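/- Let $N\ge 2$. For integers $k\ge 1$ let $$C(N,k)=\inf_{u}\frac{\int_{\mathbb R^{N+2k}}|\Delta u|^2\,dx+\int_{\mathbb R^{N+2k}}\left(|\nabla u|^2|x|^2-2k|u|^2\right)dx}{\int_{\mathbb R^{N+2k}}|\nabla u|^2\,dx}-(N+2),$$ where the infimum is over all real-valued radial functions $u\in C_c^\infty(\mathbb R^{N+2k})$, $u\not\equiv 0$, and let $C(N)=\inf_{k\ge1}C(N,k)$. Let $$E=\{\alpha e^{-\beta|x|^2}x:\ \alpha\in\mathbb R,\ \beta>0\}$$ (vector fields on $\mathbb R^N$), and for a vector field $\mathbf U:\mathbb R^N\to\mathbb R^N$ put $$\delta_3(\mathbf U)=\Big(\int_{\mathbb R^N}|\nabla \mathbf U|^2dx\Big)^{1/2}\Big(\int_{\mathbb R^N}|x|^2|\mathbf U|^2dx\Big)^{1/2}-\frac{N+2}{2}\int_{\mathbb R^N}|\mathbf U|^2dx,$$ where $|\nabla\mathbf U|^2=\sum_{i,j}(\partial_iU_j)^2$. Let $\mathcal F$ be the set of smooth vector fields $\mathbf U:\mathbb R^N\to\mathbb R^N$ that are curl-free, i.e.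 $\partial_iU_j=\partial_jU_i$ for all $i,j$, and satisfy $\int|\nabla\mathbf U|^2dx<\infty$ and $\int|x|^2|\mathbf U|^2dx<\infty$ (hence also $\int|\mathbf U|^2dx<\infty$). (a) For every $\mathbf U\in\mathcal F$, $$\delta_3(\mathbf U)\ge\frac{C(N)}2\inf_{\mathbf U^*\in E}\|\mathbf U-\mathbf U^*\|_2^2 .$$ (b) The constant $C(N)/2$ in (a) is sharp: for every $K>C(N)/2$ there is a $\mathbf U\in\mathcal F$, even one with compact support, such that $\delta_3(\mathbf U)<K\inf_{\mathbf U^*\in E}\|\mathbf U-\mathbf U^*\|_2^2$. (c) For every $\mathbf U\in\mathcal F$, $$\delta_3(\mathbf U)\ge\frac{C(N)}4\inf\left\{\|\mathbf U-\mathbf U^*\|_2^2:\ \mathbf U^*\in E,\ \|\mathbf U^*\|_2=\|\mathbf U\|_2\right\}.$$ -/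

import Mathlib

open MeasureTheory
open scoped ContDiff

noncomputable section

/-- The Euclidean space `ℝ^d`. -/
abbrev Euc (d : ℕ) : Type := EuclideanSpace ℝ (Fin d)

/-- The partial derivative `∂ᵢ Uⱼ (x)` of a vector field `U` on `ℝ^d`. -/
def pderivComp {d : ℕ} (U : Euc d → Euc d) (i j : Fin d) (x : Euc d) : ℝ :=
  fderiv ℝ U x (EuclideanSpace.single i 1) j

/-- `|∇U(x)|² = ∑ᵢⱼ (∂ᵢ Uⱼ (x))²`, the squared Hilbert-Schmidt norm of the Jacobian matrix. -/
def gradNormSq {d : ℕ} (U : Euc d → Euc d) (x : Euc d) : ℝ :=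
  ∑ i, ∑ j, (pderivComp U i j x) ^ 2

/-- The curl of a vector field on `ℝ^d`: the skew-symmetric matrix `∂ᵢ Uⱼ - ∂ⱼ Uᵢ`. -/
def curl {d : ℕ} (U : Euc d → Euc d) (x : Euc d) : Matrix (Fin d) (Fin d) ℝ :=
  Matrix.of fun i j => pderivComp U i j x - pderivComp U j i x

/-- The smooth curl-free fields on `ℝ^d` with `∫ |∇U|² < ∞` and `∫ |x|² |U|² < ∞`
(these two conditions force `∫ |U|² < ∞`). -/
structure IsCurlFreeField {d : ℕ} (U : Euc d → Euc d) : Prop where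
  smooth : ContDiff ℝ ∞ U
  curl_eq_zero : ∀ x, curl U x = 0
  integrable_grad : Integrable (fun x => gradNormSq U x)
  integrable_weight : Integrable (fun x => ‖x‖ ^ 2 * ‖U x‖ ^ 2)

/-- The deficit
`δ₃(U) = (∫ |∇U|²)^{1/2} (∫ |x|² |U|²)^{1/2} - (N+2)/2 ∫ |U|²`. -/
def deficit3 {N : ℕ} (U : Euc N → Euc N) : ℝ :=
  √(∫ x, gradNormSq U x) * √(∫ x, ‖x‖ ^ 2 * ‖U x‖ ^ 2)
    - ((N : ℝ) + 2) / 2 * ∫ x, ‖U x‖ ^ 2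

/-- The set `{α e^{-β|x|²} x : α ∈ ℝ, β > 0}` of vector fields on `ℝ^N`. -/
def ECFHUP (N : ℕ) : Set (Euc N → Euc N) :=
  {V | ∃ α β : ℝ, 0 < β ∧ V = fun x => (α * Real.exp (-β * ‖x‖ ^ 2)) • x}

/-- `inf {‖U - V‖₂² : V ∈ E_CFHUP}`. -/
def distSqE {N : ℕ} (U : Euc N → Euc N) : ℝ :=
  sInf {t : ℝ | ∃ V ∈ ECFHUP N, t = ∫ x, ‖U x - V x‖ ^ 2}

/-- `inf {‖U - V‖₂² : V ∈ E_CFHUP, ‖U‖₂² = ‖V‖₂²}`. -/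
def distSqENormalized {N : ℕ} (U : Euc N → Euc N) : ℝ :=
  sInf {t : ℝ | ∃ V ∈ ECFHUP N,
    (∫ x, ‖U x‖ ^ 2) = (∫ x, ‖V x‖ ^ 2) ∧ t = ∫ x, ‖U x - V x‖ ^ 2}

/-- The nonzero radial functions in `C_c^∞(ℝ^d)`. -/
structure IsRadialTest {d : ℕ} (u : Euc d → ℝ) : Prop where
  smooth : ContDiff ℝ ∞ u
  compactSupport : HasCompactSupport u
  radial : ∀ x y, ‖x‖ = ‖y‖ → u x = u y
  ne_zero : u ≠ 0

/-- The quotient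
`(∫ |Δu|² + ∫ (|x|² |∇u|² - 2k |u|²)) / ∫ |∇u|²` on `ℝ^{N+2k}`. -/
def radialQuotient (N k : ℕ) (u : Euc (N + 2 * k) → ℝ) : ℝ :=
  ((∫ x, (Laplacian.laplacian u x) ^ 2)
      + ∫ x, (‖gradient u x‖ ^ 2 * ‖x‖ ^ 2 - 2 * (k : ℝ) * (u x) ^ 2))
    / ∫ x, ‖gradient u x‖ ^ 2

/-- `C(N,k)`: the infimum of the quotient over radial functions on `ℝ^{N+2k}`, minus `N+2`. -/
def stabConstK (N k : ℕ) : ℝ :=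
  sInf {q : ℝ | ∃ u : Euc (N + 2 * k) → ℝ, IsRadialTest u ∧ q = radialQuotient N k u}
    - ((N : ℝ) + 2)

/-- `C(N) = inf_{k ≥ 1} C(N,k)`. -/
def stabConst (N : ℕ) : ℝ :=
  sInf {c : ℝ | ∃ k : ℕ, 1 ≤ k ∧ c = stabConstK N k}

end

/-! A smooth curl-free field is a gradient, U = ∇φ, and integration by parts turns ∫|∇U|² into
∫|Δφ|² when φ has compact support. Everything rests on one inequality at a fixed width: with Q(φ) =
∫|Δφ|² + ∫|x|²|∇φ|² - (N+2)∫|∇φ|², the form Q(φ) is at least C(N) times the squared distance of ∇φ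
to the line spanned by x e^{-|x|²/2} (`stabConst_mul_le_quadForm`). Dilating gives the same bound
for every Gaussian width (`stabConst_mul_le_width`), and the width that balances the two energies
turns the sum into twice their geometric mean, so Q becomes 2δ₃. This proves (a). For (c) one
rescales the projection to the norm of U, which at most doubles the squared distance.

The fixed-width inequality is proved by splitting φ into spherical harmonics of degree 0, degree 1
and the rest; Q and ∫|∇φ|² are additive over the pieces. For degree 0 the form is a one-dimensional
Dirichlet form with weight r^{N+1}e^{-r²}, whose gap above the Gaussian is 2 (`weighted_poincare`,
`radial_gap`). For degree 1, multiplication by xᵢ carries the form to a radial one on ℝ^{N+2},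
governed by C(N,1) ≥ C(N). The rest has gap 2, from the Poincaré inequality on the sphere and the
square (Δφ + x·∇φ + (N+1)φ)² (`two_mul_le_quadForm`). Truncated Gaussians give C(N) ≤ 2
(`stabConst_le_two`), so all three gaps dominate C(N) and no infinite expansion is needed.

Compact support is removed by a cutoff applied only to the part of φ with zero spherical mean. That
part is square integrable by the Poincaré inequality on spheres, so the cutoff errors vanish by
dominated convergence (`stabConst_mul_le_of_integrable`).

For sharpness, if Y is a solid harmonic of degree k, then Δ(Yv) is Y times the Laplacian of v in
dimension N+2k. A nearly optimal radial function in the definition of C(N,k) therefore gives a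
potential Yv with nearly optimal Q (`quadForm_harmonic`). Its gradient is orthogonal to every
Gaussian field, so the distance is its full norm, and the arithmetic-geometric mean inequality
bounds δ₃ by Q/2. -/

/-- The partial derivative `∂ᵢ φ` of a scalar function on `ℝ^d`. -/
noncomputable def pd {d : ℕ} (i : Fin d) (φ : Euc d → ℝ) (x : Euc d) : ℝ :=
  fderiv ℝ φ x (EuclideanSpace.single i 1)

/-- The Laplacian `∑ᵢ ∂ᵢ ∂ᵢ φ`. -/
noncomputable def lap {d : ℕ} (φ : Euc d → ℝ) (x : Euc d) : ℝ := ∑ i, pd i (pd i φ) x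

/-- The Euler operator `x · ∇φ`. -/
noncomputable def eul {d : ℕ} (φ : Euc d → ℝ) (x : Euc d) : ℝ := ∑ i, x i * pd i φ x

/-- The pointwise product `∇φ · ∇ψ`. -/
noncomputable def gradDot {d : ℕ} (φ ψ : Euc d → ℝ) (x : Euc d) : ℝ := ∑ i, pd i φ x * pd i ψ x

/-- Smooth compactly supported functions. -/
structure IsTest {d : ℕ} (φ : Euc d → ℝ) : Prop where
  smooth : ContDiff ℝ ∞ φ
  compact : HasCompactSupport φ

/-! ### Coordinate calculus and integration by parts against test functions. -/

section Calculus

variable {d : ℕ} {φ ψ : Euc d → ℝ}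

theorem contDiff_coord (i : Fin d) : ContDiff ℝ ∞ (fun x : Euc d => x i) :=
  (EuclideanSpace.proj (𝕜 := ℝ) i).contDiff

theorem continuous_coord (i : Fin d) : Continuous (fun x : Euc d => x i) :=
  (contDiff_coord i).continuous

theorem contDiff_pd (hφ : ContDiff ℝ ∞ φ) (i : Fin d) : ContDiff ℝ ∞ (pd i φ) :=
  (hφ.fderiv_right (m := ∞) (by simp)).clm_apply contDiff_const

theorem differentiable_of_smooth {E F : Type*} [NormedAddCommGroup E] [NormedSpace ℝ E]
    [NormedAddCommGroup F] [NormedSpace ℝ F] {f : E → F} (hf : ContDiff ℝ ∞ f) :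
    Differentiable ℝ f := hf.differentiable (by simp)

theorem contDiff_gradDot (hφ : ContDiff ℝ ∞ φ) (hψ : ContDiff ℝ ∞ ψ) :
    ContDiff ℝ ∞ (gradDot φ ψ) :=
  ContDiff.sum fun i _ => (contDiff_pd hφ i).mul (contDiff_pd hψ i)

theorem pd_coord (i j : Fin d) (x : Euc d) :
    pd i (fun y => y j) x = if i = j then 1 else 0 := by
  have : fderiv ℝ (fun y : Euc d => y j) x = EuclideanSpace.proj (𝕜 := ℝ) j :=
    (EuclideanSpace.proj (𝕜 := ℝ) j).hasFDerivAt.fderiv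
  rw [pd, this]
  simp [eq_comm]

theorem pd_add (hφ : ContDiff ℝ ∞ φ) (hψ : ContDiff ℝ ∞ ψ) (i : Fin d) :
    pd i (fun x => φ x + ψ x) = fun x => pd i φ x + pd i ψ x := by
  funext x
  rw [pd, fderiv_fun_add (differentiable_of_smooth hφ x) (differentiable_of_smooth hψ x)]
  rfl

theorem pd_sub (hφ : ContDiff ℝ ∞ φ) (hψ : ContDiff ℝ ∞ ψ) (i : Fin d) :
    pd i (fun x => φ x - ψ x) = fun x => pd i φ x - pd i ψ x := by
  funext x
  rw [pd, fderiv_fun_sub (differentiable_of_smooth hφ x) (differentiable_of_smooth hψ x)]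
  rfl

theorem pd_mul (hφ : ContDiff ℝ ∞ φ) (hψ : ContDiff ℝ ∞ ψ) (i : Fin d) :
    pd i (fun x => φ x * ψ x) = fun x => pd i φ x * ψ x + φ x * pd i ψ x := by
  funext x
  rw [pd, fderiv_fun_mul (differentiable_of_smooth hφ x) (differentiable_of_smooth hψ x)]
  simp [pd]
  ring

theorem pd_const (c : ℝ) (i : Fin d) : pd i (fun _ => c) = fun _ => 0 := by
  funext x
  simp [pd]

theorem pd_const_mul (hφ : ContDiff ℝ ∞ φ) (c : ℝ) (i : Fin d) :
    pd i (fun x => c * φ x) = fun x => c * pd i φ x := by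
  rw [pd_mul contDiff_const hφ, pd_const]
  simp

theorem pd_sum {ι : Type*} (s : Finset ι) {f : ι → Euc d → ℝ} (hf : ∀ j, ContDiff ℝ ∞ (f j))
    (i : Fin d) : pd i (fun x => ∑ j ∈ s, f j x) = fun x => ∑ j ∈ s, pd i (f j) x := by
  funext x
  rw [pd, fderiv_fun_sum fun j _ => differentiable_of_smooth (hf j) x]
  simp [pd]

theorem pd_comm (hφ : ContDiff ℝ ∞ φ) (i j : Fin d) : pd i (pd j φ) = pd j (pd i φ) := by
  funext x
  have hd : DifferentiableAt ℝ (fderiv ℝ φ) x :=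
    differentiable_of_smooth (hφ.fderiv_right (m := ∞) (by simp)) x
  have hs : IsSymmSndFDerivAt ℝ φ x :=
    hφ.contDiffAt.isSymmSndFDerivAt (by simpa using WithTop.coe_le_coe.2 (le_top : (2 : ℕ∞) ≤ ⊤))
  have key : ∀ k l : Fin d, pd k (pd l φ) x =
      fderiv ℝ (fderiv ℝ φ) x (EuclideanSpace.single k 1) (EuclideanSpace.single l 1) := by
    intro k l
    have h : pd l φ = fun y => fderiv ℝ φ y (EuclideanSpace.single l 1) := rfl
    rw [pd, h, fderiv_clm_apply hd (differentiableAt_const _)]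
    simp
  rw [key, key, hs.eq]

theorem fderiv_apply_eq_sum_pd (φ : Euc d → ℝ) (x v : Euc d) :
    fderiv ℝ φ x v = ∑ i, v i * pd i φ x := by
  have hv : v = ∑ i, v i • EuclideanSpace.single i (1 : ℝ) := by
    ext j
    simp [Finset.sum_apply, Pi.single_apply]
  conv_lhs => rw [hv]
  simp [pd]

theorem norm_sq_eq_sum (x : Euc d) : ‖x‖ ^ 2 = ∑ i, x i ^ 2 := by
  simp [EuclideanSpace.norm_sq_eq]

theorem contDiff_normSq : ContDiff ℝ ∞ (fun x : Euc d => ‖x‖ ^ 2) := contDiff_norm_sq ℝ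

theorem pd_normSq (i : Fin d) (x : Euc d) : pd i (fun y => ‖y‖ ^ 2) x = 2 * x i := by
  have h : (fun y : Euc d => ‖y‖ ^ 2) = fun y => ∑ j, y j * y j := by
    funext y
    rw [norm_sq_eq_sum]
    simp only [sq]
  rw [h, pd_sum _ fun j => (contDiff_coord j).mul (contDiff_coord j)]
  simp only [pd_mul (contDiff_coord _) (contDiff_coord _), pd_coord]
  simp [Finset.sum_add_distrib]
  ring

theorem hasCompactSupport_pd (h : HasCompactSupport φ) (i : Fin d) :
    HasCompactSupport (pd i φ) :=
  h.fderiv_apply (𝕜 := ℝ) _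

namespace IsTest

theorem pd (h : IsTest φ) (i : Fin d) : IsTest (pd i φ) :=
  ⟨contDiff_pd h.smooth i, hasCompactSupport_pd h.compact i⟩

theorem continuous (h : IsTest φ) : Continuous φ := h.smooth.continuous

theorem integrable (h : IsTest φ) : Integrable φ := h.continuous.integrable_of_hasCompactSupport
  h.compact

theorem mul_left (h : IsTest φ) {f : Euc d → ℝ} (hf : ContDiff ℝ ∞ f) :
    IsTest (fun x => f x * φ x) := ⟨hf.mul h.smooth, h.compact.mul_left⟩

theorem mul_right (h : IsTest φ) {f : Euc d → ℝ} (hf : ContDiff ℝ ∞ f) :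
    IsTest (fun x => φ x * f x) := ⟨h.smooth.mul hf, h.compact.mul_right⟩

theorem add (h : IsTest φ) (h' : IsTest ψ) : IsTest (fun x => φ x + ψ x) :=
  ⟨h.smooth.add h'.smooth, h.compact.add h'.compact⟩

theorem sub (h : IsTest φ) (h' : IsTest ψ) : IsTest (fun x => φ x - ψ x) :=
  ⟨h.smooth.sub h'.smooth, h.compact.sub h'.compact⟩

theorem zero : IsTest (fun _ : Euc d => (0 : ℝ)) := ⟨contDiff_const, HasCompactSupport.zero⟩

theorem sum {ι : Type*} (s : Finset ι) {f : ι → Euc d → ℝ} (hf : ∀ j, IsTest (f j)) :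
    IsTest (fun x => ∑ j ∈ s, f j x) := by
  classical
  induction s using Finset.induction_on with
  | empty => simpa using zero
  | insert a s ha ih => simpa [Finset.sum_insert ha] using (hf a).add ih

theorem lap (h : IsTest φ) : IsTest (lap φ) := sum _ fun i => (h.pd i).pd i

theorem eul (h : IsTest φ) : IsTest (eul φ) := sum _ fun i => (h.pd i).mul_left (contDiff_coord i)

theorem gradDot (h : IsTest φ) (h' : IsTest ψ) : IsTest (gradDot φ ψ) :=
  sum _ fun i => (h.pd i).mul_right (h'.pd i).smooth

theorem integrable_mul (h : IsTest φ) {f : Euc d → ℝ} (hf : Continuous f) :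
    Integrable (fun x => φ x * f x) :=
  (h.continuous.mul hf).integrable_of_hasCompactSupport h.compact.mul_right

theorem integrable_mul_left (h : IsTest φ) {f : Euc d → ℝ} (hf : Continuous f) :
    Integrable (fun x => f x * φ x) :=
  (hf.mul h.continuous).integrable_of_hasCompactSupport h.compact.mul_left

end IsTest

theorem integral_pd_mul {f : Euc d → ℝ} (hf : ContDiff ℝ ∞ f) (hφ : IsTest φ) (i : Fin d) :
    ∫ x, pd i f x * φ x = -∫ x, f x * pd i φ x := by
  have := integral_mul_fderiv_eq_neg_fderiv_mul_of_integrable (μ := volume) (𝕜 := ℝ)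
    (f := φ) (g := f) (v := EuclideanSpace.single i 1)
    ((hφ.pd i).integrable_mul hf.continuous)
    (hφ.integrable_mul (contDiff_pd hf i).continuous) (hφ.integrable_mul hf.continuous)
    (fun x _ => differentiable_of_smooth hφ.smooth x) (fun x _ => differentiable_of_smooth hf x)
  simp only [pd, mul_comm] at this ⊢
  exact this

theorem integral_eul (hφ : IsTest φ) : ∫ x, eul φ x = -(d : ℝ) * ∫ x, φ x := by
  simp only [eul]
  rw [integral_finsetSum _ fun i _ => (hφ.pd i).integrable_mul_left (continuous_coord i)]
  have h : ∀ i : Fin d, ∫ x : Euc d, x i * pd i φ x = -∫ x, φ x := by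
    intro i
    have := integral_pd_mul (contDiff_coord i) hφ i
    simp only [pd_coord, if_true, one_mul] at this
    linarith
  simp [h]

theorem integral_gradDot {f : Euc d → ℝ} (hf : ContDiff ℝ ∞ f) (hφ : IsTest φ) :
    ∫ x, gradDot f φ x = -∫ x, f x * lap φ x := by
  simp only [gradDot, lap, Finset.mul_sum]
  rw [integral_finsetSum _ fun i _ =>
      (hφ.pd i).integrable_mul_left (contDiff_pd hf i).continuous,
    integral_finsetSum _ fun i _ => ((hφ.pd i).pd i).integrable_mul_left hf.continuous,
    ← Finset.sum_neg_distrib]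
  exact Finset.sum_congr rfl fun i _ => integral_pd_mul hf (hφ.pd i) i

theorem integral_mul_lap_comm {f : Euc d → ℝ} (hf : ContDiff ℝ ∞ f) (hφ : IsTest φ) :
    ∫ x, f x * lap φ x = ∫ x, lap f x * φ x := by
  simp only [lap, Finset.mul_sum, Finset.sum_mul]
  rw [integral_finsetSum _ fun i _ => ((hφ.pd i).pd i).integrable_mul_left hf.continuous,
    integral_finsetSum _ fun i _ =>
      hφ.integrable_mul_left (contDiff_pd (contDiff_pd hf i) i).continuous]
  refine Finset.sum_congr rfl fun i _ => ?_
  rw [integral_pd_mul (contDiff_pd hf i) hφ, integral_pd_mul hf (hφ.pd i), neg_neg]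

theorem integral_normSq_gradDot {f : Euc d → ℝ} (hf : ContDiff ℝ ∞ f) (hφ : IsTest φ) :
    ∫ x, ‖x‖ ^ 2 * gradDot f φ x = -∫ x, f x * (‖x‖ ^ 2 * lap φ x + 2 * eul φ x) := by
  simp only [gradDot, lap, eul, Finset.mul_sum, ← Finset.sum_add_distrib]
  have ht : ∀ i, IsTest (fun x => ‖x‖ ^ 2 * pd i φ x) := fun i =>
    (hφ.pd i).mul_left contDiff_normSq
  have h0 : ∀ i x, f x * (‖x‖ ^ 2 * pd i (pd i φ) x + 2 * (x i * pd i φ x)) =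
      f x * pd i (fun x => ‖x‖ ^ 2 * pd i φ x) x := by
    intro i x
    simp only [pd_mul contDiff_normSq (hφ.pd i).smooth, pd_normSq]
    ring
  have h1 : ∀ i x, ‖x‖ ^ 2 * (pd i f x * pd i φ x) = pd i f x * (‖x‖ ^ 2 * pd i φ x) := by
    intro i x; ring
  simp only [h0, h1]
  rw [integral_finsetSum _ fun i _ => (ht i).integrable_mul_left (contDiff_pd hf i).continuous,
    integral_finsetSum _ fun i _ => ((ht i).pd i).integrable_mul_left hf.continuous,
    ← Finset.sum_neg_distrib]
  exact Finset.sum_congr rfl fun i _ => integral_pd_mul hf (ht i) i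

/-- Two integrations by parts exchange the roles of i and j, since third derivatives commute. This
is what lets the energy of a gradient field be written with the Laplacian alone. -/
theorem integral_hessian_sq (hφ : IsTest φ) :
    ∫ x, ∑ i, ∑ j, (pd i (pd j φ) x) ^ 2 = ∫ x, lap φ x ^ 2 := by
  have hsq : ∀ x, lap φ x ^ 2 = ∑ i, ∑ j, pd i (pd i φ) x * pd j (pd j φ) x := by
    intro x; rw [sq, lap, Finset.sum_mul_sum]
  simp only [hsq, sq]
  rw [integral_finsetSum _ fun i _ => integrable_finsetSum _ fun j _ =>
      ((hφ.pd j).pd i).integrable_mul ((hφ.pd j).pd i).continuous,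
    integral_finsetSum _ fun i _ => integrable_finsetSum _ fun j _ =>
      ((hφ.pd i).pd i).integrable_mul ((hφ.pd j).pd j).continuous]
  refine Finset.sum_congr rfl fun i _ => ?_
  rw [integral_finsetSum _ fun j _ =>
      ((hφ.pd j).pd i).integrable_mul ((hφ.pd j).pd i).continuous,
    integral_finsetSum _ fun j _ =>
      ((hφ.pd i).pd i).integrable_mul ((hφ.pd j).pd j).continuous]
  refine Finset.sum_congr rfl fun j _ => ?_
  have h1 := integral_pd_mul (hφ.pd i).smooth ((hφ.pd j).pd j) i
  have h2 := integral_pd_mul (hφ.pd i).smooth ((hφ.pd j).pd i) j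
  rw [h1, pd_comm (hφ.pd j).smooth i j, ← h2, pd_comm hφ.smooth j i]

theorem integral_mul_eul (hφ : IsTest φ) :
    ∫ x, φ x * eul φ x = -(d : ℝ) / 2 * ∫ x, φ x ^ 2 := by
  have h := integral_eul (hφ.mul_right hφ.smooth)
  have h2 : ∀ x, eul (fun x => φ x * φ x) x = 2 * (φ x * eul φ x) := by
    intro x
    simp only [eul, pd_mul hφ.smooth hφ.smooth, Finset.mul_sum]
    exact Finset.sum_congr rfl fun i _ => by ring
  simp only [h2, integral_const_mul] at h
  simp only [← sq] at h
  linarith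

theorem pd_eul (hφ : ContDiff ℝ ∞ φ) (i : Fin d) (x : Euc d) :
    pd i (eul φ) x = pd i φ x + eul (pd i φ) x := by
  have h : eul φ = fun x => ∑ j, x j * pd j φ x := rfl
  rw [h, pd_sum _ fun j => (contDiff_coord j).mul (contDiff_pd hφ j)]
  simp only [pd_mul (contDiff_coord _) (contDiff_pd hφ _), pd_coord, eul,
    Finset.sum_add_distrib, ite_mul, one_mul, zero_mul, Finset.sum_ite_eq, Finset.mem_univ, if_true]
  congr 1
  exact Finset.sum_congr rfl fun j _ => by rw [pd_comm hφ i j]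

/-- A Rellich-Pohozaev identity: ∇(x·∇φ)·∇φ = |∇φ|² + ½ x·∇|∇φ|², and the Euler operator integrates
to -d times the integral. -/
theorem integral_lap_mul_eul (hφ : IsTest φ) :
    ∫ x, lap φ x * eul φ x = ((d : ℝ) - 2) / 2 * ∫ x, gradDot φ φ x := by
  have h1 := integral_gradDot hφ.eul.smooth hφ
  have h2 : ∀ x, gradDot (eul φ) φ x = gradDot φ φ x + 1 / 2 * eul (gradDot φ φ) x := by
    intro x
    have h : gradDot φ φ = fun x => ∑ j, pd j φ x * pd j φ x := rfl
    have h' : ∀ i, pd i (gradDot φ φ) x = ∑ j, 2 * (pd j φ x * pd i (pd j φ) x) := by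
      intro i
      rw [h, pd_sum _ fun j => (hφ.pd j).smooth.mul (hφ.pd j).smooth]
      refine Finset.sum_congr rfl fun j _ => ?_
      rw [pd_mul (hφ.pd j).smooth (hφ.pd j).smooth]
      ring
    simp only [gradDot, pd_eul hφ.smooth, add_mul, Finset.sum_add_distrib]
    congr 1
    simp only [eul, Finset.sum_mul, h', Finset.mul_sum]
    rw [Finset.sum_comm]
    refine Finset.sum_congr rfl fun i _ => ?_
    refine (Finset.sum_congr rfl fun j _ => ?_)
    ring
  simp only [h2] at h1
  rw [integral_add (hφ.gradDot hφ).integrable ((hφ.gradDot hφ).eul.integrable.const_mul _),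
    integral_const_mul, integral_eul (hφ.gradDot hφ)] at h1
  simp only [mul_comm (lap φ _)]
  linarith

/-- The expansion of `∫ (Δφ + x · ∇φ + c φ)²`. -/
theorem integral_sq_lap_add_eul (hφ : IsTest φ) (c : ℝ) :
    ∫ x, (lap φ x + eul φ x + c * φ x) ^ 2 =
      (∫ x, lap φ x ^ 2) + (∫ x, eul φ x ^ 2) + ((d : ℝ) - 2 - 2 * c) * (∫ x, gradDot φ φ x)
        + (c ^ 2 - c * d) * ∫ x, φ x ^ 2 := by
  have e : ∀ x, (lap φ x + eul φ x + c * φ x) ^ 2 =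
      lap φ x ^ 2 + (eul φ x ^ 2 + (2 * (lap φ x * eul φ x) + (2 * c * (φ x * lap φ x)
        + (2 * c * (φ x * eul φ x) + c ^ 2 * φ x ^ 2)))) := by
    intro x; ring
  have i1 : Integrable fun x => lap φ x ^ 2 := by
    simpa [sq] using hφ.lap.integrable_mul hφ.lap.continuous
  have i2 : Integrable fun x => eul φ x ^ 2 := by
    simpa [sq] using hφ.eul.integrable_mul hφ.eul.continuous
  have i3 : Integrable fun x => 2 * (lap φ x * eul φ x) :=
    (hφ.lap.integrable_mul hφ.eul.continuous).const_mul _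
  have i4 : Integrable fun x => 2 * c * (φ x * lap φ x) :=
    (hφ.integrable_mul hφ.lap.continuous).const_mul _
  have i5 : Integrable fun x => 2 * c * (φ x * eul φ x) :=
    (hφ.integrable_mul hφ.eul.continuous).const_mul _
  have i6 : Integrable fun x => c ^ 2 * φ x ^ 2 := by
    simpa only [sq (φ _)] using (hφ.integrable_mul hφ.continuous).const_mul (c ^ 2)
  simp only [e]
  rw [integral_add i1 (i2.fun_add (i3.fun_add (i4.fun_add (i5.fun_add i6)))),
    integral_add i2 (i3.fun_add (i4.fun_add (i5.fun_add i6))), integral_add i3 (i4.fun_add (i5.fun_add i6)),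
    integral_add i4 (i5.fun_add i6), integral_add i5 i6]
  simp only [integral_const_mul]
  have h1 := integral_gradDot hφ.smooth hφ
  rw [integral_lap_mul_eul hφ, integral_mul_eul hφ, h1]
  ring

theorem eul_sq_le (φ : Euc d → ℝ) (x : Euc d) : eul φ x ^ 2 ≤ ‖x‖ ^ 2 * gradDot φ φ x := by
  have := Finset.sum_mul_sq_le_sq_mul_sq Finset.univ (fun i => x i) (fun i => pd i φ x)
  rw [norm_sq_eq_sum]
  simpa [eul, gradDot, sq] using this

theorem gradDot_self_nonneg (φ : Euc d → ℝ) (x : Euc d) : 0 ≤ gradDot φ φ x :=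
  Finset.sum_nonneg fun _ _ => mul_self_nonneg _

end Calculus

/-! ### Differentiation under the integral along rays, and division by r. -/

section Parametric

universe u

theorem hasDerivAt_integral_ray {T : Type*} [TopologicalSpace T] [CompactSpace T]
    [MeasurableSpace T] [OpensMeasurableSpace T] (μ : Measure T) [IsFiniteMeasure μ]
    {E F : Type*} [NormedAddCommGroup E] [NormedSpace ℝ E] [NormedAddCommGroup F] [NormedSpace ℝ F]
    {γ : T → E} (hγ : Continuous γ) {φ : E → F} (hφ : ContDiff ℝ ∞ φ)
    {ρ : T → F →L[ℝ] ℝ} (hρ : Continuous ρ) (r : ℝ) :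
    HasDerivAt (fun r : ℝ => ∫ τ, ρ τ (φ (r • γ τ)) ∂μ)
      (∫ τ, ρ τ (fderiv ℝ φ (r • γ τ) (γ τ)) ∂μ) r := by
  have hφc := hφ.continuous
  have hφ' : Continuous (fderiv ℝ φ) := hφ.continuous_fderiv (by simp)
  have hint : ∀ {g : T → ℝ}, Continuous g → Integrable g μ := fun hg =>
    hg.integrable_of_hasCompactSupport (HasCompactSupport.of_compactSpace _)
  have hcont : Continuous fun p : ℝ × T => ρ p.2 (fderiv ℝ φ (p.1 • γ p.2) (γ p.2)) := by
    fun_prop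
  obtain ⟨M, hM⟩ := ((isCompact_Icc (a := r - 1) (b := r + 1)).prod
    (isCompact_univ (X := T))).bddAbove_image hcont.norm.continuousOn
  have hs : Set.Icc (r - 1) (r + 1) ∈ nhds r := Icc_mem_nhds (by linarith) (by linarith)
  refine (hasDerivAt_integral_of_dominated_loc_of_deriv_le (μ := μ)
    (F := fun (r : ℝ) τ => ρ τ (φ (r • γ τ)))
    (F' := fun r τ => ρ τ (fderiv ℝ φ (r • γ τ) (γ τ))) (bound := fun _ => M) hs
    (Filter.Eventually.of_forall fun x => ?_) (hint (by fun_prop)) ?_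
    (Filter.Eventually.of_forall fun τ x hx => ?_) (integrable_const _)
    (Filter.Eventually.of_forall fun τ x _ => ?_)).2
  · exact Integrable.aestronglyMeasurable (hint (by fun_prop))
  · exact Integrable.aestronglyMeasurable (hint (by fun_prop))
  · exact hM ⟨(x, τ), ⟨hx, Set.mem_univ _⟩, rfl⟩
  · have h1 : HasDerivAt (fun x : ℝ => x • γ τ) (γ τ) x := by
      simpa using (hasDerivAt_id x).smul_const (γ τ)
    exact (ρ τ).hasFDerivAt.comp_hasDerivAt x
      (((differentiable_of_smooth hφ) _).hasFDerivAt.comp_hasDerivAt x h1)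

/-- The r-derivative is an integral of the same shape, with φ replaced by its derivative and F by E
→L F. The weight ρ takes values in functionals on F precisely so that this induction closes; the
common universe of E and F keeps E →L F in the same class. -/
theorem contDiff_integral_ray {T : Type*} [TopologicalSpace T] [CompactSpace T]
    [MeasurableSpace T] [OpensMeasurableSpace T] (μ : Measure T) [IsFiniteMeasure μ]
    {E F : Type u} [NormedAddCommGroup E] [NormedSpace ℝ E] [NormedAddCommGroup F]
    [NormedSpace ℝ F] {γ : T → E} (hγ : Continuous γ) {φ : E → F} (hφ : ContDiff ℝ ∞ φ)
    {ρ : T → F →L[ℝ] ℝ} (hρ : Continuous ρ) :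
    ContDiff ℝ ∞ (fun r : ℝ => ∫ τ, ρ τ (φ (r • γ τ)) ∂μ) := by
  rw [contDiff_infty]
  intro n
  induction n generalizing F with
  | zero =>
    exact contDiff_zero.2 (continuous_iff_continuousAt.2 fun r =>
      (hasDerivAt_integral_ray μ hγ hφ hρ r).continuousAt)
  | succ n ih =>
    push_cast
    rw [contDiff_succ_iff_deriv]
    refine ⟨fun r => (hasDerivAt_integral_ray μ hγ hφ hρ r).differentiableAt, by simp, ?_⟩
    have h := ih (F := E →L[ℝ] F) (φ := fderiv ℝ φ) (hφ.fderiv_right (by simp))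
      (ρ := fun τ => (ρ τ).comp (ContinuousLinearMap.apply ℝ F (γ τ))) (by fun_prop)
    have e : deriv (fun r : ℝ => ∫ τ, ρ τ (φ (r • γ τ)) ∂μ) = fun r : ℝ =>
        ∫ τ, (ρ τ ∘SL (ContinuousLinearMap.apply ℝ F) (γ τ)) (fderiv ℝ φ (r • γ τ)) ∂μ :=
      funext fun r => (hasDerivAt_integral_ray μ hγ hφ hρ r).deriv
    rw [e]
    exact h

/-- Hadamard's lemma on the line. -/
theorem exists_contDiff_eq_id_mul {f : ℝ → ℝ} (hf : ContDiff ℝ ∞ f) (h0 : f 0 = 0) :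
    ∃ g : ℝ → ℝ, ContDiff ℝ ∞ g ∧ ∀ r, f r = r * g r := by
  have hf' : ContDiff ℝ ∞ (deriv f) := (contDiff_infty_iff_deriv.1 hf).2
  refine ⟨fun r => ∫ τ : Set.Icc (0 : ℝ) 1, deriv f (r • (τ : ℝ)), ?_, fun r => ?_⟩
  · exact contDiff_integral_ray volume (γ := fun τ : Set.Icc (0 : ℝ) 1 => (τ : ℝ))
      continuous_subtype_val hf' (ρ := fun _ => ContinuousLinearMap.id ℝ ℝ) continuous_const
  · have h1 : ∫ τ : Set.Icc (0 : ℝ) 1, deriv f (r • (τ : ℝ)) = ∫ t in (0 : ℝ)..1, deriv f (r * t) := by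
      rw [intervalIntegral.integral_of_le zero_le_one, ← integral_Icc_eq_integral_Ioc]
      exact integral_subtype_comap measurableSet_Icc fun t => deriv f (r * t)
    simp only [h1]
    have h2 : ∫ t in (0 : ℝ)..1, r * deriv f (r * t) = f (r * 1) - f (r * 0) := by
      refine intervalIntegral.integral_eq_sub_of_hasDerivAt (f := fun t => f (r * t)) (fun t _ => ?_)
        (Continuous.intervalIntegrable (by have := hf'.continuous; fun_prop) _ _)
      have h3 : HasDerivAt (fun t : ℝ => r * t) r t := by
        simpa using (hasDerivAt_id t).const_mul r
      have h4 := (differentiable_of_smooth hf (r * t)).hasDerivAt.comp t h3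
      rw [mul_comm] at h4
      exact h4
    rw [intervalIntegral.integral_const_mul] at h2
    rw [h2]
    simp [h0]

end Parametric

/-! ### Even profiles and smooth radial functions. -/

/-- Smooth even functions on the line, the profiles of smooth radial functions. -/
structure EvenSmooth (f : ℝ → ℝ) : Prop where
  smooth : ContDiff ℝ ∞ f
  even : ∀ r, f (-r) = f r

namespace EvenSmooth

variable {f g : ℝ → ℝ}

theorem of_odd_div (hf : ContDiff ℝ ∞ f) (hodd : ∀ r, f (-r) = -f r) :
    ∃ g : ℝ → ℝ, EvenSmooth g ∧ ∀ r, f r = r * g r := by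
  have h0 : f 0 = 0 := by
    have := hodd 0
    simp only [neg_zero] at this
    linarith
  obtain ⟨g, hg, h⟩ := exists_contDiff_eq_id_mul hf h0
  refine ⟨g, ⟨hg, fun r => ?_⟩, h⟩
  rcases eq_or_ne r 0 with rfl | hr
  · simp
  · have := hodd r
    rw [h, h r] at this
    have h2 : r * g (-r) = r * g r := by linarith
    exact mul_left_cancel₀ hr h2

theorem deriv_odd (hf : EvenSmooth f) (r : ℝ) : deriv f (-r) = -deriv f r := by
  have h := deriv_comp_neg f r
  have h2 : (fun x => f (-x)) = f := funext hf.even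
  rw [h2] at h
  linarith

theorem exists_rdiv (hf : EvenSmooth f) :
    ∃ g : ℝ → ℝ, EvenSmooth g ∧ ∀ r, deriv f r = r * g r :=
  of_odd_div (contDiff_infty_iff_deriv.1 hf.smooth).2 hf.deriv_odd

theorem hasFDerivAt_comp_norm {E : Type*} [NormedAddCommGroup E] [InnerProductSpace ℝ E]
    (hf : EvenSmooth f) (hg : ∀ r, deriv f r = r * g r) (x : E) :
    HasFDerivAt (fun x : E => f ‖x‖) (g ‖x‖ • innerSL ℝ x) x := by
  rcases eq_or_ne x 0 with rfl | hx
  -- The norm is not differentiable at the origin, but f'(0) = 0, so f(‖x‖) - f(0) is o(‖x‖).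
  · have h0 : HasDerivAt f 0 ‖(0 : E)‖ := by
      have := (differentiable_of_smooth hf.smooth 0).hasDerivAt
      rw [hg] at this
      simpa using this
    have h1 : (fun x : E => ‖x‖ - ‖(0 : E)‖) =O[nhds 0] fun x : E => x - 0 := by
      simpa using (Asymptotics.isBigO_refl (fun x : E => x) (nhds 0)).norm_left
    have h2 := h0.isLittleO.comp_tendsto (continuous_norm.tendsto (0 : E))
    refine HasFDerivAt.of_isLittleO ?_
    simp only [map_zero, smul_zero, zero_apply, sub_zero]
    refine (Asymptotics.IsLittleO.trans_isBigO ?_ h1).congr_right (by simp)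
    simpa [Function.comp_def] using h2
  · have h1 : HasFDerivAt (fun x : E => ‖x‖) (‖x‖⁻¹ • innerSL ℝ x) x :=
      (hasStrictFDerivAt_norm_sq x).hasFDerivAt.sqrt (by positivity) |>.congr_of_eventuallyEq
        (Filter.Eventually.of_forall fun y => by simp) |>.congr_fderiv (by
          ext v
          have : ‖x‖ ≠ 0 := norm_ne_zero_iff.2 hx
          simp
          ring)
    have h2 := (differentiable_of_smooth hf.smooth ‖x‖).hasDerivAt.comp_hasFDerivAt x h1
    refine h2.congr_fderiv ?_
    have : ‖x‖ ≠ 0 := norm_ne_zero_iff.2 hx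
    rw [hg, smul_smul]
    congr 1
    field_simp

/-- The derivative at x is (f'/r)(‖x‖) times the functional ⟨x, ·⟩, and f'/r is again smooth and
even; the smoothness order can thus be raised one step at a time. -/
theorem contDiff_comp_norm {E : Type*} [NormedAddCommGroup E] [InnerProductSpace ℝ E]
    (hf : EvenSmooth f) : ContDiff ℝ ∞ (fun x : E => f ‖x‖) := by
  rw [contDiff_infty]
  intro n
  induction n generalizing f with
  | zero => exact contDiff_zero.2 (hf.smooth.continuous.comp continuous_norm)
  | succ n ih =>
    obtain ⟨g, hg, h⟩ := hf.exists_rdiv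
    push_cast
    rw [contDiff_succ_iff_fderiv]
    refine ⟨fun x => (hf.hasFDerivAt_comp_norm h x).differentiableAt, by simp, ?_⟩
    have : fderiv ℝ (fun x : E => f ‖x‖) = fun x => g ‖x‖ • innerSL ℝ x :=
      funext fun x => (hf.hasFDerivAt_comp_norm h x).fderiv
    rw [this]
    exact (ih hg).smul (innerSL ℝ (E := E)).contDiff

theorem pd_comp_norm {d : ℕ} (hf : EvenSmooth f) (hg : ∀ r, deriv f r = r * g r) (i : Fin d)
    (x : Euc d) : pd i (fun x => f ‖x‖) x = x i * g ‖x‖ := by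
  rw [pd, (hf.hasFDerivAt_comp_norm hg x).fderiv]
  simp [mul_comm, EuclideanSpace.inner_single_right]

theorem continuous (hf : EvenSmooth f) : Continuous f := hf.smooth.continuous

theorem mul (hf : EvenSmooth f) (hg : EvenSmooth g) : EvenSmooth fun r => f r * g r :=
  ⟨hf.smooth.mul hg.smooth, fun r => by rw [hf.even, hg.even]⟩

theorem const (c : ℝ) : EvenSmooth fun _ => c := ⟨contDiff_const, fun _ => rfl⟩

/-- The profile of a smooth radial function is even and smooth. -/
theorem of_radial {d : ℕ} (i : Fin d) {u : Euc d → ℝ} (hu : ContDiff ℝ ∞ u)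
    (hr : ∀ x y, ‖x‖ = ‖y‖ → u x = u y) :
    EvenSmooth (fun r : ℝ => u (EuclideanSpace.single i r)) ∧
      ∀ x, u x = u (EuclideanSpace.single i ‖x‖) := by
  refine ⟨⟨?_, fun r => hr _ _ (by simp)⟩, fun x => hr _ _ (by simp)⟩
  have h : (fun r : ℝ => u (EuclideanSpace.single i r)) =
      fun r : ℝ => u (r • EuclideanSpace.single i (1 : ℝ)) := by
    funext r
    congr 1
    ext j
    simp
  rw [h]
  exact hu.comp (contDiff_id.smul contDiff_const)

end EvenSmooth

/-! ### Integration on the sphere, polar coordinates, and infinitesimal rotations. -/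

/-- The integral of a function over the unit sphere of `ℝ^d`. -/
noncomputable def sphInt {d : ℕ} (f : Euc d → ℝ) : ℝ :=
  ∫ w : Metric.sphere (0 : Euc d) 1, f w ∂(volume : Measure (Euc d)).toSphere

/-- The infinitesimal rotation `xᵢ ∂ⱼ - xⱼ ∂ᵢ`. -/
noncomputable def rot {d : ℕ} (i j : Fin d) (f : Euc d → ℝ) (x : Euc d) : ℝ :=
  x i * pd j f x - x j * pd i f x

section Sphere

variable {d : ℕ}

theorem integrable_sphere {f : Metric.sphere (0 : Euc d) 1 → ℝ} (hf : Continuous f) :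
    Integrable f (volume : Measure (Euc d)).toSphere :=
  hf.integrable_of_hasCompactSupport (HasCompactSupport.of_compactSpace _)

theorem integrable_sphere_coe {f : Euc d → ℝ} (hf : Continuous f) :
    Integrable (fun w : Metric.sphere (0 : Euc d) 1 => f w) (volume : Measure (Euc d)).toSphere :=
  integrable_sphere (hf.comp continuous_subtype_val)

theorem sphInt_add {f g : Euc d → ℝ} (hf : Continuous f) (hg : Continuous g) :
    sphInt (fun x => f x + g x) = sphInt f + sphInt g :=
  integral_add (integrable_sphere_coe hf) (integrable_sphere_coe hg)

theorem sphInt_sub {f g : Euc d → ℝ} (hf : Continuous f) (hg : Continuous g) :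
    sphInt (fun x => f x - g x) = sphInt f - sphInt g :=
  integral_sub (integrable_sphere_coe hf) (integrable_sphere_coe hg)

theorem sphInt_const_mul (c : ℝ) (f : Euc d → ℝ) : sphInt (fun x => c * f x) = c * sphInt f :=
  integral_const_mul _ _

theorem sphInt_mul_const (c : ℝ) (f : Euc d → ℝ) : sphInt (fun x => f x * c) = sphInt f * c :=
  integral_mul_const _ _

theorem sphInt_sum {ι : Type*} (s : Finset ι) {f : ι → Euc d → ℝ} (hf : ∀ i, Continuous (f i)) :
    sphInt (fun x => ∑ i ∈ s, f i x) = ∑ i ∈ s, sphInt (f i) :=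
  integral_finsetSum _ fun i _ => integrable_sphere_coe (hf i)

theorem sphInt_congr {f g : Euc d → ℝ} (h : ∀ x, ‖x‖ = 1 → f x = g x) : sphInt f = sphInt g :=
  integral_congr_ae (Filter.Eventually.of_forall fun w => h w (by simp))

theorem sphInt_mono {f g : Euc d → ℝ} (hf : Continuous f) (hg : Continuous g)
    (h : ∀ x, ‖x‖ = 1 → f x ≤ g x) : sphInt f ≤ sphInt g :=
  integral_mono (integrable_sphere_coe hf) (integrable_sphere_coe hg) fun w => h w (by simp)

theorem sphInt_nonneg {f : Euc d → ℝ} (h : ∀ x, 0 ≤ f x) : 0 ≤ sphInt f :=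
  integral_nonneg fun w => h w

theorem sphInt_const (c : ℝ) : sphInt (fun _ : Euc d => c) = sphInt (fun _ : Euc d => 1) * c := by
  simp [sphInt]

theorem continuous_sphInt_smul {f : Euc d → ℝ} (hf : Continuous f) :
    Continuous fun r : ℝ => sphInt fun w => f (r • w) := by
  have h := continuous_parametric_integral_of_continuous (X := ℝ)
    (Y := Metric.sphere (0 : Euc d) 1)
    (μ := (volume : Measure (Euc d)).toSphere) (f := fun r w => f (r • (w : Euc d)))
    (by simp only [Function.uncurry_def]; fun_prop) isCompact_univ
  simpa [sphInt] using h

theorem sphere_coe_smul_homeomorph (x : ({0}ᶜ : Set (Euc d))) :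
    ((homeomorphUnitSphereProd (Euc d) x).2 : ℝ) • ((homeomorphUnitSphereProd (Euc d) x).1 : Euc d)
      = x := by
  have := (homeomorphUnitSphereProd (Euc d)).symm_apply_apply x
  conv_rhs => rw [← this]
  rfl

/-- Integration in polar coordinates, for nonnegative functions. -/
theorem lintegral_polar (hd : 0 < d) {F : Euc d → ENNReal} (hF : Measurable F) :
    ∫⁻ x, F x = ∫⁻ r in Set.Ioi (0 : ℝ), ENNReal.ofReal (r ^ (d - 1)) *
      ∫⁻ w : Metric.sphere (0 : Euc d) 1, F (r • (w : Euc d)) ∂(volume : Measure (Euc d)).toSphere := by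
  have : Nontrivial (Euc d) :=
    Module.nontrivial_of_finrank_pos (R := ℝ) (by simpa using hd)
  have hmp := (volume : Measure (Euc d)).measurePreserving_homeomorphUnitSphereProd
  have h1 : ∫⁻ x, F x = ∫⁻ x : ({0}ᶜ : Set (Euc d)), F x ∂(volume.comap Subtype.val) := by
    rw [lintegral_subtype_comap (measurableSet_singleton _).compl, restrict_compl_singleton]
  have h2 : ∫⁻ x : ({0}ᶜ : Set (Euc d)), F x ∂(volume.comap Subtype.val) =
      ∫⁻ p, F ((p.2 : ℝ) • (p.1 : Euc d))
        ∂((volume : Measure (Euc d)).toSphere.prod (Measure.volumeIoiPow (d - 1))) := by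
    have h3 := hmp.lintegral_comp
      (f := fun p : Metric.sphere (0 : Euc d) 1 × Set.Ioi (0 : ℝ) => F ((p.2 : ℝ) • (p.1 : Euc d)))
      (hF.comp (by fun_prop))
    simp only [sphere_coe_smul_homeomorph, finrank_euclideanSpace, Fintype.card_fin] at h3
    exact h3
  have hm : Measurable fun p : Metric.sphere (0 : Euc d) 1 × Set.Ioi (0 : ℝ) =>
      F ((p.2 : ℝ) • (p.1 : Euc d)) := hF.comp (by fun_prop)
  rw [h1, h2, lintegral_prod_symm' _ hm, Measure.volumeIoiPow,
    lintegral_withDensity_eq_lintegral_mul₀ (by fun_prop)]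
  · exact lintegral_subtype_comap measurableSet_Ioi (fun r : ℝ => ENNReal.ofReal (r ^ (d - 1)) *
      ∫⁻ w : Metric.sphere (0 : Euc d) 1, F (r • (w : Euc d))
        ∂(volume : Measure (Euc d)).toSphere)
  · exact hm.lintegral_prod_left'.aemeasurable

/-- Integration in polar coordinates. -/
theorem integral_polar (hd : 0 < d) {F : Euc d → ℝ} (hF : Integrable F) :
    ∫ x, F x = ∫ r in Set.Ioi (0 : ℝ), r ^ (d - 1) * sphInt fun w => F (r • w) := by
  have : Nontrivial (Euc d) :=
    Module.nontrivial_of_finrank_pos (R := ℝ) (by simpa using hd)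
  have hmp := (volume : Measure (Euc d)).measurePreserving_homeomorphUnitSphereProd
  have he := (homeomorphUnitSphereProd (Euc d)).measurableEmbedding
  have h1 : ∫ x, F x = ∫ x : ({0}ᶜ : Set (Euc d)), F x ∂(volume.comap Subtype.val) := by
    rw [integral_subtype_comap (measurableSet_singleton _).compl, restrict_compl_singleton]
  have h2 : ∫ x : ({0}ᶜ : Set (Euc d)), F x ∂(volume.comap Subtype.val) =
      ∫ p, F ((p.2 : ℝ) • (p.1 : Euc d))
        ∂((volume : Measure (Euc d)).toSphere.prod (Measure.volumeIoiPow (d - 1))) := by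
    have h3 := hmp.integral_comp he
      (fun p : Metric.sphere (0 : Euc d) 1 × Set.Ioi (0 : ℝ) => F ((p.2 : ℝ) • (p.1 : Euc d)))
    simp only [sphere_coe_smul_homeomorph, finrank_euclideanSpace, Fintype.card_fin] at h3
    exact h3
  have hint : Integrable (fun p : Metric.sphere (0 : Euc d) 1 × Set.Ioi (0 : ℝ) =>
      F ((p.2 : ℝ) • (p.1 : Euc d)))
      ((volume : Measure (Euc d)).toSphere.prod (Measure.volumeIoiPow (d - 1))) := by
    have h3 := hmp.integrable_comp_emb he
      (g := fun p : Metric.sphere (0 : Euc d) 1 × Set.Ioi (0 : ℝ) => F ((p.2 : ℝ) • (p.1 : Euc d)))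
    simp only [Function.comp_def, sphere_coe_smul_homeomorph, finrank_euclideanSpace,
      Fintype.card_fin] at h3
    rw [← h3]
    exact (integrableOn_iff_comap_subtypeVal (measurableSet_singleton _).compl).1 hF.integrableOn
  rw [h1, h2, integral_prod_symm _ hint, Measure.volumeIoiPow]
  simp only [ENNReal.ofReal]
  rw [integral_withDensity_eq_integral_smul (by fun_prop)]
  have h4 := integral_subtype_comap (μ := volume) (measurableSet_Ioi (a := (0 : ℝ))) (fun r : ℝ =>
    Real.toNNReal (r ^ (d - 1)) • ∫ w : Metric.sphere (0 : Euc d) 1, F (r • (w : Euc d))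
        ∂(volume : Measure (Euc d)).toSphere)
  refine h4.trans (setIntegral_congr_fun measurableSet_Ioi fun r hr => ?_)
  simp only [NNReal.smul_def, Real.coe_toNNReal _ (pow_nonneg (le_of_lt hr) _), smul_eq_mul]
  rfl

/-- Domination of spherical means implies domination of integrals. -/
theorem integrable_and_integral_le_of_sphInt_le (hd : 0 < d) {f g : Euc d → ℝ}
    (hf : Continuous f) (hg : Continuous g) (hf0 : ∀ x, 0 ≤ f x) (hg0 : ∀ x, 0 ≤ g x)
    (hgi : Integrable g)
    (h : ∀ r : ℝ, 0 < r → sphInt (fun w => f (r • w)) ≤ sphInt fun w => g (r • w)) :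
    Integrable f ∧ ∫ x, f x ≤ ∫ x, g x := by
  have hle : ∫⁻ x, ENNReal.ofReal (f x) ≤ ∫⁻ x, ENNReal.ofReal (g x) := by
    rw [lintegral_polar hd (by fun_prop), lintegral_polar hd (by fun_prop)]
    refine setLIntegral_mono' measurableSet_Ioi fun r hr => mul_le_mul_right ?_ _
    have key : ∀ u : Euc d → ℝ, Continuous u → (∀ x, 0 ≤ u x) →
        ∫⁻ w : Metric.sphere (0 : Euc d) 1, ENNReal.ofReal (u (r • (w : Euc d)))
          ∂(volume : Measure (Euc d)).toSphere = ENNReal.ofReal (sphInt fun w => u (r • w)) := by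
      intro u hu hu0
      rw [sphInt, ofReal_integral_eq_lintegral_ofReal (integrable_sphere (by fun_prop))
        (Filter.Eventually.of_forall fun w => hu0 _)]
    rw [key f hf hf0, key g hg hg0]
    exact ENNReal.ofReal_le_ofReal (h r hr)
  have hfi : Integrable f := by
    refine ⟨hf.aestronglyMeasurable, ?_⟩
    rw [hasFiniteIntegral_iff_ofReal (Filter.Eventually.of_forall hf0)]
    refine hle.trans_lt ?_
    rw [← hasFiniteIntegral_iff_ofReal (Filter.Eventually.of_forall hg0)]
    exact hgi.2
  refine ⟨hfi, ?_⟩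
  rw [← ofReal_integral_eq_lintegral_ofReal hfi (Filter.Eventually.of_forall hf0),
    ← ofReal_integral_eq_lintegral_ofReal hgi (Filter.Eventually.of_forall hg0)] at hle
  exact (ENNReal.ofReal_le_ofReal_iff (integral_nonneg hg0)).1 hle

theorem hasCompactSupport_comp_norm {η : ℝ → ℝ} {R : ℝ} (h : ∀ r, R ≤ r → η r = 0) :
    HasCompactSupport fun x : Euc d => η ‖x‖ := by
  refine HasCompactSupport.intro (isCompact_closedBall (0 : Euc d) R) fun x hx => h _ ?_
  simp only [Metric.mem_closedBall, dist_zero_right, not_le] at hx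
  exact hx.le

theorem EvenSmooth.isTest_comp_norm {η : ℝ → ℝ} (hη : EvenSmooth η) {R : ℝ}
    (h : ∀ r, R ≤ r → η r = 0) : IsTest fun x : Euc d => η ‖x‖ :=
  ⟨hη.contDiff_comp_norm, hasCompactSupport_comp_norm h⟩

/-- A continuous function orthogonal to all radial test functions has zero spherical means. -/
theorem sphInt_eq_zero_of_radial (hd : 0 < d) {F : Euc d → ℝ} (hF : Continuous F)
    (h : ∀ η : ℝ → ℝ, EvenSmooth η → (∃ R, ∀ r, R ≤ r → η r = 0) → ∫ x, η ‖x‖ * F x = 0)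
    {r : ℝ} (hr : 0 < r) : sphInt (fun w => F (r • w)) = 0 := by
  set H : ℝ → ℝ := fun r => r ^ (d - 1) * sphInt fun w => F (r • w) with hH
  have hHc : Continuous H := (continuous_id.pow _).mul (continuous_sphInt_smul hF)
  have hae : ∀ᵐ s : ℝ, s ∈ Set.Ioi (0 : ℝ) → H s = 0 := by
    refine isOpen_Ioi.ae_eq_zero_of_integral_contDiff_smul_eq_zero
      (hHc.locallyIntegrable.locallyIntegrableOn _) fun g hg hgc hgs => ?_
    have hgneg : ∀ s, s ≤ 0 → g s = 0 := fun s hs => by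
      by_contra hne
      exact absurd (hgs (subset_tsupport _ hne)) (not_lt.2 hs)
    obtain ⟨R, hR⟩ := hgc.isCompact.bddAbove
    have hgR : ∀ s, R + 1 ≤ s → g s = 0 := fun s hs => by
      by_contra hne
      have := hR (subset_tsupport _ hne)
      linarith
    have hη : EvenSmooth fun s => g s + g (-s) :=
      ⟨hg.add (hg.comp contDiff_neg), fun s => by simp [add_comm]⟩
    have hηR : ∀ s, max (R + 1) 0 ≤ s → g s + g (-s) = 0 := fun s hs => by
      rw [hgR s (le_trans (le_max_left _ _) hs),
        hgneg (-s) (by linarith [le_trans (le_max_right (R + 1) 0) hs]), add_zero]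
    have h1 := h _ hη ⟨_, hηR⟩
    rw [integral_polar hd ((hη.isTest_comp_norm hηR).integrable_mul hF)] at h1
    rw [← h1, ← setIntegral_eq_integral_of_forall_compl_eq_zero (s := Set.Ioi 0)]
    · refine setIntegral_congr_fun measurableSet_Ioi fun s hs => ?_
      have hs' : (0 : ℝ) < s := hs
      have e : sphInt (fun w : Euc d => (g ‖s • w‖ + g (-‖s • w‖)) * F (s • w)) =
          g s * sphInt fun w => F (s • w) := by
        rw [← sphInt_const_mul]
        refine sphInt_congr fun x hx => ?_
        rw [norm_smul, hx, Real.norm_of_nonneg hs'.le, mul_one, hgneg (-s) (by linarith), add_zero]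
      simp only [smul_eq_mul, hH, e]
      ring
    · intro s hs
      rw [hgneg s (not_lt.1 hs), zero_smul]
  have hEq : Set.EqOn H (fun _ => 0) (Set.Ioi 0) :=
    Measure.eqOn_open_of_ae_eq (μ := volume) ((ae_restrict_iff' measurableSet_Ioi).2 hae)
      isOpen_Ioi hHc.continuousOn continuousOn_const
  have := hEq hr
  simp only [hH, mul_eq_zero, pow_eq_zero_iff', hr.ne', false_and, false_or] at this
  exact this

theorem contDiff_rot {f : Euc d → ℝ} (hf : ContDiff ℝ ∞ f) (i j : Fin d) :
    ContDiff ℝ ∞ (rot i j f) :=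
  ((contDiff_coord i).mul (contDiff_pd hf j)).sub ((contDiff_coord j).mul (contDiff_pd hf i))

theorem rot_mul {f g : Euc d → ℝ} (hf : ContDiff ℝ ∞ f) (hg : ContDiff ℝ ∞ g) (i j : Fin d)
    (x : Euc d) : rot i j (fun x => f x * g x) x = rot i j f x * g x + f x * rot i j g x := by
  simp only [rot, pd_mul hf hg]
  ring

theorem rot_comp_norm {η : ℝ → ℝ} (hη : EvenSmooth η) (i j : Fin d) (x : Euc d) :
    rot i j (fun x => η ‖x‖) x = 0 := by
  obtain ⟨g, -, h⟩ := hη.exists_rdiv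
  simp only [rot, hη.pd_comp_norm h]
  ring

theorem integral_rot {φ : Euc d → ℝ} (hφ : IsTest φ) (i j : Fin d) : ∫ x, rot i j φ x = 0 := by
  have h : ∀ i j : Fin d, ∫ x : Euc d, x i * pd j φ x = -((if i = j then 1 else 0) * ∫ x, φ x) := by
    intro i j
    have h1 := integral_pd_mul (contDiff_coord i) hφ j
    simp only [pd_coord, integral_const_mul] at h1
    rw [← neg_eq_iff_eq_neg, ← h1]
    simp [eq_comm]
  simp only [rot]
  rw [integral_sub ((hφ.pd j).integrable_mul_left (continuous_coord i))
    ((hφ.pd i).integrable_mul_left (continuous_coord j)), h, h]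
  simp [eq_comm]

/-- Rotation fields are divergence free and annihilate radial functions, so the rotated function is
orthogonal to every radial test function, and this passes to each sphere. It provides integration by
parts on the sphere without any surface calculus. -/
theorem sphInt_rot_smul {f : Euc d → ℝ} (hf : ContDiff ℝ ∞ f) (i j : Fin d) {r : ℝ} (hr : 0 < r) :
    sphInt (fun w => rot i j f (r • w)) = 0 := by
  refine sphInt_eq_zero_of_radial i.pos (contDiff_rot hf i j).continuous
    (fun η hη ⟨R, hR⟩ => ?_) hr
  have h1 := integral_rot ((hη.isTest_comp_norm (d := d) hR).mul_right hf) i j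
  simpa only [rot_mul hη.contDiff_comp_norm hf, rot_comp_norm hη, zero_mul, zero_add] using h1

theorem sphInt_rot {f : Euc d → ℝ} (hf : ContDiff ℝ ∞ f) (i j : Fin d) :
    sphInt (rot i j f) = 0 := by
  simpa using sphInt_rot_smul hf i j one_pos

theorem sphInt_rot_mul {f g : Euc d → ℝ} (hf : ContDiff ℝ ∞ f) (hg : ContDiff ℝ ∞ g)
    (i j : Fin d) :
    sphInt (fun x => rot i j f x * g x) = -sphInt (fun x => f x * rot i j g x) := by
  have h := sphInt_rot (hf.mul hg) i j
  have e : rot i j (fun x => f x * g x) = fun x => rot i j f x * g x + f x * rot i j g x :=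
    funext fun x => rot_mul hf hg i j x
  rw [e, sphInt_add ((contDiff_rot hf i j).mul hg).continuous
    (hf.mul (contDiff_rot hg i j)).continuous] at h
  linarith

theorem sphInt_neg (hd : 0 < d) {f : Euc d → ℝ} (hf : Continuous f) {r : ℝ} (hr : 0 < r) :
    sphInt (fun w => f (-(r • w))) = sphInt fun w => f (r • w) := by
  have h := sphInt_eq_zero_of_radial hd (F := fun x => f (-x) - f x) (by fun_prop)
    (fun η hη ⟨R, hR⟩ => ?_) hr
  · rw [sphInt_sub (by fun_prop) (by fun_prop)] at h
    linarith
  · have ht := hη.isTest_comp_norm (d := d) hR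
    have hi := ht.integrable_mul hf
    have hi' : Integrable fun x : Euc d => η ‖x‖ * f (-x) := ht.integrable_mul (by fun_prop)
    simp only [mul_sub]
    rw [integral_sub hi' hi]
    have := integral_neg_eq_self (fun x : Euc d => η ‖x‖ * f x) volume
    simp only [norm_neg] at this
    rw [this, sub_self]

/-- For j ≠ i, xᵢ is the (i, j) rotation of xⱼ, hence has zero mean. The next two lemmas use in the
same way that 2xᵢxⱼ and xᵢ² - xⱼ² are rotations of xⱼ² and xᵢxⱼ. -/
theorem sphInt_coord (hd : 2 ≤ d) (i : Fin d) : sphInt (fun x : Euc d => x i) = 0 := by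
  have : Nontrivial (Fin d) := Fin.nontrivial_iff_two_le.2 hd
  obtain ⟨j, hj⟩ := exists_ne i
  rw [← sphInt_rot (contDiff_coord j) i j]
  congr 1
  funext x
  simp [rot, pd_coord, hj.symm]

theorem sphInt_coord_mul {i j : Fin d} (hij : i ≠ j) :
    sphInt (fun x : Euc d => x i * x j) = 0 := by
  have h := sphInt_rot ((contDiff_coord j).mul (contDiff_coord j)) i j
  have e : rot i j (fun x => x j * x j) = fun x => 2 * (x i * x j) := by
    funext x
    simp only [rot, pd_mul (contDiff_coord _) (contDiff_coord _), pd_coord, hij]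
    simp
    ring
  rw [e, sphInt_const_mul] at h
  linarith

theorem sphInt_coord_sq (hd : 0 < d) (i : Fin d) :
    sphInt (fun x : Euc d => x i * x i) = sphInt (fun _ : Euc d => 1) / d := by
  have h : ∀ j, sphInt (fun x : Euc d => x j * x j) = sphInt (fun x : Euc d => x i * x i) := by
    intro j
    rcases eq_or_ne i j with rfl | hij
    · rfl
    have h := sphInt_rot ((contDiff_coord i).mul (contDiff_coord j)) i j
    have e : rot i j (fun x => x i * x j) = fun x => x i * x i - x j * x j := by
      funext x
      simp only [rot, pd_mul (contDiff_coord _) (contDiff_coord _), pd_coord, hij, hij.symm]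
      simp
    rw [e, sphInt_sub (by fun_prop) (by fun_prop)] at h
    linarith
  have h2 : sphInt (fun x : Euc d => ∑ j, x j * x j) = sphInt (fun _ : Euc d => 1) := by
    refine sphInt_congr fun x hx => ?_
    have := norm_sq_eq_sum x
    rw [hx] at this
    simp only [← sq, ← this]
    norm_num
  rw [sphInt_sum _ fun j => by fun_prop] at h2
  simp only [h, Finset.sum_const, Finset.card_univ, Fintype.card_fin, nsmul_eq_mul] at h2
  rw [← h2]
  field_simp

theorem sphInt_one_pos (hd : 0 < d) : 0 < sphInt (fun _ : Euc d => 1) := by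
  have : Nontrivial (Euc d) :=
    Module.nontrivial_of_finrank_pos (R := ℝ) (by simpa using hd)
  simp only [sphInt, integral_const, smul_eq_mul, mul_one]
  refine ENNReal.toReal_pos ?_ (measure_ne_top _ _)
  rw [Ne, Measure.measure_univ_eq_zero]
  exact Measure.toSphere_ne_zero (volume : Measure (Euc d))

end Sphere

/-! ### The Casimir operator on polynomials. -/

/-- The function on `ℝ^d` defined by a polynomial in the coordinates. -/
noncomputable def evalP {d : ℕ} (p : MvPolynomial (Fin d) ℝ) (x : Euc d) : ℝ :=
  MvPolynomial.eval (fun i => x i) p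

/-- The infinitesimal rotation `Xᵢ ∂ⱼ - Xⱼ ∂ᵢ` as a derivation of the polynomial ring. -/
noncomputable def rotP {d : ℕ} (i j : Fin d) :
    Derivation ℝ (MvPolynomial (Fin d) ℝ) (MvPolynomial (Fin d) ℝ) :=
  MvPolynomial.X (R := ℝ) i • MvPolynomial.pderiv j - MvPolynomial.X (R := ℝ) j • MvPolynomial.pderiv i

/-- The sum of the squares of all infinitesimal rotations, twice the spherical Laplacian. -/
noncomputable def casimirP {d : ℕ} (p : MvPolynomial (Fin d) ℝ) : MvPolynomial (Fin d) ℝ :=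
  ∑ i, ∑ j, rotP i j (rotP i j p)

/-- Polynomials of total degree at most `m`. -/
noncomputable abbrev polyLE (d m : ℕ) : Submodule ℝ (MvPolynomial (Fin d) ℝ) :=
  MvPolynomial.restrictTotalDegree (Fin d) ℝ m

section Poly

variable {d : ℕ}

theorem contDiff_evalP (p : MvPolynomial (Fin d) ℝ) : ContDiff ℝ ∞ (evalP p) := by
  induction p using MvPolynomial.induction_on with
  | C a =>
    have : evalP (MvPolynomial.C a : MvPolynomial (Fin d) ℝ) = fun _ => a := by
      funext x; simp [evalP]
    rw [this]
    exact contDiff_const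
  | add p q hp hq =>
    have : evalP (p + q) = fun x => evalP p x + evalP q x := by funext x; simp [evalP]
    rw [this]
    exact hp.add hq
  | mul_X p i hp =>
    have : evalP (p * MvPolynomial.X i) = fun x => evalP p x * x i := by funext x; simp [evalP]
    rw [this]
    exact hp.mul (contDiff_coord i)

theorem continuous_evalP (p : MvPolynomial (Fin d) ℝ) : Continuous (evalP p) :=
  (contDiff_evalP p).continuous

theorem evalP_add (p q : MvPolynomial (Fin d) ℝ) (x : Euc d) :
    evalP (p + q) x = evalP p x + evalP q x := map_add _ _ _

theorem evalP_sub (p q : MvPolynomial (Fin d) ℝ) (x : Euc d) :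
    evalP (p - q) x = evalP p x - evalP q x := map_sub _ _ _

theorem evalP_mul (p q : MvPolynomial (Fin d) ℝ) (x : Euc d) :
    evalP (p * q) x = evalP p x * evalP q x := map_mul _ _ _

theorem evalP_sum {ι : Type*} (s : Finset ι) (p : ι → MvPolynomial (Fin d) ℝ) (x : Euc d) :
    evalP (∑ i ∈ s, p i) x = ∑ i ∈ s, evalP (p i) x := map_sum _ _ _

theorem evalP_X (i : Fin d) (x : Euc d) : evalP (MvPolynomial.X i) x = x i := by simp [evalP]

theorem pd_evalP (p : MvPolynomial (Fin d) ℝ) (i : Fin d) :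
    pd i (evalP p) = evalP (MvPolynomial.pderiv i p) := by
  induction p using MvPolynomial.induction_on with
  | C a =>
    have : evalP (MvPolynomial.C a : MvPolynomial (Fin d) ℝ) = fun _ => a := by
      funext x; simp [evalP]
    rw [this, pd_const]
    funext x; simp [evalP]
  | add p q hp hq =>
    have : evalP (p + q) = fun x => evalP p x + evalP q x := funext (evalP_add p q)
    rw [this, pd_add (contDiff_evalP p) (contDiff_evalP q), hp, hq, map_add]
    exact funext fun x => (evalP_add _ _ x).symm
  | mul_X p j hp =>
    have : evalP (p * MvPolynomial.X j) = fun x => evalP p x * x j := by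
      funext x; rw [evalP_mul, evalP_X]
    rw [this, pd_mul (contDiff_evalP p) (contDiff_coord j), hp]
    funext x
    rw [pd_coord, Derivation.leibniz, MvPolynomial.pderiv_X]
    simp only [smul_eq_mul, evalP_add, evalP_mul, evalP_X]
    by_cases h : i = j
    · subst h
      simp [evalP]
      ring
    · simp [h, evalP]
      ring

theorem rot_evalP (p : MvPolynomial (Fin d) ℝ) (i j : Fin d) :
    rot i j (evalP p) = evalP (rotP i j p) := by
  funext x
  simp [rot, rotP, pd_evalP, evalP_sub, evalP_mul, evalP_X]

theorem casimirP_add (p q : MvPolynomial (Fin d) ℝ) :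
    casimirP (p + q) = casimirP p + casimirP q := by
  simp [casimirP, Finset.sum_add_distrib]

theorem evalP_casimirP (p : MvPolynomial (Fin d) ℝ) (x : Euc d) :
    evalP (casimirP p) x = ∑ i, ∑ j, rot i j (rot i j (evalP p)) x := by
  simp [casimirP, evalP_sum, rot_evalP]

theorem mem_polyLE {m : ℕ} {p : MvPolynomial (Fin d) ℝ} : p ∈ polyLE d m ↔ p.totalDegree ≤ m :=
  MvPolynomial.mem_restrictTotalDegree _ _ _

theorem polyLE_mono {m n : ℕ} (h : m ≤ n) : polyLE d m ≤ polyLE d n := fun _ hp =>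
  mem_polyLE.2 ((mem_polyLE.1 hp).trans h)

theorem rotP_isHomogeneous {p : MvPolynomial (Fin d) ℝ} {m : ℕ} (hp : p.IsHomogeneous m)
    (i j : Fin d) : (rotP i j p).IsHomogeneous m := by
  have h : ∀ i j : Fin d, (MvPolynomial.X i * MvPolynomial.pderiv j p).IsHomogeneous m := by
    intro i j
    rcases Nat.eq_zero_or_pos m with rfl | hm
    · obtain ⟨c, rfl⟩ : ∃ c, p = MvPolynomial.C c := ⟨_, MvPolynomial.totalDegree_eq_zero_iff_eq_C.1
        (Nat.le_zero.1 hp.totalDegree_le)⟩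
      simpa using MvPolynomial.isHomogeneous_zero (Fin d) ℝ 0
    · have := (MvPolynomial.isHomogeneous_X ℝ i).mul (hp.pderiv (i := j))
      rwa [Nat.add_sub_cancel' hm] at this
  simpa [rotP] using (h i j).sub (h j i)

theorem casimirP_isHomogeneous {p : MvPolynomial (Fin d) ℝ} {m : ℕ} (hp : p.IsHomogeneous m) :
    (casimirP p).IsHomogeneous m :=
  MvPolynomial.IsHomogeneous.sum _ _ _ fun i _ => MvPolynomial.IsHomogeneous.sum _ _ _ fun j _ =>
    rotP_isHomogeneous (rotP_isHomogeneous hp i j) i j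

theorem casimirP_mem {m : ℕ} {p : MvPolynomial (Fin d) ℝ} (hp : p ∈ polyLE d m) :
    casimirP p ∈ polyLE d m := by
  have h1 : ∀ (s : Finset ℕ), casimirP (∑ i ∈ s, MvPolynomial.homogeneousComponent i p) =
      ∑ i ∈ s, casimirP (MvPolynomial.homogeneousComponent i p) := by
    intro s
    simp only [casimirP, map_sum]
    rw [Finset.sum_comm' (t' := Finset.univ) (s' := fun _ => s) (by simp)]
    refine Finset.sum_congr rfl fun i _ => ?_
    rw [Finset.sum_comm' (t' := Finset.univ) (s' := fun _ => s) (by simp)]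
  rw [← MvPolynomial.sum_homogeneousComponent p, h1]
  refine Submodule.sum_mem _ fun i hi => mem_polyLE.2 ?_
  have h2 := (casimirP_isHomogeneous
    (MvPolynomial.homogeneousComponent_isHomogeneous i p)).totalDegree_le
  have h3 := mem_polyLE.1 hp
  have h4 := Finset.mem_range.1 hi
  omega

/-- The Casimir identity for functions that are homogeneous of degree `m`. -/
theorem sum_rot_rot_of_eul {f : Euc d → ℝ} (hf : ContDiff ℝ ∞ f) {m : ℝ}
    (h : eul f = fun x => m * f x) (x : Euc d) :
    ∑ i, ∑ j, rot i j (rot i j f) x =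
      2 * (‖x‖ ^ 2 * lap f x - m * (m + d - 2) * f x) := by
  have hxp : ∀ i j : Fin d, ContDiff ℝ ∞ fun x : Euc d => x i * pd j f x := fun i j =>
    (contDiff_coord i).mul (contDiff_pd hf j)
  have hpd : ∀ i j k : Fin d, pd k (rot i j f) x =
      (if k = i then 1 else 0) * pd j f x + x i * pd k (pd j f) x -
        ((if k = j then 1 else 0) * pd i f x + x j * pd k (pd i f) x) := by
    intro i j k
    have : rot i j f = fun x => x i * pd j f x - x j * pd i f x := rfl
    rw [this, pd_sub (hxp i j) (hxp j i), pd_mul (contDiff_coord i) (contDiff_pd hf j),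
      pd_mul (contDiff_coord j) (contDiff_pd hf i)]
    simp only [pd_coord]
  have hterm : ∀ i j : Fin d, rot i j (rot i j f) x =
      ((if i = j then 2 * (x i * pd i f x) else 0) + (x i ^ 2 * pd j (pd j f) x
        + x j ^ 2 * pd i (pd i f) x) - (x i * pd i f x + x j * pd j f x)
        - 2 * (x i * (x j * pd j (pd i f) x))) := by
    intro i j
    rw [rot, hpd, hpd, pd_comm hf i j]
    by_cases hij : i = j
    · subst hij
      simp
      ring
    · have hji : ¬j = i := fun h => hij h.symm
      simp only [hij, hji, if_true, if_false]
      ring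
  have he : ∑ i, x i * pd i f x = m * f x := congrFun h x
  have hee : ∑ i, ∑ j, x i * (x j * pd j (pd i f) x) = m * (m * f x) - m * f x := by
    have h1 : ∀ i, pd i (eul f) x = m * pd i f x := by
      intro i; rw [h, pd_const_mul hf]
    simp only [pd_eul hf] at h1
    have h2 : ∀ i, ∑ j, x i * (x j * pd j (pd i f) x) = m * (x i * pd i f x) - x i * pd i f x := by
      intro i
      rw [← Finset.mul_sum]
      have h3 : ∑ j, x j * pd j (pd i f) x = eul (pd i f) x := rfl
      rw [h3]
      linear_combination x i * h1 i
    simp only [h2, Finset.sum_sub_distrib, ← Finset.mul_sum, he]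
  have s1 : ∑ i, ∑ j, (if i = j then 2 * (x i * pd i f x) else 0) = 2 * (m * f x) := by
    simp only [Finset.sum_ite_eq, Finset.mem_univ, if_true, ← Finset.mul_sum, he]
  have s2 : ∑ i, ∑ j, x i ^ 2 * pd j (pd j f) x = ‖x‖ ^ 2 * lap f x := by
    rw [lap, norm_sq_eq_sum, Finset.sum_mul_sum]
  have s3 : ∑ i, ∑ j, x j ^ 2 * pd i (pd i f) x = ‖x‖ ^ 2 * lap f x := by
    rw [Finset.sum_comm, s2]
  have s4 : ∑ i, ∑ _j : Fin d, x i * pd i f x = d * (m * f x) := by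
    simp [← Finset.mul_sum, he]
  have s5 : ∑ _i : Fin d, ∑ j, x j * pd j f x = d * (m * f x) := by
    simp [he]
  simp only [hterm, Finset.sum_add_distrib, Finset.sum_sub_distrib, s1, s2, s3, s4, s5,
    ← Finset.mul_sum (s := Finset.univ) (a := (2 : ℝ))]
  rw [hee]
  ring

theorem eul_evalP {p : MvPolynomial (Fin d) ℝ} {m : ℕ} (hp : p.IsHomogeneous m) :
    eul (evalP p) = fun x => (m : ℝ) * evalP p x := by
  funext x
  have h := congrArg (fun q => evalP q x) hp.sum_X_mul_pderiv
  simp only [evalP_sum, evalP_mul, evalP_X, nsmul_eq_mul] at h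
  simp only [eul, pd_evalP, h]
  simp [evalP]

/-- On polynomials of degree `≤ m + 1`, the Casimir operator is a scalar on the sphere modulo
polynomials of degree `≤ m`. -/
theorem exists_casimirP_eq {m : ℕ} {p : MvPolynomial (Fin d) ℝ} (hp : p ∈ polyLE d (m + 1)) :
    ∃ c ∈ polyLE d m, ∀ x : Euc d, ‖x‖ = 1 →
      evalP (casimirP p) x = evalP c x - 2 * (((m : ℝ) + 1) * (m + d - 1)) * evalP p x := by
  set h := MvPolynomial.homogeneousComponent (m + 1) p with hh
  have hhom : h.IsHomogeneous (m + 1) := MvPolynomial.homogeneousComponent_isHomogeneous _ _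
  set q := p - h with hq
  have hqm : q ∈ polyLE d m := by
    have hsum : p = ∑ i ∈ Finset.range (m + 2), MvPolynomial.homogeneousComponent i p := by
      conv_lhs => rw [← MvPolynomial.sum_homogeneousComponent p]
      refine Finset.sum_subset (fun i hi => ?_) fun i _ hi => ?_
      · have := mem_polyLE.1 hp
        simp only [Finset.mem_range] at hi ⊢
        omega
      · refine MvPolynomial.homogeneousComponent_eq_zero _ _ ?_
        simp only [Finset.mem_range] at hi
        omega
    rw [Finset.sum_range_succ] at hsum
    have : q = ∑ i ∈ Finset.range (m + 1), MvPolynomial.homogeneousComponent i p := by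
      rw [hq, hh]
      exact sub_eq_of_eq_add hsum
    rw [this]
    refine Submodule.sum_mem _ fun i hi => mem_polyLE.2 ?_
    have := (MvPolynomial.homogeneousComponent_isHomogeneous i p).totalDegree_le
    have := Finset.mem_range.1 hi
    omega
  have hlap : (∑ i, MvPolynomial.pderiv i (MvPolynomial.pderiv i h)) ∈ polyLE d m := by
    refine Submodule.sum_mem _ fun i _ => mem_polyLE.2 ?_
    have := ((hhom.pderiv (i := i)).pderiv (i := i)).totalDegree_le
    omega
  set lam : ℝ := ((m : ℝ) + 1) * (m + d - 1) with hlam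
  -- With h the part of degree m+1 and q = p - h, the Casimir identity gives 2(Δh - λh) on the
  -- sphere for h. Writing λh as λ(p - q) leaves -2λp plus terms of degree at most m. The factor 2
  -- counts ordered pairs (i, j).
  refine ⟨casimirP q + (2 * lam) • q +
    (2 : ℝ) • ∑ i, MvPolynomial.pderiv i (MvPolynomial.pderiv i h),
    Submodule.add_mem _ (Submodule.add_mem _ (casimirP_mem hqm) (Submodule.smul_mem _ _ hqm))
      (Submodule.smul_mem _ _ hlap), fun x hx => ?_⟩
  have hp' : p = q + h := by rw [hq]; ring
  have hsm : ∀ (a : ℝ) (r : MvPolynomial (Fin d) ℝ), evalP (a • r) x = a * evalP r x := by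
    intro a r; simp [evalP]
  have h1 : evalP (casimirP h) x = 2 * (lap (evalP h) x - lam * evalP h x) := by
    rw [evalP_casimirP, sum_rot_rot_of_eul (contDiff_evalP h) (eul_evalP hhom), hx, hlam]
    push_cast
    ring
  have h2 : lap (evalP h) x = evalP (∑ i, MvPolynomial.pderiv i (MvPolynomial.pderiv i h)) x := by
    simp only [lap, pd_evalP, evalP_sum]
  conv_lhs => rw [hp', casimirP_add, evalP_add, h1, h2]
  rw [evalP_add, evalP_add, hsm, hsm]
  conv_rhs => rw [hp', evalP_add]
  ring

theorem polyLE_one_eq {q : MvPolynomial (Fin d) ℝ} (hq : q ∈ polyLE d 1) :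
    ∃ (c : ℝ) (a : Fin d → ℝ), ∀ x, evalP q x = c + ∑ i, a i * x i := by
  refine ⟨MvPolynomial.constantCoeff q, fun i => evalP (MvPolynomial.pderiv i q) 0, fun x => ?_⟩
  have hsum := MvPolynomial.sum_homogeneousComponent q
  have h1 : q = MvPolynomial.homogeneousComponent 0 q + MvPolynomial.homogeneousComponent 1 q := by
    conv_lhs => rw [← hsum]
    have : (∑ i ∈ Finset.range 2, MvPolynomial.homogeneousComponent i q) =
      MvPolynomial.homogeneousComponent 0 q + MvPolynomial.homogeneousComponent 1 q := by
      simp [Finset.sum_range_succ]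
    rw [← this]
    refine Finset.sum_subset (fun i hi => ?_) fun i _ hi => ?_
    · have := mem_polyLE.1 hq
      simp only [Finset.mem_range] at hi ⊢
      omega
    · refine MvPolynomial.homogeneousComponent_eq_zero _ _ ?_
      simp only [Finset.mem_range] at hi
      omega
  set h := MvPolynomial.homogeneousComponent 1 q with hh
  have hhom : h.IsHomogeneous 1 := MvPolynomial.homogeneousComponent_isHomogeneous _ _
  have hconst : ∀ i, ∃ c, MvPolynomial.pderiv i h = MvPolynomial.C c := fun i =>
    ⟨_, MvPolynomial.totalDegree_eq_zero_iff_eq_C.1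
      (Nat.le_zero.1 (hhom.pderiv (i := i)).totalDegree_le)⟩
  choose c hc using hconst
  have h2 : evalP h x = ∑ i, c i * x i := by
    have := congrFun (eul_evalP hhom) x
    simp only [Nat.cast_one, one_mul] at this
    rw [← this, eul]
    refine Finset.sum_congr rfl fun i _ => ?_
    rw [pd_evalP, hc]
    simp [evalP, mul_comm]
  have h3 : ∀ i, evalP (MvPolynomial.pderiv i q) 0 = c i := by
    intro i
    rw [h1, map_add, hc, MvPolynomial.homogeneousComponent_zero]
    simp [evalP]
  simp only [h3]
  conv_lhs => rw [h1]
  rw [evalP_add, h2, MvPolynomial.homogeneousComponent_zero]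
  simp [evalP, MvPolynomial.constantCoeff_eq]

end Poly

/-! ### The Poincaré inequality on the sphere. -/

section Poincare

variable {d : ℕ}

/-- The `L²` class on the sphere of a continuous function. -/
noncomputable def sphLp (d : ℕ) : C(Metric.sphere (0 : Euc d) 1, ℝ) →L[ℝ]
    Lp ℝ 2 (volume : Measure (Euc d)).toSphere :=
  ContinuousMap.toLp 2 (volume : Measure (Euc d)).toSphere ℝ

/-- The restriction of a continuous function to the sphere. -/
def sphRestrict {f : Euc d → ℝ} (hf : Continuous f) : C(Metric.sphere (0 : Euc d) 1, ℝ) :=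
  ⟨fun w => f w, hf.comp continuous_subtype_val⟩

theorem inner_sphLp {f g : Euc d → ℝ} (hf : Continuous f) (hg : Continuous g) :
    inner ℝ (sphLp d (sphRestrict hf)) (sphLp d (sphRestrict hg)) = sphInt fun x => f x * g x := by
  rw [sphLp, ContinuousMap.inner_toLp]
  simp [sphInt, sphRestrict, mul_comm]

/-- The best approximation in `L²` of the sphere by polynomials of degree at most `m`. -/
theorem exists_polyLE_proj {f : Euc d → ℝ} (hf : Continuous f) (m : ℕ) :
    ∃ a ∈ polyLE d m, ∀ q ∈ polyLE d m,
      sphInt (fun x => f x * evalP q x) = sphInt fun x => evalP a x * evalP q x := by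
  let ι : MvPolynomial (Fin d) ℝ →ₗ[ℝ] Lp ℝ 2 (volume : Measure (Euc d)).toSphere :=
    { toFun := fun p => sphLp d (sphRestrict (continuous_evalP p))
      map_add' := fun p q => by
        rw [← map_add]
        congr 1
        ext w
        simp [sphRestrict, evalP_add]
      map_smul' := fun c p => by
        rw [RingHom.id_apply, ← map_smul]
        congr 1
        ext w
        simp [sphRestrict, evalP] }
  set W := (polyLE d m).map ι with hW
  have : FiniteDimensional ℝ W := inferInstance
  set P := W.starProjection (sphLp d (sphRestrict hf)) with hP
  obtain ⟨a, ha, haP⟩ : P ∈ W := Submodule.starProjection_apply_mem _ _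
  refine ⟨a, ha, fun q hq => ?_⟩
  rw [← inner_sphLp hf (continuous_evalP q), ← inner_sphLp (continuous_evalP a) (continuous_evalP q)]
  have h1 : inner ℝ (sphLp d (sphRestrict hf) - P) (ι q) = 0 :=
    Submodule.starProjection_inner_eq_zero _ _ ⟨q, hq, rfl⟩
  rw [inner_sub_left, ← haP] at h1
  exact sub_eq_zero.1 h1

/-- Stone-Weierstrass on the sphere. -/
theorem exists_poly_near {f : Euc d → ℝ} (hf : Continuous f) {ε : ℝ} (hε : 0 < ε) :
    ∃ p : MvPolynomial (Fin d) ℝ, ∀ x : Euc d, ‖x‖ = 1 → |f x - evalP p x| < ε := by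
  let A : MvPolynomial (Fin d) ℝ →ₐ[ℝ] C(Metric.sphere (0 : Euc d) 1, ℝ) :=
    MvPolynomial.aeval fun i => sphRestrict (continuous_coord i)
  have hA : ∀ (p : MvPolynomial (Fin d) ℝ) (w : Metric.sphere (0 : Euc d) 1),
      A p w = evalP p (w : Euc d) := by
    intro p w
    induction p using MvPolynomial.induction_on with
    | C a => simp [A, evalP]
    | add p q hp hq => simp [evalP_add, hp, hq]
    | mul_X p i hp =>
      rw [map_mul, ContinuousMap.mul_apply, hp, evalP_mul, evalP_X]
      simp [A, sphRestrict]
  have hsep : A.range.SeparatesPoints := by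
    intro x y hxy
    obtain ⟨i, hi⟩ : ∃ i, (x : Euc d) i ≠ (y : Euc d) i := by
      by_contra! h
      exact hxy (Subtype.ext (by ext i; exact h i))
    refine ⟨_, ⟨A (MvPolynomial.X i), ⟨_, rfl⟩, rfl⟩, ?_⟩
    simpa only [hA, evalP_X] using hi
  obtain ⟨⟨g, p, hp⟩, hg⟩ :=
    ContinuousMap.exists_mem_subalgebra_near_continuous_of_separatesPoints A.range hsep
      (fun w : Metric.sphere (0 : Euc d) 1 => f w) (hf.comp continuous_subtype_val) ε hε
  refine ⟨p, fun x hx => ?_⟩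
  have h1 := hg ⟨x, by simpa using hx⟩
  have h2 : g = A p := hp.symm
  subst h2
  rw [Real.norm_eq_abs, abs_sub_comm] at h1
  simpa only [hA] using h1

/-- The energy form `∑ᵢⱼ ∫_S (L_{ij} f) (L_{ij} g)`. -/
noncomputable def sphEnergy (f g : Euc d → ℝ) : ℝ :=
  ∑ i, ∑ j, sphInt fun x => rot i j f x * rot i j g x

theorem sphEnergy_self_nonneg (f : Euc d → ℝ) : 0 ≤ sphEnergy f f :=
  Finset.sum_nonneg fun _ _ => Finset.sum_nonneg fun _ _ => sphInt_nonneg fun _ => mul_self_nonneg _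

theorem sphEnergy_evalP {f : Euc d → ℝ} (hf : ContDiff ℝ ∞ f) (p : MvPolynomial (Fin d) ℝ) :
    sphEnergy f (evalP p) = -sphInt fun x => f x * evalP (casimirP p) x := by
  have h : ∀ i j : Fin d, Continuous fun x => f x * rot i j (rot i j (evalP p)) x := fun i j =>
    hf.continuous.mul (contDiff_rot (contDiff_rot (contDiff_evalP p) i j) i j).continuous
  simp only [evalP_casimirP, Finset.mul_sum]
  rw [sphInt_sum _ fun i => continuous_finsetSum _ fun j _ => h i j, sphEnergy,
    ← Finset.sum_neg_distrib]
  refine Finset.sum_congr rfl fun i _ => ?_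
  rw [sphInt_sum _ fun j => h i j, ← Finset.sum_neg_distrib]
  exact Finset.sum_congr rfl fun j _ =>
    sphInt_rot_mul hf (contDiff_rot (contDiff_evalP p) i j) i j

theorem rot_add {f g : Euc d → ℝ} (hf : ContDiff ℝ ∞ f) (hg : ContDiff ℝ ∞ g) (i j : Fin d)
    (x : Euc d) : rot i j (fun x => f x + g x) x = rot i j f x + rot i j g x := by
  simp only [rot, pd_add hf hg]
  ring

theorem rot_sub {f g : Euc d → ℝ} (hf : ContDiff ℝ ∞ f) (hg : ContDiff ℝ ∞ g) (i j : Fin d)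
    (x : Euc d) : rot i j (fun x => f x - g x) x = rot i j f x - rot i j g x := by
  simp only [rot, pd_sub hf hg]
  ring

theorem sphEnergy_sub_self {f g : Euc d → ℝ} (hf : ContDiff ℝ ∞ f) (hg : ContDiff ℝ ∞ g) :
    sphEnergy (fun x => f x - g x) (fun x => f x - g x) =
      sphEnergy f f - 2 * sphEnergy f g + sphEnergy g g := by
  simp only [sphEnergy, Finset.mul_sum, ← Finset.sum_sub_distrib, ← Finset.sum_add_distrib]
  refine Finset.sum_congr rfl fun i _ => Finset.sum_congr rfl fun j _ => ?_
  have h1 := (contDiff_rot hf i j).continuous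
  have h2 := (contDiff_rot hg i j).continuous
  rw [← sphInt_const_mul, ← sphInt_sub (by fun_prop) (by fun_prop),
    ← sphInt_add (by fun_prop) (by fun_prop)]
  congr 1
  funext x
  rw [rot_sub hf hg]
  ring

theorem sphEnergy_add_self {f g : Euc d → ℝ} (hf : ContDiff ℝ ∞ f) (hg : ContDiff ℝ ∞ g) :
    sphEnergy (fun x => f x + g x) (fun x => f x + g x) =
      sphEnergy f f + 2 * sphEnergy f g + sphEnergy g g := by
  simp only [sphEnergy, Finset.mul_sum, ← Finset.sum_add_distrib]
  refine Finset.sum_congr rfl fun i _ => Finset.sum_congr rfl fun j _ => ?_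
  have h1 := (contDiff_rot hf i j).continuous
  have h2 := (contDiff_rot hg i j).continuous
  rw [← sphInt_const_mul, ← sphInt_add (by fun_prop) (by fun_prop),
    ← sphInt_add (by fun_prop) (by fun_prop)]
  congr 1
  funext x
  rw [rot_add hf hg]
  ring

theorem sphInt_sq_add {f g : Euc d → ℝ} (hf : Continuous f) (hg : Continuous g)
    (h : sphInt (fun x => f x * g x) = 0) :
    sphInt (fun x => (f x + g x) ^ 2) = sphInt (fun x => f x ^ 2) + sphInt fun x => g x ^ 2 := by
  have e : (fun x => (f x + g x) ^ 2) = fun x => f x ^ 2 + (2 * (f x * g x) + g x ^ 2) := by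
    funext x; ring
  rw [e, sphInt_add (by fun_prop) (by fun_prop), sphInt_add (by fun_prop) (by fun_prop),
    sphInt_const_mul, h]
  ring

/-- Induction on the degree. Split p = b + a with a the best approximation of degree at most m. As b
is orthogonal to lower degrees, its energy is exactly 2(m+1)(m+d-1) times its squared norm. The
cross energy vanishes because the Casimir operator preserves degree. These values increase with m,
so those above l are at least the claimed one; harmonic polynomials are never needed. -/
theorem sphere_gap_poly (hd : 1 ≤ d) (l m : ℕ) {p : MvPolynomial (Fin d) ℝ} (hp : p ∈ polyLE d m)
    (h : ∀ q ∈ polyLE d l, sphInt (fun x => evalP p x * evalP q x) = 0) :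
    2 * (((l : ℝ) + 1) * (l + d - 1)) * sphInt (fun x => evalP p x ^ 2) ≤
      sphEnergy (evalP p) (evalP p) := by
  have hd' : (1 : ℝ) ≤ d := by exact_mod_cast hd
  induction m generalizing p with
  | zero =>
    have := h p (polyLE_mono (Nat.zero_le l) hp)
    simp only [← sq] at this
    rw [this, mul_zero]
    exact sphEnergy_self_nonneg _
  | succ m ih =>
    rcases Nat.lt_or_ge l (m + 1) with hlm | hlm
    · have hlm' : l ≤ m := Nat.lt_succ_iff.1 hlm
      obtain ⟨a, ha, hproj⟩ := exists_polyLE_proj (continuous_evalP p) m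
      set b := p - a with hb
      have hbm : b ∈ polyLE d (m + 1) :=
        Submodule.sub_mem _ hp (polyLE_mono (Nat.le_succ m) ha)
      have hbq : ∀ q ∈ polyLE d m, sphInt (fun x => evalP b x * evalP q x) = 0 := by
        intro q hq
        simp only [hb, evalP_sub, sub_mul]
        have cp := continuous_evalP p
        have ca := continuous_evalP a
        have cq := continuous_evalP q
        rw [sphInt_sub (by fun_prop) (by fun_prop), hproj q hq, sub_self]
      have hpe : evalP p = fun x => evalP b x + evalP a x := by
        funext x; rw [hb, evalP_sub]; ring
      have iha := ih ha fun q hq => by rw [← hproj q (polyLE_mono hlm' hq), h q hq]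
      obtain ⟨c, hc, hcas⟩ := exists_casimirP_eq hbm
      have hbb : sphEnergy (evalP b) (evalP b) =
          2 * (((m : ℝ) + 1) * (m + d - 1)) * sphInt fun x => evalP b x ^ 2 := by
        rw [sphEnergy_evalP (contDiff_evalP b)]
        have e : sphInt (fun x => evalP b x * evalP (casimirP b) x) =
            sphInt fun x => evalP b x * evalP c x -
              2 * (((m : ℝ) + 1) * (m + d - 1)) * evalP b x ^ 2 :=
          sphInt_congr fun x hx => by rw [hcas x hx]; ring
        have cb := continuous_evalP b
        have cc := continuous_evalP c
        rw [e, sphInt_sub (by fun_prop) (by fun_prop), hbq c hc, sphInt_const_mul]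
        ring
      have hba : sphEnergy (evalP b) (evalP a) = 0 := by
        rw [sphEnergy_evalP (contDiff_evalP b), hbq _ (casimirP_mem ha), neg_zero]
      rw [hpe, sphEnergy_add_self (contDiff_evalP b) (contDiff_evalP a), hba, hbb,
        sphInt_sq_add (continuous_evalP b) (continuous_evalP a) (hbq a ha)]
      have hb0 : 0 ≤ sphInt fun x => evalP b x ^ 2 := sphInt_nonneg fun x => sq_nonneg _
      have hlm2 : (l : ℝ) ≤ m := by exact_mod_cast hlm'
      have hl0 : (0 : ℝ) ≤ l := by positivity
      have hmono : ((l : ℝ) + 1) * (l + d - 1) ≤ ((m : ℝ) + 1) * (m + d - 1) := by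
        apply mul_le_mul <;> linarith
      nlinarith [mul_le_mul_of_nonneg_right hmono hb0]
    · have := h p (polyLE_mono hlm hp)
      simp only [← sq] at this
      rw [this, mul_zero]
      exact sphEnergy_self_nonneg _

/-- The Poincaré inequality on the sphere for functions orthogonal to polynomials of degree at
most `l`. -/
theorem sphere_poincare (hd : 1 ≤ d) (l : ℕ) {f : Euc d → ℝ} (hf : ContDiff ℝ ∞ f)
    (h : ∀ q ∈ polyLE d l, sphInt (fun x => f x * evalP q x) = 0) :
    2 * (((l : ℝ) + 1) * (l + d - 1)) * sphInt (fun x => f x ^ 2) ≤ sphEnergy f f := by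
  have hd' : (1 : ℝ) ≤ d := by exact_mod_cast hd
  set μ : ℝ := 2 * (((l : ℝ) + 1) * (l + d - 1)) with hμ
  have hμ0 : 0 ≤ μ := by
    have : (0 : ℝ) ≤ l + d - 1 := by
      have : (0 : ℝ) ≤ l := by positivity
      linarith
    positivity
  have hfc := hf.continuous
  have key : ∀ p : MvPolynomial (Fin d) ℝ,
      μ * (sphInt (fun x => f x ^ 2) - sphInt fun x => (f x - evalP p x) ^ 2) ≤ sphEnergy f f := by
    intro p
    -- The projection a of f to degree at most m has no more energy than f, because the energy of f
    -- - a is nonnegative and the cross term equals the energy of a. The choice m ≥ l makes a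
    -- inherit the orthogonality of f, and m ≥ deg p makes a at least as good an approximation as p.
    set m := max l p.totalDegree with hm
    have hpm : p ∈ polyLE d m := mem_polyLE.2 (le_max_right _ _)
    obtain ⟨a, ha, hproj⟩ := exists_polyLE_proj hfc m
    have hac := continuous_evalP a
    have hpc := continuous_evalP p
    have h1 := sphere_gap_poly hd l m ha fun q hq => by
      rw [← hproj q (polyLE_mono (le_max_left _ _) hq), h q hq]
    have h2 : sphEnergy f (evalP a) = sphEnergy (evalP a) (evalP a) := by
      rw [sphEnergy_evalP hf, sphEnergy_evalP (contDiff_evalP a), hproj _ (casimirP_mem ha)]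
    have h3 := sphEnergy_self_nonneg fun x => f x - evalP a x
    rw [sphEnergy_sub_self hf (contDiff_evalP a), h2] at h3
    have h4 : sphInt (fun x => f x ^ 2) - sphInt (fun x => (f x - evalP p x) ^ 2) ≤
        sphInt fun x => evalP a x ^ 2 := by
      have e1 : (fun x => (f x - evalP p x) ^ 2) = fun x =>
          (f x ^ 2 - 2 * (f x * evalP p x)) + evalP p x ^ 2 := by
        funext x; ring
      have e2 : (fun x => (evalP a x - evalP p x) ^ 2) = fun x =>
          (evalP a x ^ 2 - 2 * (evalP a x * evalP p x)) + evalP p x ^ 2 := by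
        funext x; ring
      have h5 : 0 ≤ sphInt fun x => (evalP a x - evalP p x) ^ 2 :=
        sphInt_nonneg fun x => sq_nonneg _
      rw [e2, sphInt_add (by fun_prop) (by fun_prop), sphInt_sub (by fun_prop) (by fun_prop),
        sphInt_const_mul, ← hproj p hpm] at h5
      rw [e1, sphInt_add (by fun_prop) (by fun_prop), sphInt_sub (by fun_prop) (by fun_prop),
        sphInt_const_mul]
      linarith
    calc _ ≤ μ * sphInt fun x => evalP a x ^ 2 := mul_le_mul_of_nonneg_left h4 hμ0
      _ ≤ sphEnergy (evalP a) (evalP a) := h1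
      _ ≤ sphEnergy f f := by linarith
  have hS := sphInt_one_pos (d := d) hd
  set S := sphInt fun _ : Euc d => (1 : ℝ) with hSdef
  -- Only the squared error of p enters `key`, so uniform approximation suffices and no derivative
  -- of p has to be controlled.
  have hε : ∀ ε : ℝ, 0 < ε → μ * sphInt (fun x => f x ^ 2) - μ * S * ε ^ 2 ≤ sphEnergy f f := by
    intro ε hε
    obtain ⟨p, hp⟩ := exists_poly_near hfc hε
    have hpc := continuous_evalP p
    have h6 : sphInt (fun x => (f x - evalP p x) ^ 2) ≤ S * ε ^ 2 := by
      rw [← sphInt_const]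
      refine sphInt_mono (by fun_prop) continuous_const fun x hx => ?_
      exact sq_le_sq' (by linarith [neg_abs_le (f x - evalP p x), hp x hx])
        ((le_abs_self _).trans (hp x hx).le)
    have := key p
    nlinarith [mul_le_mul_of_nonneg_left h6 hμ0]
  have hlim : Filter.Tendsto (fun ε : ℝ => μ * sphInt (fun x => f x ^ 2) - μ * S * ε ^ 2)
      (nhdsWithin 0 (Set.Ioi 0)) (nhds (μ * sphInt (fun x => f x ^ 2) - μ * S * 0 ^ 2)) :=
    (Continuous.tendsto (by fun_prop) 0).mono_left nhdsWithin_le_nhds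
  have := le_of_tendsto hlim (Filter.eventually_of_mem self_mem_nhdsWithin hε)
  simpa using this

end Poincare

/-! ### The constants C(N,k) and C(N): lower bounds and near-minimisers. -/

section Constants

theorem lap_eq_laplacian {d : ℕ} {φ : Euc d → ℝ} (hφ : ContDiff ℝ ∞ φ) (x : Euc d) :
    Laplacian.laplacian φ x = lap φ x := by
  rw [InnerProductSpace.laplacian_eq_iteratedFDeriv_orthonormalBasis φ
    (EuclideanSpace.basisFun (Fin d) ℝ)]
  refine Finset.sum_congr rfl fun i _ => ?_
  have hd : DifferentiableAt ℝ (fderiv ℝ φ) x :=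
    differentiable_of_smooth (hφ.fderiv_right (m := ∞) (by simp)) x
  have h : pd i φ = fun y => fderiv ℝ φ y (EuclideanSpace.single i 1) := rfl
  rw [iteratedFDeriv_two_apply, pd, h, fderiv_clm_apply hd (differentiableAt_const _)]
  simp

theorem norm_gradient_sq {d : ℕ} (φ : Euc d → ℝ) (x : Euc d) :
    ‖gradient φ x‖ ^ 2 = gradDot φ φ x := by
  rw [norm_sq_eq_sum, gradDot]
  refine Finset.sum_congr rfl fun i _ => ?_
  have h : gradient φ x i = pd i φ x := by
    have h1 : inner ℝ (gradient φ x) (EuclideanSpace.single i (1 : ℝ)) = pd i φ x := by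
      rw [gradient, InnerProductSpace.toDual_symm_apply, pd]
    rw [← h1, EuclideanSpace.inner_single_right]
    simp
  rw [h, sq]

/-- An even smooth cutoff: `1` on `[-1, 1]` and `0` outside `(-2, 2)`. -/
theorem exists_cutoff : ∃ χ : ℝ → ℝ, EvenSmooth χ ∧ (∀ r, |r| ≤ 1 → χ r = 1) ∧
    (∀ r, 2 ≤ |r| → χ r = 0) ∧ (∀ r, 0 ≤ χ r) ∧ ∀ r, χ r ≤ 1 := by
  let f : ContDiffBump (0 : ℝ) := ⟨1, 2, by norm_num, by norm_num⟩
  refine ⟨f, ⟨f.contDiff, fun r => ?_⟩, fun r hr => f.one_of_mem_closedBall (by simpa using hr),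
    fun r hr => f.zero_of_le_dist (by simpa using hr), fun r => f.nonneg, fun r => f.le_one⟩
  simpa using f.neg r

theorem gradDot_integral_pos {d : ℕ} (hd : 0 < d) {φ : Euc d → ℝ} (hφ : IsTest φ) (h0 : φ ≠ 0) :
    0 < ∫ x, gradDot φ φ x := by
  refine lt_of_le_of_ne (integral_nonneg fun x => gradDot_self_nonneg φ x) fun h => h0 ?_
  have hc := (hφ.gradDot hφ).continuous
  have h1 : gradDot φ φ = 0 := by
    have := (integral_eq_zero_iff_of_nonneg (gradDot_self_nonneg φ)
      (hφ.gradDot hφ).integrable).1 h.symm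
    exact (Continuous.ae_eq_iff_eq volume hc continuous_const).1 this
  have h2 : ∀ i x, pd i φ x = 0 := fun i x => by
    have := congrFun h1 x
    rw [gradDot, Pi.zero_apply, Finset.sum_eq_zero_iff_of_nonneg fun _ _ => mul_self_nonneg _] at this
    exact mul_self_eq_zero.1 (this i (Finset.mem_univ i))
  have h3 : ∀ x y, φ x = φ y := is_const_of_fderiv_eq_zero (differentiable_of_smooth hφ.smooth)
    fun x => by
      ext v
      rw [fderiv_apply_eq_sum_pd]
      simp [h2]
  have : Nontrivial (Euc d) :=
    Module.nontrivial_of_finrank_pos (R := ℝ) (by simpa using hd)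
  have : NoncompactSpace (Euc d) := NormedSpace.noncompactSpace ℝ _
  obtain ⟨y, hy⟩ : ∃ y, y ∉ tsupport φ := by
    by_contra! h
    exact this.noncompact_univ (by
      have : tsupport φ = Set.univ := Set.eq_univ_of_forall h
      rw [← this]
      exact hφ.compact)
  funext x
  rw [h3 x y, image_eq_zero_of_notMem_tsupport hy]
  rfl

/-- The numerator of the radial quotient, in coordinates. -/
noncomputable def radialNum (N k : ℕ) (u : Euc (N + 2 * k) → ℝ) : ℝ :=
  (∫ x, lap u x ^ 2) + ∫ x, (‖x‖ ^ 2 * gradDot u u x - 2 * (k : ℝ) * u x ^ 2)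

variable {N k : ℕ}

theorem IsRadialTest.isTest {d : ℕ} {u : Euc d → ℝ} (hu : IsRadialTest u) : IsTest u :=
  ⟨hu.smooth, hu.compactSupport⟩

theorem radialQuotient_eq {u : Euc (N + 2 * k) → ℝ} (hu : IsRadialTest u) :
    radialQuotient N k u = radialNum N k u / ∫ x, gradDot u u x := by
  simp only [radialQuotient, radialNum, norm_gradient_sq, lap_eq_laplacian hu.smooth,
    mul_comm (gradDot u u _)]

theorem radialNum_eq {u : Euc (N + 2 * k) → ℝ} (hu : IsTest u) :
    radialNum N k u = (∫ x, lap u x ^ 2) + (∫ x, ‖x‖ ^ 2 * gradDot u u x)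
      - 2 * (k : ℝ) * ∫ x, u x ^ 2 := by
  rw [radialNum, integral_sub ((hu.gradDot hu).mul_left contDiff_normSq).integrable,
    integral_const_mul]
  · ring
  · simpa only [sq (u _)] using (hu.integrable_mul hu.continuous).const_mul (2 * (k : ℝ))

theorem integral_eul_sq_le {d : ℕ} {u : Euc d → ℝ} (hu : IsTest u) :
    ∫ x, eul u x ^ 2 ≤ ∫ x, ‖x‖ ^ 2 * gradDot u u x := by
  refine integral_mono ?_ ((hu.gradDot hu).mul_left contDiff_normSq).integrable (eul_sq_le u)
  simpa only [sq] using hu.eul.integrable_mul hu.eul.continuous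

/-- In dimension N+2k the choice c = N+k makes the coefficient of ∫|∇u|² in
`integral_sq_lap_add_eul` equal to -(N+2). After the term -2k∫u² is absorbed, k(N+k-2)∫u² ≥ 0 is
left over. Radiality plays no role. -/
theorem le_radialNum (hN : 2 ≤ N) (hk : 1 ≤ k) {u : Euc (N + 2 * k) → ℝ} (hu : IsTest u) :
    ((N : ℝ) + 2) * ∫ x, gradDot u u x ≤ radialNum N k u := by
  have h1 := integral_sq_lap_add_eul hu ((N : ℝ) + k)
  have h2 : 0 ≤ ∫ x, (lap u x + eul u x + ((N : ℝ) + k) * u x) ^ 2 :=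
    integral_nonneg fun x => sq_nonneg _
  have h3 := integral_eul_sq_le hu
  have h4 : 0 ≤ ∫ x, u x ^ 2 := integral_nonneg fun x => sq_nonneg _
  rw [radialNum_eq hu]
  push_cast at h1
  have hN' : (2 : ℝ) ≤ N := by exact_mod_cast hN
  have hk' : (1 : ℝ) ≤ k := by exact_mod_cast hk
  nlinarith [mul_nonneg (mul_nonneg (by linarith : (0 : ℝ) ≤ k)
    (by linarith : (0 : ℝ) ≤ N + k - 2)) h4]

theorem le_radialQuotient (hN : 2 ≤ N) (hk : 1 ≤ k) {u : Euc (N + 2 * k) → ℝ}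
    (hu : IsRadialTest u) : (N : ℝ) + 2 ≤ radialQuotient N k u := by
  rw [radialQuotient_eq hu,
    le_div_iff₀ (gradDot_integral_pos (by omega) hu.isTest hu.ne_zero)]
  exact le_radialNum hN hk hu.isTest

theorem exists_isRadialTest {d : ℕ} : ∃ u : Euc d → ℝ, IsRadialTest u := by
  obtain ⟨χ, hχ, h1, h2, -, -⟩ := exists_cutoff
  have ht : IsTest fun x : Euc d => χ ‖x‖ := hχ.isTest_comp_norm (R := 2) fun r hr =>
    h2 r (hr.trans (le_abs_self r))
  refine ⟨_, ht.smooth, ht.compact, fun x y h => by simp only [h], fun h => ?_⟩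
  have := congrFun h 0
  simp [h1] at this

/-- Besides the sign, this supplies the lower bound that makes the outer infimum genuine: `sInf` of
a real set unbounded below is 0 by convention. -/
theorem stabConstK_nonneg (hN : 2 ≤ N) (hk : 1 ≤ k) : 0 ≤ stabConstK N k := by
  refine sub_nonneg.2 (le_csInf ?_ ?_)
  · obtain ⟨u, hu⟩ := exists_isRadialTest (d := N + 2 * k)
    exact ⟨radialQuotient N k u, u, hu, rfl⟩
  · rintro _ ⟨u, hu, rfl⟩
    exact le_radialQuotient hN hk hu

theorem stabConst_nonneg (hN : 2 ≤ N) : 0 ≤ stabConst N := by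
  refine Real.sInf_nonneg ?_
  rintro _ ⟨k, hk, rfl⟩
  exact stabConstK_nonneg hN hk

theorem stabConst_mul_le (hN : 2 ≤ N) (hk : 1 ≤ k) {u : Euc (N + 2 * k) → ℝ}
    (hu : IsRadialTest u) :
    (stabConst N + (N + 2)) * ∫ x, gradDot u u x ≤ radialNum N k u := by
  have h1 : stabConst N ≤ stabConstK N k := by
    rw [stabConst]
    refine csInf_le ⟨0, ?_⟩ (Set.mem_ofPred.2 ⟨k, hk, rfl⟩)
    rintro _ ⟨k, hk, rfl⟩
    exact stabConstK_nonneg hN hk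
  have h2 : stabConstK N k ≤ radialQuotient N k u - (N + 2) := by
    refine sub_le_sub_right (csInf_le ⟨(N : ℝ) + 2, ?_⟩ (Set.mem_ofPred.2 ⟨u, hu, rfl⟩)) _
    rintro _ ⟨u, hu, rfl⟩
    exact le_radialQuotient hN hk hu
  rw [← le_div_iff₀ (gradDot_integral_pos (by omega) hu.isTest hu.ne_zero),
    ← radialQuotient_eq hu]
  linarith

theorem exists_radialNum_lt {c : ℝ} (hc : stabConst N < c) :
    ∃ k, 1 ≤ k ∧ ∃ u : Euc (N + 2 * k) → ℝ, IsRadialTest u ∧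
      radialNum N k u < (c + (N + 2)) * ∫ x, gradDot u u x := by
  obtain ⟨_, ⟨k, hk, rfl⟩, h1⟩ := exists_lt_of_csInf_lt
    ⟨stabConstK N 1, Set.mem_ofPred.2 ⟨1, le_rfl, rfl⟩⟩ hc
  have h2 : sInf {q : ℝ | ∃ u : Euc (N + 2 * k) → ℝ, IsRadialTest u ∧ q = radialQuotient N k u} <
      c + (N + 2) := by
    rw [stabConstK] at h1
    linarith
  obtain ⟨u₀, hu₀⟩ := exists_isRadialTest (d := N + 2 * k)
  obtain ⟨_, ⟨u, hu, rfl⟩, h3⟩ := exists_lt_of_csInf_lt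
    ⟨radialQuotient N k u₀, Set.mem_ofPred.2 ⟨u₀, hu₀, rfl⟩⟩ h2
  refine ⟨k, hk, u, hu, ?_⟩
  rcases Nat.eq_zero_or_pos (N + 2 * k) with h0 | h0
  · omega
  · rwa [radialQuotient_eq hu, div_lt_iff₀ (gradDot_integral_pos h0 hu.isTest hu.ne_zero)] at h3

end Constants

/-! ### Products of solid harmonics with radial profiles. -/

/-- Solid harmonics of degree `k`: harmonic functions homogeneous of degree `k`. -/
structure IsSolidHarmonic {d : ℕ} (k : ℕ) (Y : Euc d → ℝ) : Prop where
  smooth : ContDiff ℝ ∞ Y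
  harmonic : ∀ x, lap Y x = 0
  homogeneous : ∀ (r : ℝ) x, Y (r • x) = r ^ k * Y x
  euler : ∀ x, eul Y x = k * Y x

/-- The even smooth function `v'(r) / r`. -/
noncomputable def rdiv (v : ℝ → ℝ) : ℝ → ℝ :=
  Classical.epsilon fun g => EvenSmooth g ∧ ∀ r, deriv v r = r * g r

/-- The profile `v'' + (m - 1) v' / r` of the Laplacian in dimension `m`. -/
noncomputable def lapProfile (m : ℝ) (v : ℝ → ℝ) (r : ℝ) : ℝ :=
  m * rdiv v r + r ^ 2 * rdiv (rdiv v) r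

/-- `φ` is orthogonal to all products of `Y` with radial functions. -/
def OrthRadial {d : ℕ} (Y φ : Euc d → ℝ) : Prop :=
  ∀ w : ℝ → ℝ, Continuous w → ∫ x, φ x * (Y x * w ‖x‖) = 0

section Radial

variable {d k : ℕ} {v : ℝ → ℝ} {Y φ ψ : Euc d → ℝ}

theorem EvenSmooth.rdiv (hv : EvenSmooth v) : EvenSmooth (rdiv v) :=
  (Classical.epsilon_spec hv.exists_rdiv).1

theorem EvenSmooth.deriv_eq (hv : EvenSmooth v) (r : ℝ) : deriv v r = r * _root_.rdiv v r :=
  (Classical.epsilon_spec hv.exists_rdiv).2 r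

theorem EvenSmooth.pd_radial (hv : EvenSmooth v) (i : Fin d) (x : Euc d) :
    pd i (fun x => v ‖x‖) x = x i * _root_.rdiv v ‖x‖ := hv.pd_comp_norm hv.deriv_eq i x

theorem evenSmooth_sq : EvenSmooth fun r => r ^ 2 := ⟨contDiff_id.pow 2, fun r => by ring⟩

theorem EvenSmooth.add {u : ℝ → ℝ} (hu : EvenSmooth u) (hv : EvenSmooth v) :
    EvenSmooth fun r => u r + v r :=
  ⟨hu.smooth.add hv.smooth, fun r => by rw [hu.even, hv.even]⟩

theorem EvenSmooth.lapProfile (hv : EvenSmooth v) (m : ℝ) : EvenSmooth (lapProfile m v) :=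
  ((EvenSmooth.const m).mul hv.rdiv).add (evenSmooth_sq.mul hv.rdiv.rdiv)

theorem EvenSmooth.rdiv_eq_zero (hv : EvenSmooth v) {R : ℝ} (hR : ∀ r, R < r → v r = 0) {r : ℝ}
    (hr : max R 0 < r) : _root_.rdiv v r = 0 := by
  have h1 : v =ᶠ[nhds r] fun _ => 0 :=
    Filter.eventually_of_mem (Ioi_mem_nhds (lt_of_le_of_lt (le_max_left _ _) hr)) hR
  have h2 := hv.deriv_eq r
  rw [h1.deriv_eq, deriv_const] at h2
  exact (mul_eq_zero.1 h2.symm).resolve_left (lt_of_le_of_lt (le_max_right _ _) hr).ne'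

theorem EvenSmooth.lapProfile_eq_zero (hv : EvenSmooth v) {R : ℝ} (hR : ∀ r, R ≤ r → v r = 0)
    (m : ℝ) {r : ℝ} (hr : max R 0 < r) : _root_.lapProfile m v r = 0 := by
  have h1 : ∀ r, max R 0 < r → _root_.rdiv v r = 0 := fun r hr =>
    hv.rdiv_eq_zero (fun s hs => hR s hs.le) hr
  have h2 := hv.rdiv.rdiv_eq_zero h1 (r := r) (by simpa using hr)
  rw [_root_.lapProfile, h1 r hr, h2]
  ring

theorem sum_sq_coord (x : Euc d) : ∑ i, x i * x i = ‖x‖ ^ 2 := by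
  rw [norm_sq_eq_sum]
  simp only [sq]

theorem EvenSmooth.lap_radial (hv : EvenSmooth v) (x : Euc d) :
    lap (fun x => v ‖x‖) x = _root_.lapProfile d v ‖x‖ := by
  have h : ∀ i : Fin d, pd i (fun x : Euc d => v ‖x‖) = fun x => x i * _root_.rdiv v ‖x‖ :=
    fun i => funext (hv.pd_radial i)
  have h2 : ∀ i : Fin d, pd i (pd i fun x : Euc d => v ‖x‖) x =
      _root_.rdiv v ‖x‖ + x i * x i * _root_.rdiv (_root_.rdiv v) ‖x‖ := by
    intro i
    rw [h i, pd_mul (contDiff_coord i) hv.rdiv.contDiff_comp_norm]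
    simp only [pd_coord, if_true, hv.rdiv.pd_radial]
    ring
  simp only [lap, h2, Finset.sum_add_distrib, ← Finset.sum_mul, sum_sq_coord, _root_.lapProfile]
  simp

theorem EvenSmooth.eul_radial (hv : EvenSmooth v) (x : Euc d) :
    eul (fun x => v ‖x‖) x = ‖x‖ ^ 2 * _root_.rdiv v ‖x‖ := by
  simp only [eul, hv.pd_radial, ← mul_assoc, ← Finset.sum_mul, sum_sq_coord]

theorem EvenSmooth.gradDot_radial (hv : EvenSmooth v) (x : Euc d) :
    gradDot (fun x => v ‖x‖) (fun x => v ‖x‖) x = ‖x‖ ^ 2 * _root_.rdiv v ‖x‖ ^ 2 := by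
  rw [← sum_sq_coord, Finset.sum_mul]
  simp only [gradDot, hv.pd_radial]
  exact Finset.sum_congr rfl fun i _ => by ring

theorem lap_mul {f g : Euc d → ℝ} (hf : ContDiff ℝ ∞ f) (hg : ContDiff ℝ ∞ g) (x : Euc d) :
    lap (fun x => f x * g x) x = lap f x * g x + 2 * gradDot f g x + f x * lap g x := by
  have h : ∀ i, pd i (pd i fun x => f x * g x) x =
      pd i (pd i f) x * g x + 2 * (pd i f x * pd i g x) + f x * pd i (pd i g) x := by
    intro i
    rw [pd_mul hf hg, pd_add ((contDiff_pd hf i).mul hg) (hf.mul (contDiff_pd hg i)),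
      pd_mul (contDiff_pd hf i) hg, pd_mul hf (contDiff_pd hg i)]
    ring
  simp only [lap, gradDot, h, Finset.sum_add_distrib, Finset.sum_mul, Finset.mul_sum]

theorem eul_mul {f g : Euc d → ℝ} (hf : ContDiff ℝ ∞ f) (hg : ContDiff ℝ ∞ g) (x : Euc d) :
    eul (fun x => f x * g x) x = eul f x * g x + f x * eul g x := by
  simp only [eul, pd_mul hf hg, Finset.sum_mul, Finset.mul_sum, ← Finset.sum_add_distrib]
  exact Finset.sum_congr rfl fun i _ => by ring

namespace IsSolidHarmonic

theorem one : IsSolidHarmonic 0 (fun _ : Euc d => (1 : ℝ)) where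
  smooth := contDiff_const
  harmonic x := by simp [lap, pd_const]
  homogeneous r x := by simp
  euler x := by simp [eul, pd_const]

theorem coord (i : Fin d) : IsSolidHarmonic 1 (fun x : Euc d => x i) where
  smooth := contDiff_coord i
  harmonic x := by
    have : ∀ j : Fin d, pd j (fun x : Euc d => x i) = fun _ => if j = i then 1 else 0 :=
      fun j => funext (pd_coord j i)
    simp [lap, this, pd_const]
  homogeneous r x := by simp
  euler x := by simp [eul, pd_coord]

/-- Harmonicity kills ΔY, and Euler's relation makes the cross term 2∇Y·∇v equal to 2kY v'/r, which
is the first-order term of 2k extra dimensions. This is where ℝ^{N+2k} comes from. -/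
theorem lap_mul_radial (hY : IsSolidHarmonic k Y) (hv : EvenSmooth v) (x : Euc d) :
    lap (fun x => Y x * v ‖x‖) x = Y x * lapProfile (d + 2 * k) v ‖x‖ := by
  rw [lap_mul hY.smooth hv.contDiff_comp_norm, hY.harmonic, hv.lap_radial]
  have h : gradDot Y (fun x => v ‖x‖) x = k * Y x * rdiv v ‖x‖ := by
    rw [← hY.euler, eul, Finset.sum_mul]
    simp only [gradDot, hv.pd_radial]
    exact Finset.sum_congr rfl fun i _ => by ring
  rw [h, lapProfile, lapProfile]
  ring

theorem eul_mul_radial (hY : IsSolidHarmonic k Y) (hv : EvenSmooth v) (x : Euc d) :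
    eul (fun x => Y x * v ‖x‖) x = Y x * (k * v ‖x‖ + ‖x‖ ^ 2 * rdiv v ‖x‖) := by
  rw [eul_mul hY.smooth hv.contDiff_comp_norm, hY.euler, hv.eul_radial]
  ring

theorem isTest_mul_radial (hY : IsSolidHarmonic k Y) (hv : EvenSmooth v) {R : ℝ}
    (hR : ∀ r, R ≤ r → v r = 0) : IsTest fun x => Y x * v ‖x‖ :=
  (hv.isTest_comp_norm hR).mul_left hY.smooth

section Cross

variable (hY : IsSolidHarmonic k Y) (hv : EvenSmooth v) (ht : IsTest fun x => Y x * v ‖x‖)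
  (hφ : IsTest φ) (ho : OrthRadial Y φ)

include hY hv ht hφ ho

/-- The Laplacian sends Y times a radial function to another such product. Integrating by parts away
from φ leaves φ paired with that product. The next two cross terms vanish for the same reason, with
the Euler operator and the bi-Laplacian. -/
theorem integral_gradDot_eq_zero : ∫ x, gradDot φ (fun x => Y x * v ‖x‖) x = 0 := by
  rw [integral_gradDot hφ.smooth ht]
  simp only [hY.lap_mul_radial hv]
  rw [ho _ (hv.lapProfile _).continuous, neg_zero]

theorem integral_normSq_gradDot_eq_zero :
    ∫ x, ‖x‖ ^ 2 * gradDot φ (fun x => Y x * v ‖x‖) x = 0 := by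
  rw [integral_normSq_gradDot hφ.smooth ht]
  simp only [hY.lap_mul_radial hv, hY.eul_mul_radial hv]
  have h := ho (fun r => r ^ 2 * lapProfile (d + 2 * k) v r + 2 * (k * v r + r ^ 2 * rdiv v r))
    (by
      have h1 := (hv.lapProfile (d + 2 * k)).continuous
      have h2 := hv.continuous
      have h3 := hv.rdiv.continuous
      fun_prop)
  rw [neg_eq_zero, ← h]
  congr 1
  funext x
  ring

theorem integral_lap_mul_lap_eq_zero :
    ∫ x, lap φ x * lap (fun x => Y x * v ‖x‖) x = 0 := by
  rw [← integral_mul_lap_comm hφ.smooth ht.lap]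
  have h : lap (fun x => Y x * v ‖x‖) = fun x => Y x * lapProfile (d + 2 * k) v ‖x‖ :=
    funext (hY.lap_mul_radial hv)
  rw [h]
  simp only [hY.lap_mul_radial (hv.lapProfile _)]
  exact ho _ ((hv.lapProfile _).lapProfile _).continuous

end Cross

end IsSolidHarmonic

/-- The quadratic form `∫ |Δφ|² + ∫ |x|² |∇φ|² - c ∫ |∇φ|²`. -/
noncomputable def quadForm (c : ℝ) (φ : Euc d → ℝ) : ℝ :=
  (∫ x, lap φ x ^ 2) + (∫ x, ‖x‖ ^ 2 * gradDot φ φ x) - c * ∫ x, gradDot φ φ x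

theorem gradDot_add_self (hφ : ContDiff ℝ ∞ φ) (hψ : ContDiff ℝ ∞ ψ) (x : Euc d) :
    gradDot (fun x => φ x + ψ x) (fun x => φ x + ψ x) x =
      gradDot φ φ x + 2 * gradDot φ ψ x + gradDot ψ ψ x := by
  simp only [gradDot, pd_add hφ hψ, Finset.mul_sum, ← Finset.sum_add_distrib]
  exact Finset.sum_congr rfl fun i _ => by ring

theorem lap_add (hφ : ContDiff ℝ ∞ φ) (hψ : ContDiff ℝ ∞ ψ) (x : Euc d) :
    lap (fun x => φ x + ψ x) x = lap φ x + lap ψ x := by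
  simp only [lap, pd_add hφ hψ, pd_add (contDiff_pd hφ _) (contDiff_pd hψ _),
    Finset.sum_add_distrib]

theorem integral_add_two_mul_add {f g h : Euc d → ℝ} (hf : Integrable f) (hg : Integrable g)
    (hh : Integrable h) (h0 : ∫ x, g x = 0) :
    ∫ x, (f x + 2 * g x + h x) = (∫ x, f x) + ∫ x, h x := by
  rw [integral_add (hf.fun_add (hg.const_mul 2)) hh, integral_add hf (hg.const_mul 2),
    integral_const_mul, h0]
  ring

theorem integral_gradDot_add (hY : IsSolidHarmonic k Y) (hv : EvenSmooth v)
    (ht : IsTest fun x => Y x * v ‖x‖) (hφ : IsTest φ) (ho : OrthRadial Y φ) :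
    ∫ x, gradDot (fun x => φ x + Y x * v ‖x‖) (fun x => φ x + Y x * v ‖x‖) x =
      (∫ x, gradDot φ φ x) + ∫ x, gradDot (fun x => Y x * v ‖x‖) (fun x => Y x * v ‖x‖) x := by
  simp only [gradDot_add_self hφ.smooth ht.smooth]
  exact integral_add_two_mul_add (hφ.gradDot hφ).integrable (hφ.gradDot ht).integrable
    (ht.gradDot ht).integrable (hY.integral_gradDot_eq_zero hv ht hφ ho)

theorem quadForm_add (c : ℝ) (hY : IsSolidHarmonic k Y) (hv : EvenSmooth v)
    (ht : IsTest fun x => Y x * v ‖x‖) (hφ : IsTest φ) (ho : OrthRadial Y φ) :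
    quadForm c (fun x => φ x + Y x * v ‖x‖) =
      quadForm c φ + quadForm c fun x => Y x * v ‖x‖ := by
  have h2 : ∫ x, ‖x‖ ^ 2 *
        gradDot (fun x => φ x + Y x * v ‖x‖) (fun x => φ x + Y x * v ‖x‖) x =
      (∫ x, ‖x‖ ^ 2 * gradDot φ φ x) +
        ∫ x, ‖x‖ ^ 2 * gradDot (fun x => Y x * v ‖x‖) (fun x => Y x * v ‖x‖) x := by
    rw [← integral_add_two_mul_add ((hφ.gradDot hφ).mul_left contDiff_normSq).integrable
      ((hφ.gradDot ht).mul_left contDiff_normSq).integrable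
      ((ht.gradDot ht).mul_left contDiff_normSq).integrable
      (hY.integral_normSq_gradDot_eq_zero hv ht hφ ho)]
    congr 1
    funext x
    rw [gradDot_add_self hφ.smooth ht.smooth]
    ring
  have h3 : ∫ x, lap (fun x => φ x + Y x * v ‖x‖) x ^ 2 =
      (∫ x, lap φ x ^ 2) + ∫ x, lap (fun x => Y x * v ‖x‖) x ^ 2 := by
    rw [← integral_add_two_mul_add (by simpa only [sq] using hφ.lap.integrable_mul hφ.lap.continuous)
      (hφ.lap.integrable_mul ht.lap.continuous)
      (by simpa only [sq] using ht.lap.integrable_mul ht.lap.continuous)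
      (hY.integral_lap_mul_lap_eq_zero hv ht hφ ho)]
    congr 1
    funext x
    rw [lap_add hφ.smooth ht.smooth]
    ring
  rw [quadForm, h2, h3, integral_gradDot_add hY hv ht hφ ho, quadForm, quadForm]
  ring

/-- The ratio of `∫ Y² w(|x|)` on `ℝ^d` to `∫ w(|x|)` on `ℝ^{d + 2k}`. -/
noncomputable def harmonicRatio (k : ℕ) (Y : Euc d → ℝ) : ℝ :=
  sphInt (fun x => Y x ^ 2) / sphInt fun _ : Euc (d + 2 * k) => 1

theorem harmonicRatio_nonneg (k : ℕ) (Y : Euc d → ℝ) : 0 ≤ harmonicRatio k Y :=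
  div_nonneg (sphInt_nonneg fun _ => sq_nonneg _) (sphInt_nonneg fun _ => zero_le_one)

theorem integrable_radial_of_vanish {w : ℝ → ℝ} (hw : Continuous w) {R : ℝ}
    (hR : ∀ r, R ≤ r → w r = 0) : Integrable fun x : Euc d => w ‖x‖ :=
  (hw.comp continuous_norm).integrable_of_hasCompactSupport (hasCompactSupport_comp_norm hR)

theorem integral_radial (hd : 0 < d) {w : ℝ → ℝ} (hw : Integrable fun x : Euc d => w ‖x‖) :
    ∫ x : Euc d, w ‖x‖ =
      sphInt (fun _ : Euc d => 1) * ∫ r in Set.Ioi (0 : ℝ), r ^ (d - 1) * w r := by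
  rw [integral_polar hd hw, ← integral_const_mul]
  refine setIntegral_congr_fun measurableSet_Ioi fun r hr => ?_
  have h : sphInt (fun x : Euc d => w ‖r • x‖) = sphInt (fun _ : Euc d => 1) * w r := by
    rw [← sphInt_const]
    refine sphInt_congr fun x hx => ?_
    rw [norm_smul, hx, mul_one, Real.norm_of_nonneg (le_of_lt hr)]
  simp only [h]
  ring

/-- By homogeneity Y² contributes r^{2k}, which turns the polar density r^{d-1} into that of
ℝ^{d+2k}; only the angular constants differ. -/
theorem integral_harmonic_sq (hd : 0 < d) (hY : IsSolidHarmonic k Y) {w : ℝ → ℝ}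
    (hw : Continuous w) {R : ℝ} (hR : ∀ r, R ≤ r → w r = 0) :
    ∫ x, Y x ^ 2 * w ‖x‖ = harmonicRatio k Y * ∫ x : Euc (d + 2 * k), w ‖x‖ := by
  have hd' : 0 < d + 2 * k := by omega
  have hint : Integrable fun x : Euc d => Y x ^ 2 * w ‖x‖ :=
    ((hY.smooth.continuous.pow 2).mul (hw.comp continuous_norm)).integrable_of_hasCompactSupport
      (hasCompactSupport_comp_norm hR).mul_left
  rw [integral_radial hd' (integrable_radial_of_vanish hw hR), integral_polar hd hint,
    harmonicRatio, div_mul_eq_mul_div, mul_comm (sphInt fun _ : Euc (d + 2 * k) => 1),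
    ← mul_assoc, mul_div_cancel_right₀ _ (sphInt_one_pos hd').ne', ← integral_const_mul]
  refine setIntegral_congr_fun measurableSet_Ioi fun r hr => ?_
  have h : sphInt (fun x : Euc d => Y (r • x) ^ 2 * w ‖r • x‖) =
      sphInt (fun x => Y x ^ 2) * (r ^ (2 * k) * w r) := by
    rw [← sphInt_mul_const]
    refine sphInt_congr fun x hx => ?_
    rw [norm_smul, hx, mul_one, Real.norm_of_nonneg (le_of_lt hr), hY.homogeneous]
    ring
  simp only [h]
  have e : d + 2 * k - 1 = d - 1 + 2 * k := by omega
  rw [e, pow_add]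
  ring

section Transfer

variable (hd : 0 < d) (hY : IsSolidHarmonic k Y) (hv : EvenSmooth v) {R : ℝ}
  (hR : ∀ r, R ≤ r → v r = 0)

include hd hY hv hR

theorem integral_gradDot_harmonic :
    ∫ x, gradDot (fun x => Y x * v ‖x‖) (fun x => Y x * v ‖x‖) x =
      harmonicRatio k Y *
        ∫ x : Euc (d + 2 * k), gradDot (fun x => v ‖x‖) (fun x => v ‖x‖) x := by
  have ht := hY.isTest_mul_radial hv hR
  have ht' : IsTest fun x : Euc (d + 2 * k) => v ‖x‖ := hv.isTest_comp_norm hR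
  rw [integral_gradDot ht.smooth ht, integral_gradDot ht'.smooth ht', mul_neg]
  simp only [hY.lap_mul_radial hv, hv.lap_radial]
  push_cast
  rw [← integral_harmonic_sq hd hY (w := fun r => v r * lapProfile (d + 2 * k) v r)
    (hv.continuous.mul (hv.lapProfile _).continuous) (R := R) fun r hr => by rw [hR r hr, zero_mul]]
  congr 2
  funext x
  ring

/-- The term -2k∫u² in the radial quotient appears here: integrating |x|²|∇(Yv)|² by parts produces
the Euler operator, which acts on Yv with an additional kYv. -/
theorem quadForm_harmonic (c : ℝ) :
    quadForm c (fun x => Y x * v ‖x‖) = harmonicRatio k Y *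
      (radialNum d k (fun x => v ‖x‖) -
        c * ∫ x : Euc (d + 2 * k), gradDot (fun x => v ‖x‖) (fun x => v ‖x‖) x) := by
  have ht := hY.isTest_mul_radial hv hR
  have ht' : IsTest fun x : Euc (d + 2 * k) => v ‖x‖ := hv.isTest_comp_norm hR
  have hvc := hv.continuous
  have hlc := (hv.lapProfile (d + 2 * k)).continuous
  have hgc := hv.rdiv.continuous
  have h1 : ∫ x, lap (fun x => Y x * v ‖x‖) x ^ 2 =
      harmonicRatio k Y * ∫ x : Euc (d + 2 * k), lap (fun x => v ‖x‖) x ^ 2 := by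
    simp only [hY.lap_mul_radial hv, hv.lap_radial]
    push_cast
    have hlR : ∀ r, max R 0 + 1 ≤ r → lapProfile (d + 2 * k) v r ^ 2 = 0 := by
      intro r hr
      rw [hv.lapProfile_eq_zero hR _ (by linarith)]
      norm_num
    rw [← integral_harmonic_sq hd hY (w := fun r => lapProfile (d + 2 * k) v r ^ 2)
      (hlc.pow 2) hlR]
    simp only [mul_pow]
  have h2 : ∫ x, ‖x‖ ^ 2 * gradDot (fun x => Y x * v ‖x‖) (fun x => Y x * v ‖x‖) x =
      harmonicRatio k Y *
        ((∫ x : Euc (d + 2 * k), ‖x‖ ^ 2 * gradDot (fun x => v ‖x‖) (fun x => v ‖x‖) x)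
          - 2 * (k : ℝ) * ∫ x : Euc (d + 2 * k), v ‖x‖ ^ 2) := by
    rw [integral_normSq_gradDot ht.smooth ht, integral_normSq_gradDot ht'.smooth ht']
    simp only [hY.lap_mul_radial hv, hY.eul_mul_radial hv, hv.lap_radial, hv.eul_radial]
    push_cast
    set w : ℝ → ℝ := fun r => v r *
      (r ^ 2 * lapProfile (d + 2 * k) v r + 2 * (r ^ 2 * rdiv v r)) with hw
    have hwc : Continuous w := by fun_prop
    have i1 := integral_harmonic_sq hd hY (w := fun r => w r + 2 * k * v r ^ 2) (by fun_prop)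
      (R := R) fun r hr => by simp [hw, hR r hr]
    rw [integral_add (integrable_radial_of_vanish hwc (R := R) fun r hr => by simp [hw, hR r hr])
      (integrable_radial_of_vanish (w := fun r => 2 * k * v r ^ 2) (by fun_prop)
        (R := R) fun r hr => by simp [hR r hr]), integral_const_mul] at i1
    have e : (fun x : Euc d => Y x * v ‖x‖ * (‖x‖ ^ 2 * (Y x * lapProfile (d + 2 * k) v ‖x‖) +
        2 * (Y x * (k * v ‖x‖ + ‖x‖ ^ 2 * rdiv v ‖x‖)))) =
        fun x => Y x ^ 2 * (w ‖x‖ + 2 * k * v ‖x‖ ^ 2) := by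
      funext x
      simp only [hw]
      ring
    rw [e, i1]
    ring
  rw [quadForm, h1, h2, integral_gradDot_harmonic hd hY hv hR, radialNum_eq ht']
  ring

end Transfer

end Radial

/-! ### A one-dimensional Poincaré inequality for the weight rⁿe^{-r²}. -/

section WeightedPoincare

/-- The weight `r^n e^{-r²}`. -/
noncomputable def gaussWeight (n : ℕ) (r : ℝ) : ℝ := r ^ n * Real.exp (-r ^ 2)

/-- The derivative of `gaussWeight n`. -/
noncomputable def gaussWeight' (n : ℕ) (r : ℝ) : ℝ :=
  (n * r ^ (n - 1) - 2 * r ^ (n + 1)) * Real.exp (-r ^ 2)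

theorem continuous_gaussWeight (n : ℕ) : Continuous (gaussWeight n) := by
  unfold gaussWeight; fun_prop

theorem continuous_gaussWeight' (n : ℕ) : Continuous (gaussWeight' n) := by
  unfold gaussWeight'; fun_prop

theorem hasDerivAt_gaussWeight (n : ℕ) (r : ℝ) :
    HasDerivAt (gaussWeight n) (gaussWeight' n r) r := by
  have h1 : HasDerivAt (fun r : ℝ => -r ^ 2) (-(2 * r)) r := by
    simpa using (hasDerivAt_pow 2 r).fun_neg
  have h := (hasDerivAt_pow n r).mul h1.exp
  refine h.congr_deriv ?_
  rw [gaussWeight']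
  ring

theorem integrable_gaussWeight (n : ℕ) : Integrable (gaussWeight n) := by
  have h := integrable_rpow_mul_exp_neg_mul_sq (b := 1) one_pos (s := n)
    (by have : (0 : ℝ) ≤ n := by positivity
        linarith)
  refine h.congr (Filter.Eventually.of_forall fun r => ?_)
  simp [gaussWeight, Real.rpow_natCast]

theorem integrable_gaussWeight' (n : ℕ) : Integrable (gaussWeight' n) := by
  have h := ((integrable_gaussWeight (n - 1)).const_mul (n : ℝ)).sub
    ((integrable_gaussWeight (n + 1)).const_mul 2)
  refine h.congr (Filter.Eventually.of_forall fun r => ?_)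
  simp only [Pi.sub_apply, gaussWeight, gaussWeight']
  ring

theorem gaussWeight_pos (n : ℕ) {r : ℝ} (hr : 0 < r) : 0 < gaussWeight n r := by
  unfold gaussWeight; positivity

theorem integral_gaussWeight'_Ioi (n : ℕ) (t : ℝ) :
    ∫ r in Set.Ioi t, gaussWeight' n r = -gaussWeight n t := by
  have hlim := tendsto_zero_of_hasDerivAt_of_integrableOn_Ioi (a := t)
    (fun r _ => hasDerivAt_gaussWeight n r) (integrable_gaussWeight' n).integrableOn
    (integrable_gaussWeight n).integrableOn
  rw [integral_Ioi_of_hasDerivAt_of_tendsto' (fun r _ => hasDerivAt_gaussWeight n r)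
    (integrable_gaussWeight' n).integrableOn hlim, zero_sub]

/-- The logarithmic derivative n/r - 2r drops by at least 2(x - y) from y to x: the potential -log w
is uniformly convex with constant 2, the source of the spectral gap. -/
theorem gaussWeight_convex (n : ℕ) {x y : ℝ} (hy : 0 < y) (hxy : y < x) :
    2 * (x - y) * (gaussWeight n x * gaussWeight n y) ≤
      gaussWeight n x * gaussWeight' n y - gaussWeight' n x * gaussWeight n y := by
  have hx : 0 < x := hy.trans hxy
  have key : ∀ r : ℝ, 0 < r → gaussWeight' n r = (n / r - 2 * r) * gaussWeight n r := by
    intro r hr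
    rcases Nat.eq_zero_or_pos n with rfl | hn
    · simp [gaussWeight, gaussWeight']
    · obtain ⟨m, rfl⟩ : ∃ m, n = m + 1 := ⟨n - 1, by omega⟩
      simp only [gaussWeight, gaussWeight', Nat.add_sub_cancel]
      field_simp
      ring
  have h1 : (n : ℝ) / x ≤ n / y := by gcongr
  have h2 : 0 ≤ gaussWeight n x * gaussWeight n y :=
    (mul_pos (gaussWeight_pos n hx) (gaussWeight_pos n hy)).le
  rw [key x hx, key y hy]
  nlinarith [mul_nonneg (sub_nonneg.2 h1) h2]

theorem sq_sub_le_integral_deriv_sq {f : ℝ → ℝ} (hf : ContDiff ℝ ∞ f) {x y : ℝ} (hxy : y < x) :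
    (f x - f y) ^ 2 ≤ (x - y) * ∫ t in Set.Ioo y x, deriv f t ^ 2 := by
  have hf' : Continuous (deriv f) := (contDiff_infty_iff_deriv.1 hf).2.continuous
  have h0 : 0 < x - y := sub_pos.2 hxy
  set m := (f x - f y) / (x - y) with hm
  have h1 : ∫ t in y..x, deriv f t = f x - f y :=
    intervalIntegral.integral_deriv_eq_sub (fun t _ => differentiable_of_smooth hf t)
      (hf'.intervalIntegrable _ _)
  have h2 : 0 ≤ ∫ t in y..x, (deriv f t - m) ^ 2 :=
    intervalIntegral.integral_nonneg hxy.le fun t _ => sq_nonneg _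
  have e : (fun t => (deriv f t - m) ^ 2) = fun t => deriv f t ^ 2 + ((-2 * m) * deriv f t + m ^ 2) := by
    funext t; ring
  have i1 : IntervalIntegrable (fun t => deriv f t ^ 2) volume y x :=
    (hf'.pow 2).intervalIntegrable _ _
  have i2 : IntervalIntegrable (fun t => (-2 * m) * deriv f t) volume y x :=
    (continuous_const.mul hf').intervalIntegrable _ _
  rw [e, intervalIntegral.integral_add i1 (i2.add intervalIntegrable_const),
    intervalIntegral.integral_add i2 intervalIntegrable_const,
    intervalIntegral.integral_const_mul, h1, intervalIntegral.integral_const, smul_eq_mul] at h2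
  rw [← integral_Ioc_eq_integral_Ioo, ← intervalIntegral.integral_of_le hxy.le]
  have h3 : f x - f y = m * (x - y) := by rw [hm]; field_simp
  rw [h3] at h2 ⊢
  nlinarith

/-- The weighted Poincaré inequality on the half line for the weight `r^n e^{-r²}`. -/
theorem weighted_poincare (n : ℕ) (hn : 1 ≤ n) {f : ℝ → ℝ} (hf : ContDiff ℝ ∞ f)
    (hfc : HasCompactSupport f) :
    2 * ((∫ r in Set.Ioi (0 : ℝ), gaussWeight n r) *
          (∫ r in Set.Ioi (0 : ℝ), f r ^ 2 * gaussWeight n r)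
        - (∫ r in Set.Ioi (0 : ℝ), f r * gaussWeight n r) ^ 2) ≤
      (∫ r in Set.Ioi (0 : ℝ), gaussWeight n r) *
        ∫ r in Set.Ioi (0 : ℝ), deriv f r ^ 2 * gaussWeight n r := by
  set w := gaussWeight n with hw
  set w' := gaussWeight' n with hw'
  set μ : Measure ℝ := volume.restrict (Set.Ioi 0) with hμ
  have hwc : Continuous w := continuous_gaussWeight n
  have hwc' : Continuous w' := continuous_gaussWeight' n
  have hwi : Integrable w μ := (integrable_gaussWeight n).integrableOn
  have hwi' : Integrable w' μ := (integrable_gaussWeight' n).integrableOn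
  have hf' : Continuous (deriv f) := (contDiff_infty_iff_deriv.1 hf).2.continuous
  have hfcont := hf.continuous
  set G : ℝ → ℝ := fun t => deriv f t ^ 2 with hG
  have hGc : Continuous G := hf'.pow 2
  have hGi : Integrable G μ := by
    refine (hGc.integrable_of_hasCompactSupport ?_).integrableOn
    have e : G = deriv f * deriv f := funext fun t => sq _
    rw [e]
    exact hfc.deriv.mul_left
  have hf2 : Integrable (fun r => f r ^ 2 * w r) μ :=
    (((hfcont.pow 2).mul hwc).integrable_of_hasCompactSupport
      (by simpa only [sq, mul_assoc] using hfc.mul_right)).integrableOn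
  have hf1 : Integrable (fun r => f r * w r) μ :=
    ((hfcont.mul hwc).integrable_of_hasCompactSupport hfc.mul_right).integrableOn
  have hμ0 : ∀ᵐ r ∂μ, 0 < r := ae_restrict_mem measurableSet_Ioi
  -- The left side of the claim is ∬(f(x) - f(y))² w(x)w(y). For y < x, Cauchy-Schwarz bounds the
  -- square by (x - y)∫f'² over (y, x), and k(x, y) dominates 2(x - y)w(x)w(y). So half of k times
  -- that integral majorises the integrand, and Fubini leaves the integral of k over y < t < x, for
  -- each t.
  set k : ℝ × ℝ → ℝ := fun p => w p.1 * w' p.2 - w' p.1 * w p.2 with hk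
  have hki : Integrable k (μ.prod μ) := (hwi.mul_prod hwi').sub (hwi'.mul_prod hwi)
  set H : ℝ × ℝ → ℝ → ℝ := fun p t => (Set.Ioo p.2 p.1).indicator (fun t => k p * G t) t with hH
  have hHi : Integrable (Function.uncurry H) ((μ.prod μ).prod μ) := by
    have h1 : Integrable (fun q : (ℝ × ℝ) × ℝ => k q.1 * G q.2) ((μ.prod μ).prod μ) :=
      hki.mul_prod hGi
    have hS : MeasurableSet {q : (ℝ × ℝ) × ℝ | q.1.2 < q.2 ∧ q.2 < q.1.1} :=
      (measurableSet_lt (f := fun q : (ℝ × ℝ) × ℝ => q.1.2) (g := fun q => q.2) (by fun_prop)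
        (by fun_prop)).inter
        (measurableSet_lt (f := fun q : (ℝ × ℝ) × ℝ => q.2) (g := fun q => q.1.1) (by fun_prop)
        (by fun_prop))
    refine (h1.indicator hS).congr (Filter.Eventually.of_forall fun q => ?_)
    simp [Function.uncurry, hH, Set.indicator]
  have hswap : ∫ p, ∫ t, H p t ∂μ ∂(μ.prod μ) = ∫ t, ∫ p, H p t ∂(μ.prod μ) ∂μ :=
    integral_integral_swap hHi
  set I : ℝ × ℝ → ℝ := fun p => ∫ t, H p t ∂μ with hI
  have hIi : Integrable I (μ.prod μ) := hHi.integral_prod_left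
  have hIval : ∀ x y, 0 < y → I (x, y) = k (x, y) * ∫ t in Set.Ioo y x, G t := by
    intro x y hy
    simp only [hI, hH]
    rw [integral_indicator measurableSet_Ioo, integral_const_mul, hμ,
      Measure.restrict_restrict measurableSet_Ioo]
    congr 3
    exact Set.inter_eq_left.2 fun t ht => hy.trans ht.1
  -- Over y < t < x the kernel k is the derivative of a product structure: both halves produce w(t),
  -- times the mass of w above t and below t respectively, which add up to the full mass.
  have hinner : ∀ᵐ t ∂μ, ∫ p, H p t ∂(μ.prod μ) = (∫ r, w r ∂μ) * (G t * w t) := by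
    filter_upwards [hμ0] with t ht
    set a : ℝ → ℝ := (Set.Ioi t).indicator w
    set b : ℝ → ℝ := (Set.Iio t).indicator w'
    set a' : ℝ → ℝ := (Set.Ioi t).indicator w'
    set b' : ℝ → ℝ := (Set.Iio t).indicator w
    have e : (fun p => H p t) = fun p : ℝ × ℝ => (a p.1 * b p.2 - a' p.1 * b' p.2) * G t := by
      funext p
      by_cases h1 : t < p.1 <;> by_cases h2 : p.2 < t <;>
        simp [hH, hk, a, b, a', b', Set.indicator, h1, h2]
    have ia := hwi.indicator (measurableSet_Ioi (a := t))
    have ib := hwi'.indicator (measurableSet_Iio (a := t))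
    have ia' := hwi'.indicator (measurableSet_Ioi (a := t))
    have ib' := hwi.indicator (measurableSet_Iio (a := t))
    rw [e, integral_mul_const, integral_sub (ia.mul_prod ib) (ia'.mul_prod ib'),
      integral_prod_mul, integral_prod_mul]
    have hIoi : ∀ {u : ℝ → ℝ}, ∫ r, (Set.Ioi t).indicator u r ∂μ = ∫ r in Set.Ioi t, u r := by
      intro u
      rw [integral_indicator measurableSet_Ioi, hμ, Measure.restrict_restrict measurableSet_Ioi]
      congr 2
      exact Set.inter_eq_left.2 fun s hs => ht.trans hs
    have hsum : ∀ {u : ℝ → ℝ}, Integrable u μ →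
        ∫ r, (Set.Iio t).indicator u r ∂μ = (∫ r, u r ∂μ) - ∫ r in Set.Ioi t, u r := by
      intro u hu
      have h1 := integral_add_compl (measurableSet_Ioi (a := t)) hu
      rw [Set.compl_Ioi] at h1
      rw [← hIoi, integral_indicator measurableSet_Iio, integral_indicator measurableSet_Ioi, ← h1,
        setIntegral_congr_set (μ := μ) (Iio_ae_eq_Iic' (μ := μ) (a := t) (by
          rw [hμ]; exact measure_singleton t))]
      ring
    -- The weight vanishes at 0 because n ≥ 1, so there is no boundary term there.
    have hw0 : ∫ r, w' r ∂μ = 0 := by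
      rw [hμ, hw', integral_gaussWeight'_Ioi, gaussWeight, zero_pow (by omega)]
      simp
    rw [hIoi, hIoi, hsum hwi', hsum hwi, hw0, hw', integral_gaussWeight'_Ioi]
    ring
  have hD : ∀ᵐ p ∂(μ.prod μ), (f p.1 - f p.2) ^ 2 * (w p.1 * w p.2) ≤
      1 / 2 * (I p + I p.swap) := by
    have h1 : ∀ᵐ p ∂(μ.prod μ), 0 < p.1 ∧ 0 < p.2 := by
      have e : μ.prod μ = (volume.prod volume).restrict (Set.Ioi (0 : ℝ) ×ˢ Set.Ioi (0 : ℝ)) :=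
        Measure.prod_restrict _ _
      rw [e]
      exact ae_restrict_mem (measurableSet_Ioi.prod measurableSet_Ioi)
    have hmain : ∀ x y, 0 < y → y < x →
        (f x - f y) ^ 2 * (w x * w y) ≤ 1 / 2 * (I (x, y) + I (y, x)) := by
      intro x y hy hxy
      rw [hIval x y hy, hIval y x (hy.trans hxy), Set.Ioo_eq_empty (not_lt.2 hxy.le)]
      simp only [Measure.restrict_empty, integral_zero_measure, mul_zero, add_zero]
      have h2 := sq_sub_le_integral_deriv_sq hf hxy
      have h3 := gaussWeight_convex n hy hxy
      have h4 : 0 ≤ w x * w y :=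
        (mul_pos (gaussWeight_pos n (hy.trans hxy)) (gaussWeight_pos n hy)).le
      have h5 : 0 ≤ ∫ t in Set.Ioo y x, G t := integral_nonneg fun t => sq_nonneg _
      calc (f x - f y) ^ 2 * (w x * w y)
          ≤ ((x - y) * ∫ t in Set.Ioo y x, G t) * (w x * w y) :=
            mul_le_mul_of_nonneg_right h2 h4
        _ = 1 / 2 * ((2 * (x - y) * (w x * w y)) * ∫ t in Set.Ioo y x, G t) := by ring
        _ ≤ 1 / 2 * (k (x, y) * ∫ t in Set.Ioo y x, G t) := by
            gcongr
    filter_upwards [h1] with p hp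
    obtain ⟨x, y⟩ := p
    rcases lt_trichotomy y x with h | h | h
    · exact hmain x y hp.2 h
    · subst h
      simp [hIval y y hp.2]
    · have := hmain y x hp.1 h
      simp only [Prod.swap_prod_mk]
      nlinarith
  have hDi : Integrable (fun p : ℝ × ℝ => (f p.1 - f p.2) ^ 2 * (w p.1 * w p.2)) (μ.prod μ) := by
    have := ((hf2.mul_prod hwi).sub ((hf1.mul_prod hf1).const_mul 2)).add (hwi.mul_prod hf2)
    refine this.congr (Filter.Eventually.of_forall fun p => ?_)
    simp only [Pi.add_apply, Pi.sub_apply]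
    ring
  have hDval : ∫ p, (f p.1 - f p.2) ^ 2 * (w p.1 * w p.2) ∂(μ.prod μ) =
      2 * ((∫ r, w r ∂μ) * (∫ r, f r ^ 2 * w r ∂μ) - (∫ r, f r * w r ∂μ) ^ 2) := by
    have e : (fun p : ℝ × ℝ => (f p.1 - f p.2) ^ 2 * (w p.1 * w p.2)) = fun p =>
        ((f p.1 ^ 2 * w p.1) * w p.2 - 2 * ((f p.1 * w p.1) * (f p.2 * w p.2)))
          + w p.1 * (f p.2 ^ 2 * w p.2) := by
      funext p; ring
    have hsub : Integrable (fun p : ℝ × ℝ =>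
        (f p.1 ^ 2 * w p.1) * w p.2 - 2 * ((f p.1 * w p.1) * (f p.2 * w p.2))) (μ.prod μ) :=
      (hf2.mul_prod hwi).sub ((hf1.mul_prod hf1).const_mul 2)
    rw [e, integral_add hsub (hwi.mul_prod hf2), integral_sub (hf2.mul_prod hwi) ((hf1.mul_prod hf1).const_mul 2),
      integral_const_mul, integral_prod_mul (fun x => f x ^ 2 * w x),
      integral_prod_mul (fun x => f x * w x) (fun x => f x * w x),
      integral_prod_mul w (fun x => f x ^ 2 * w x)]
    ring
  rw [← hDval]
  calc ∫ p, (f p.1 - f p.2) ^ 2 * (w p.1 * w p.2) ∂(μ.prod μ)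
      ≤ ∫ p, 1 / 2 * (I p + I p.swap) ∂(μ.prod μ) :=
        integral_mono_ae hDi ((hIi.add hIi.swap).const_mul _) hD
    _ = ∫ p, I p ∂(μ.prod μ) := by
        have hIs : Integrable (fun p : ℝ × ℝ => I p.swap) (μ.prod μ) := hIi.swap
        rw [integral_const_mul, integral_add hIi hIs, integral_prod_swap]
        ring
    _ = (∫ r, w r ∂μ) * ∫ r, G r * w r ∂μ := by
        rw [hswap, integral_congr_ae hinner, integral_const_mul]

end WeightedPoincare

/-! ### The spectral gap for radial gradient fields. -/

section RadialGap

variable {d : ℕ} {v : ℝ → ℝ}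

theorem integrableOn_Ioi_of_vanish {w : ℝ → ℝ} (hw : Continuous w) {R : ℝ}
    (hR : ∀ r, R < r → w r = 0) : IntegrableOn w (Set.Ioi 0) := by
  have h : IntegrableOn w (Set.Ioc 0 (max R 0)) :=
    (hw.continuousOn.integrableOn_Icc).mono_set Set.Ioc_subset_Icc_self
  refine (h.of_forall_sdiff_eq_zero measurableSet_Ioi fun x hx => hR x ?_)
  have h1 : (0 : ℝ) < x := hx.1
  have h2 : ¬(x ≤ max R 0) := fun h => hx.2 ⟨h1, h⟩
  exact lt_of_le_of_lt (le_max_left _ _) (not_le.1 h2)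

theorem EvenSmooth.rdiv_eq (hv : EvenSmooth v) {g : ℝ → ℝ} (hg : Continuous g)
    (h : ∀ r, deriv v r = r * g r) : _root_.rdiv v = g := by
  refine Continuous.ext_on (dense_compl_singleton (0 : ℝ)) hv.rdiv.continuous hg fun r hr => ?_
  have := hv.deriv_eq r
  rw [h] at this
  exact (mul_left_cancel₀ hr this).symm

/-- The energy of a radial gradient field as a sum of squares. -/
theorem quadForm_radial (hd : 0 < d) (hv : EvenSmooth v) {R : ℝ} (hR : ∀ r, R ≤ r → v r = 0) :
    quadForm ((d : ℝ) + 2) (fun x : Euc d => v ‖x‖) = sphInt (fun _ : Euc d => 1) *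
      ∫ r in Set.Ioi (0 : ℝ), r ^ (d + 1) * (deriv (rdiv v) r + r * rdiv v r) ^ 2 := by
  set g := rdiv v with hg
  have hgs : EvenSmooth g := hv.rdiv
  have hgc := hgs.continuous
  have hg' : Continuous (deriv g) := (contDiff_infty_iff_deriv.1 hgs.smooth).2.continuous
  have hg0 : ∀ r, max R 0 < r → g r = 0 := fun r hr =>
    hv.rdiv_eq_zero (fun s hs => hR s hs.le) hr
  have hg0' : ∀ r, max R 0 < r → deriv g r = 0 := fun r hr => by
    have h1 : g =ᶠ[nhds r] fun _ => 0 := Filter.eventually_of_mem (Ioi_mem_nhds hr) hg0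
    rw [h1.deriv_eq, deriv_const]
  have ht : IsTest fun x : Euc d => v ‖x‖ := hv.isTest_comp_norm hR
  have hlap : ∀ x : Euc d, lap (fun x => v ‖x‖) x = d * g ‖x‖ + ‖x‖ * deriv g ‖x‖ := by
    intro x
    rw [hv.lap_radial, lapProfile, ← hg, hgs.deriv_eq]
    ring
  have hint : ∀ {w : ℝ → ℝ}, Continuous w → (∀ r, max R 0 + 1 ≤ r → w r = 0) →
      Integrable (fun x : Euc d => w ‖x‖) := fun hw h => integrable_radial_of_vanish hw h
  have e : quadForm ((d : ℝ) + 2) (fun x : Euc d => v ‖x‖) = ∫ x : Euc d,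
      (fun r => (d * g r + r * deriv g r) ^ 2 + r ^ 2 * (r ^ 2 * g r ^ 2)
        - ((d : ℝ) + 2) * (r ^ 2 * g r ^ 2)) ‖x‖ := by
    rw [quadForm]
    simp only [hlap, hv.gradDot_radial, ← hg]
    rw [← integral_const_mul, ← integral_add, ← integral_sub]
    · exact (hint (w := fun r => (d * g r + r * deriv g r) ^ 2) (by fun_prop) fun r hr => by
        simp [hg0 r (by linarith), hg0' r (by linarith)]).add
        (hint (w := fun r => r ^ 2 * (r ^ 2 * g r ^ 2)) (by fun_prop) fun r hr => by
          simp [hg0 r (by linarith)])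
    · exact hint (w := fun r => ((d : ℝ) + 2) * (r ^ 2 * g r ^ 2)) (by fun_prop) fun r hr => by
          simp [hg0 r (by linarith)]
    · exact hint (w := fun r => (d * g r + r * deriv g r) ^ 2) (by fun_prop) fun r hr => by
        simp [hg0 r (by linarith), hg0' r (by linarith)]
    · exact hint (w := fun r => r ^ 2 * (r ^ 2 * g r ^ 2)) (by fun_prop) fun r hr => by
          simp [hg0 r (by linarith)]
  refine e.trans ((integral_radial hd (w := fun r => (d * g r + r * deriv g r) ^ 2 +
    r ^ 2 * (r ^ 2 * g r ^ 2) - ((d : ℝ) + 2) * (r ^ 2 * g r ^ 2))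
    (hint (w := fun r => (d * g r + r * deriv g r) ^ 2 +
    r ^ 2 * (r ^ 2 * g r ^ 2) - ((d : ℝ) + 2) * (r ^ 2 * g r ^ 2)) (by fun_prop) fun r hr => by
      simp [hg0 r (by linarith), hg0' r (by linarith)])).trans ?_)
  congr 1
  -- The polar integrand differs from the perfect square r^{d+1}(g' + rg)² exactly by p', and p
  -- vanishes at 0 and at infinity.
  set p : ℝ → ℝ := fun r => d * r ^ d * g r ^ 2 - r ^ (d + 2) * g r ^ 2 with hp
  set p' : ℝ → ℝ := fun r => d * (d * r ^ (d - 1)) * g r ^ 2 + d * r ^ d * (2 * g r * deriv g r)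
    - (((d : ℝ) + 2) * r ^ (d + 1) * g r ^ 2 + r ^ (d + 2) * (2 * g r * deriv g r)) with hp'
  have hder : ∀ r ∈ Set.Ici (0 : ℝ), HasDerivAt p (p' r) r := by
    intro r _
    have h1 : HasDerivAt (fun r => g r ^ 2) (2 * g r * deriv g r) r := by
      simpa using (differentiable_of_smooth hgs.smooth r).hasDerivAt.fun_pow 2
    have h2 := (((hasDerivAt_pow d r).const_mul (d : ℝ)).fun_mul h1).fun_sub
      ((hasDerivAt_pow (d + 2) r).fun_mul h1)
    refine h2.congr_deriv ?_
    simp only [hp']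
    push_cast
    rfl
  have hp'c : Continuous p' := by fun_prop
  have hp'i : IntegrableOn p' (Set.Ioi 0) := integrableOn_Ioi_of_vanish hp'c (R := max R 0)
    fun r hr => by simp [hp', hg0 r hr]
  have hlim : Filter.Tendsto p Filter.atTop (nhds 0) := by
    refine tendsto_const_nhds.congr' ?_
    filter_upwards [Filter.eventually_gt_atTop (max R 0)] with r hr
    simp [hp, hg0 r hr]
  have hz := integral_Ioi_of_hasDerivAt_of_tendsto' hder hp'i hlim
  have hp0 : p 0 = 0 := by
    simp [hp, hd.ne']
  rw [hp0, sub_zero] at hz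
  have hq : IntegrableOn (fun r => r ^ (d + 1) * (deriv g r + r * g r) ^ 2) (Set.Ioi 0) :=
    integrableOn_Ioi_of_vanish (by fun_prop) (R := max R 0)
      fun r hr => by simp [hg0 r hr, hg0' r hr]
  refine Eq.trans ?_ ((integral_add hq hp'i).trans (by rw [hz, add_zero]))
  refine setIntegral_congr_fun measurableSet_Ioi fun r _ => ?_
  obtain ⟨m, rfl⟩ : ∃ m, d = m + 1 := ⟨d - 1, by omega⟩
  simp only [hp', Nat.add_sub_cancel]
  ring

/-- The squared `L²` norm of the field `x e^{-|x|²/2}`. -/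
noncomputable def gaussFieldNormSq (d : ℕ) : ℝ :=
  ∫ x : Euc d, ‖x‖ ^ 2 * Real.exp (-‖x‖ ^ 2 / 2) ^ 2

/-- The `L²` pairing of `∇φ` with the field `x e^{-|x|²/2}`. -/
noncomputable def gaussPair (φ : Euc d → ℝ) : ℝ :=
  ∫ x : Euc d, eul φ x * Real.exp (-‖x‖ ^ 2 / 2)

theorem exp_half_sq (r : ℝ) : Real.exp (-r ^ 2 / 2) ^ 2 = Real.exp (-r ^ 2) := by
  rw [← Real.exp_nat_mul]
  congr 1
  push_cast
  ring

theorem integrable_gaussField (d : ℕ) (hd : 0 < d) :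
    Integrable fun x : Euc d => ‖x‖ ^ 2 * Real.exp (-‖x‖ ^ 2 / 2) ^ 2 := by
  have : Nontrivial (Euc d) :=
    Module.nontrivial_of_finrank_pos (R := ℝ) (by simpa using hd)
  have h := (integrable_fun_norm_addHaar (volume : Measure (Euc d))
    (f := fun r => r ^ 2 * Real.exp (-r ^ 2 / 2) ^ 2)).2
  refine h ?_
  refine (integrable_gaussWeight (d + 1)).integrableOn.congr_fun (fun r _ => ?_) measurableSet_Ioi
  simp only [gaussWeight, exp_half_sq, finrank_euclideanSpace, Fintype.card_fin, smul_eq_mul]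
  rw [← mul_assoc, ← pow_add]
  congr 2
  omega

theorem gaussFieldNormSq_eq (hd : 0 < d) : gaussFieldNormSq d =
    sphInt (fun _ : Euc d => 1) * ∫ r in Set.Ioi (0 : ℝ), gaussWeight (d + 1) r := by
  rw [gaussFieldNormSq, integral_radial hd (w := fun r => r ^ 2 * Real.exp (-r ^ 2 / 2) ^ 2)
    (integrable_gaussField d hd)]
  congr 1
  refine setIntegral_congr_fun measurableSet_Ioi fun r _ => ?_
  simp only [gaussWeight, exp_half_sq]
  rw [← mul_assoc, ← pow_add]
  congr 2
  omega

theorem integral_gaussWeight_pos (n : ℕ) : 0 < ∫ r in Set.Ioi (0 : ℝ), gaussWeight n r := by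
  rw [setIntegral_pos_iff_support_of_nonneg_ae]
  · have : Set.Ioi (0 : ℝ) ⊆ Function.support (gaussWeight n) ∩ Set.Ioi 0 := fun r hr =>
      ⟨(gaussWeight_pos n hr).ne', hr⟩
    refine lt_of_lt_of_le ?_ (measure_mono this)
    simp
  · filter_upwards [ae_restrict_mem measurableSet_Ioi] with r hr
    exact (gaussWeight_pos n hr).le
  · exact (integrable_gaussWeight n).integrableOn

theorem gaussFieldNormSq_pos (hd : 0 < d) : 0 < gaussFieldNormSq d := by
  rw [gaussFieldNormSq_eq hd]
  exact mul_pos (sphInt_one_pos hd) (integral_gaussWeight_pos _)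

/-- The spectral gap for radial gradient fields. -/
theorem radial_gap (hd : 0 < d) (hv : EvenSmooth v) {R : ℝ} (hR : ∀ r, R ≤ r → v r = 0) :
    2 * (gaussFieldNormSq d * (∫ x : Euc d, gradDot (fun x => v ‖x‖) (fun x => v ‖x‖) x)
        - gaussPair (fun x : Euc d => v ‖x‖) ^ 2) ≤
      gaussFieldNormSq d * quadForm ((d : ℝ) + 2) fun x : Euc d => v ‖x‖ := by
  set g := rdiv v with hg
  have hgs : EvenSmooth g := hv.rdiv
  have hgc := hgs.continuous
  have hg0 : ∀ r, max R 0 < r → g r = 0 := fun r hr =>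
    hv.rdiv_eq_zero (fun s hs => hR s hs.le) hr
  -- Dividing the field by the Gaussian turns g' + rg into f'e^{-r²/2}. The form becomes the
  -- weighted Dirichlet form of f, and the Gaussian direction becomes the constants.
  set f : ℝ → ℝ := fun r => g r * Real.exp (r ^ 2 / 2) with hf
  have hexp : ContDiff ℝ ∞ fun r : ℝ => Real.exp (r ^ 2 / 2) :=
    Real.contDiff_exp.comp ((contDiff_id.pow 2).div_const 2)
  have hfs : ContDiff ℝ ∞ f := hgs.smooth.mul hexp
  have hfc : HasCompactSupport f := by
    refine HasCompactSupport.intro (isCompact_Icc (a := -(max R 0)) (b := max R 0)) fun r hr => ?_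
    have h1 : max R 0 < |r| := by
      by_contra h
      exact hr (abs_le.1 (not_lt.1 h))
    have h2 : g r = 0 := by
      rcases abs_choice r with h | h
      · rw [h] at h1; exact hg0 r h1
      · rw [h] at h1; rw [← hgs.even]; exact hg0 _ h1
    simp [hf, h2]
  have key := weighted_poincare (d + 1) (by omega) hfs hfc
  set σ := sphInt (fun _ : Euc d => 1) with hσ
  have hσ0 : 0 < σ := sphInt_one_pos hd
  have hee : ∀ r : ℝ, Real.exp (r ^ 2 / 2) * Real.exp (-r ^ 2) = Real.exp (-r ^ 2 / 2) := by
    intro r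
    rw [← Real.exp_add]
    congr 1
    ring
  have hee2 : ∀ r : ℝ, Real.exp (r ^ 2 / 2) * Real.exp (-r ^ 2 / 2) = 1 := by
    intro r
    rw [← Real.exp_add, ← Real.exp_zero]
    congr 1
    ring
  have h1 : ∫ x : Euc d, gradDot (fun x => v ‖x‖) (fun x => v ‖x‖) x =
      σ * ∫ r in Set.Ioi (0 : ℝ), f r ^ 2 * gaussWeight (d + 1) r := by
    simp only [hv.gradDot_radial, ← hg]
    rw [integral_radial hd (w := fun r => r ^ 2 * g r ^ 2)
      (integrable_radial_of_vanish (w := fun r => r ^ 2 * g r ^ 2) (by fun_prop) (R := max R 0 + 1)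
        fun r hr => by simp [hg0 r (by linarith)])]
    congr 1
    refine setIntegral_congr_fun measurableSet_Ioi fun r _ => ?_
    have e : d + 1 = d - 1 + 2 := by omega
    simp only [hf, gaussWeight, mul_pow]
    rw [e, pow_add, ← exp_half_sq r]
    linear_combination (-(r ^ (d - 1) * r ^ 2 * g r ^ 2) *
      (Real.exp (r ^ 2 / 2) * Real.exp (-r ^ 2 / 2) + 1)) * hee2 r
  have h2 : gaussPair (fun x : Euc d => v ‖x‖) =
      σ * ∫ r in Set.Ioi (0 : ℝ), f r * gaussWeight (d + 1) r := by
    simp only [gaussPair, hv.eul_radial, ← hg]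
    rw [integral_radial hd (w := fun r => r ^ 2 * g r * Real.exp (-r ^ 2 / 2))
      (integrable_radial_of_vanish (w := fun r => r ^ 2 * g r * Real.exp (-r ^ 2 / 2)) (by fun_prop) (R := max R 0 + 1)
        fun r hr => by simp [hg0 r (by linarith)])]
    congr 1
    refine setIntegral_congr_fun measurableSet_Ioi fun r _ => ?_
    have e : d + 1 = d - 1 + 2 := by omega
    simp only [hf, gaussWeight]
    rw [e, pow_add, ← hee r]
    ring
  have h3 : quadForm ((d : ℝ) + 2) (fun x : Euc d => v ‖x‖) =
      σ * ∫ r in Set.Ioi (0 : ℝ), deriv f r ^ 2 * gaussWeight (d + 1) r := by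
    rw [quadForm_radial hd hv hR]
    congr 1
    refine setIntegral_congr_fun measurableSet_Ioi fun r _ => ?_
    have hder : deriv f r = (deriv g r + r * g r) * Real.exp (r ^ 2 / 2) := by
      have h4 : HasDerivAt (fun r : ℝ => Real.exp (r ^ 2 / 2)) (Real.exp (r ^ 2 / 2) * r) r := by
        have h5 : HasDerivAt (fun r : ℝ => r ^ 2 / 2) r r := by
          have := (hasDerivAt_pow 2 r).div_const 2
          simpa using this
        exact h5.exp
      have h6 := (differentiable_of_smooth hgs.smooth r).hasDerivAt.fun_mul h4
      rw [h6.deriv]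
      ring
    simp only [hder, gaussWeight, mul_pow, ← hg]
    rw [← exp_half_sq r]
    linear_combination (-(r ^ (d + 1) * (deriv g r + r * g r) ^ 2) *
      (Real.exp (r ^ 2 / 2) * Real.exp (-r ^ 2 / 2) + 1)) * hee2 r
  rw [h1, h2, h3, gaussFieldNormSq_eq hd, ← hσ]
  nlinarith [mul_le_mul_of_nonneg_left key (sq_nonneg σ)]

/-- A radial function with prescribed radial derivative `r g(r)`. -/
theorem exists_radial_potential {g : ℝ → ℝ} (hg : EvenSmooth g) {R : ℝ}
    (hR : ∀ r, R ≤ r → g r = 0) :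
    ∃ v, EvenSmooth v ∧ (∀ r, R ≤ r → v r = 0) ∧ ∀ r, deriv v r = r * g r := by
  have hgc := hg.continuous
  have hc : Continuous fun r => r * g r := by fun_prop
  -- Integrating from R rather than from 0 makes the potential vanish beyond R.
  set v : ℝ → ℝ := fun r => ∫ s in R..r, s * g s with hv
  have hder : ∀ r, HasDerivAt v (r * g r) r := fun r =>
    intervalIntegral.integral_hasDerivAt_right (hc.intervalIntegrable _ _)
      (hc.stronglyMeasurableAtFilter _ _) hc.continuousAt
  have hder' : deriv v = fun r => r * g r := funext fun r => (hder r).deriv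
  refine ⟨v, ⟨?_, fun r => ?_⟩, fun r hr => ?_, fun r => (hder r).deriv⟩
  · rw [contDiff_infty_iff_deriv, hder']
    exact ⟨fun r => (hder r).differentiableAt, contDiff_id.mul hg.smooth⟩
  · have h1 : ∀ r, HasDerivAt (fun r => v (-r) - v r) 0 r := by
      intro r
      have h2 := (hder (-r)).scomp r (hasDerivAt_neg r)
      refine (h2.sub (hder r)).congr_deriv ?_
      simp [hg.even]
    have h3 := is_const_of_deriv_eq_zero (fun r => (h1 r).differentiableAt)
      (fun r => (h1 r).deriv) r 0
    simp only [neg_zero, sub_self] at h3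
    linarith
  · simp only [hv]
    rw [intervalIntegral.integral_of_le hr]
    refine setIntegral_eq_zero_of_forall_eq_zero fun s hs => ?_
    rw [hR s hs.1.le, mul_zero]

end RadialGap

/-! ### The bound C(N) ≤ 2 from truncated Gaussian fields. -/

section UpperBound

variable {d : ℕ}

/-- The energy of truncations of the Gaussian: it tends to zero, while the mass stays away
from zero. -/
theorem exists_radial_quadForm_le (hd : 0 < d) : ∃ v : ℝ → ℝ, EvenSmooth v ∧
    (∃ R, ∀ r, R ≤ r → v r = 0) ∧ (fun x : Euc d => v ‖x‖) ≠ 0 ∧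
    quadForm ((d : ℝ) + 2) (fun x : Euc d => v ‖x‖) ≤ 2 * ∫ x : Euc d, v ‖x‖ ^ 2 := by
  obtain ⟨χ, hχ, hχ1, hχ2, hχ0, -⟩ := exists_cutoff
  have hχc : HasCompactSupport χ := by
    refine HasCompactSupport.intro (isCompact_Icc (a := (-2 : ℝ)) (b := 2)) fun r hr => hχ2 r ?_
    by_contra h
    exact hr (abs_le.1 (not_le.1 h).le)
  have hχ' : Continuous (deriv χ) := (contDiff_infty_iff_deriv.1 hχ.smooth).2.continuous
  obtain ⟨M, hM⟩ := hχc.deriv.exists_bound_of_continuous hχ'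
  set σ := sphInt (fun _ : Euc d => 1) with hσ
  have hσ0 : 0 < σ := sphInt_one_pos hd
  set I := ∫ r in Set.Ioi (0 : ℝ), gaussWeight (d + 1) r with hI
  have hI0 : 0 < I := integral_gaussWeight_pos _
  set A := σ * (M ^ 2 * I) with hA
  have hA0 : 0 ≤ A := by positivity
  set B := 2 * (Real.exp (-2) ^ 2 * volume.real (Metric.ball (0 : Euc d) 1)) with hB
  have hB0 : 0 < B := by
    have : 0 < volume.real (Metric.ball (0 : Euc d) 1) :=
      ENNReal.toReal_pos (Metric.measure_ball_pos _ _ one_pos).ne' measure_ball_lt_top.ne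
    positivity
  -- A/ρ² will bound the energy of the truncation at scale ρ, and B bounds twice its mass from below
  -- independently of ρ; this ρ makes the first at most the second.
  set ρ := 2 + A / B with hρ
  have hρ2 : 2 ≤ ρ := by
    have : 0 ≤ A / B := by positivity
    linarith
  have hρ0 : 0 < ρ := by linarith
  have hAB : A / ρ ^ 2 ≤ B := by
    rw [div_le_iff₀ (by positivity)]
    have h1 : A = B * (A / B) := by field_simp
    have h2 : A / B ≤ ρ ^ 2 := by nlinarith
    exact h1.le.trans (mul_le_mul_of_nonneg_left h2 hB0.le)
  -- The full Gaussian solves g' + rg = 0, so only the derivative of the cutoff, of size 1/ρ,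
  -- contributes to the energy.
  set g : ℝ → ℝ := fun r => χ (r / ρ) * Real.exp (-r ^ 2 / 2) with hg
  have hgs : EvenSmooth g := by
    refine ⟨(hχ.smooth.comp (contDiff_id.div_const ρ)).mul
      (Real.contDiff_exp.comp ((contDiff_id.pow 2).neg.div_const 2)), fun r => ?_⟩
    simp only [hg, neg_div, hχ.even, neg_sq]
  have hgR : ∀ r, 2 * ρ ≤ r → g r = 0 := fun r hr => by
    have : 2 ≤ r / ρ := by rwa [le_div_iff₀ hρ0]
    simp [hg, hχ2 _ (this.trans (le_abs_self _))]
  obtain ⟨v, hv, hvR, hvd⟩ := exists_radial_potential hgs hgR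
  have hrd : rdiv v = g := hv.rdiv_eq hgs.continuous hvd
  have hmono : MonotoneOn v (Set.Ici 0) := by
    refine monotoneOn_of_deriv_nonneg (convex_Ici 0) hv.continuous.continuousOn
      (differentiable_of_smooth hv.smooth).differentiableOn fun r hr => ?_
    rw [interior_Ici] at hr
    rw [hvd]
    exact mul_nonneg (le_of_lt hr) (mul_nonneg (hχ0 _) (Real.exp_nonneg _))
  -- The potential increases to 0, and on [1, 2], where the cutoff is 1 since ρ ≥ 2, its slope
  -- re^{-r²/2} is at least e^{-2}.
  have hv1 : v 1 ≤ -Real.exp (-2) := by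
    have h1 := (convex_Icc (1 : ℝ) 2).mul_sub_le_image_sub_of_le_deriv (f := v)
      (C := Real.exp (-2)) hv.continuous.continuousOn
      (differentiable_of_smooth hv.smooth).differentiableOn (fun r hr => ?_) 1 (by simp) 2 (by simp)
      (by norm_num)
    · have h2 : v 2 ≤ v (2 * ρ) := hmono (by simp) (Set.mem_Ici.2 (by linarith)) (by linarith)
      rw [hvR _ le_rfl] at h2
      linarith
    · rw [interior_Icc] at hr
      have h3 : χ (r / ρ) = 1 := hχ1 _ (by
        rw [abs_of_nonneg (div_nonneg (by linarith [hr.1]) hρ0.le), div_le_one hρ0]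
        linarith [hr.2])
      rw [hvd]
      simp only [hg, h3, one_mul]
      have h4 : Real.exp (-2) ≤ Real.exp (-r ^ 2 / 2) :=
        Real.exp_le_exp.2 (by nlinarith [hr.1, hr.2])
      nlinarith [hr.1, Real.exp_pos (-r ^ 2 / 2)]
  have hvb : ∀ r, 0 ≤ r → r ≤ 1 → Real.exp (-2) ^ 2 ≤ v r ^ 2 := by
    intro r h0 h1
    have h2 : v r ≤ v 1 := hmono h0 (by simp) h1
    nlinarith [Real.exp_pos (-2)]
  refine ⟨v, hv, ⟨_, hvR⟩, fun h => ?_, ?_⟩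
  · have h1 := hvb 0 le_rfl zero_le_one
    have h2 := congrFun h 0
    simp only [norm_zero, Pi.zero_apply] at h2
    rw [h2] at h1
    have := Real.exp_pos (-2)
    nlinarith
  · have hmass : B ≤ 2 * ∫ x : Euc d, v ‖x‖ ^ 2 := by
      have hi : Integrable fun x : Euc d => v ‖x‖ ^ 2 :=
        integrable_radial_of_vanish (w := fun r => v r ^ 2) (hv.continuous.pow 2) (R := 2 * ρ)
          fun r hr => by simp [hvR r hr]
      have h1 := setIntegral_ge_of_const_le_real (μ := volume) (s := Metric.ball (0 : Euc d) 1)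
        (f := fun x => v ‖x‖ ^ 2) (c := Real.exp (-2) ^ 2) measurableSet_ball
        measure_ball_lt_top.ne (fun x hx => hvb _ (norm_nonneg _)
          (by simpa using (mem_ball_zero_iff.1 hx).le)) hi.integrableOn
      have h2 := setIntegral_le_integral (s := Metric.ball (0 : Euc d) 1) hi
        (Filter.Eventually.of_forall fun x => sq_nonneg _)
      linarith
    refine le_trans ?_ (hAB.trans hmass)
    rw [quadForm_radial hd hv hvR, hrd, hA, mul_div_assoc]
    refine mul_le_mul_of_nonneg_left ?_ hσ0.le
    have hder : ∀ r, deriv g r + r * g r = deriv χ (r / ρ) / ρ * Real.exp (-r ^ 2 / 2) := by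
      intro r
      have h1 : HasDerivAt (fun r => χ (r / ρ)) (deriv χ (r / ρ) * (1 / ρ)) r :=
        (differentiable_of_smooth hχ.smooth _).hasDerivAt.comp r ((hasDerivAt_id r).div_const ρ)
      have h2 : HasDerivAt (fun r : ℝ => -r ^ 2 / 2) (-r) r := by
        have := ((hasDerivAt_pow 2 r).fun_neg).div_const 2
        refine this.congr_deriv ?_
        push_cast
        ring
      rw [(h1.fun_mul h2.exp).deriv]
      simp only [hg]
      ring
    have hle : M ^ 2 * I / ρ ^ 2 = ∫ r in Set.Ioi (0 : ℝ), M ^ 2 / ρ ^ 2 * gaussWeight (d + 1) r := by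
      rw [integral_const_mul]
      ring
    have hpt : ∀ r ∈ Set.Ioi (0 : ℝ), r ^ (d + 1) * (deriv g r + r * g r) ^ 2 ≤
        M ^ 2 / ρ ^ 2 * gaussWeight (d + 1) r := by
      intro r hr
      have hr0 : (0 : ℝ) < r := hr
      rw [hder, mul_pow, exp_half_sq, gaussWeight, div_pow]
      have h1 : deriv χ (r / ρ) ^ 2 ≤ M ^ 2 := by
        have := hM (r / ρ)
        rw [Real.norm_eq_abs] at this
        exact sq_le_sq' (by linarith [neg_abs_le (deriv χ (r / ρ))])
          ((le_abs_self _).trans this)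
      have h2 : deriv χ (r / ρ) ^ 2 / ρ ^ 2 ≤ M ^ 2 / ρ ^ 2 := by gcongr
      calc r ^ (d + 1) * (deriv χ (r / ρ) ^ 2 / ρ ^ 2 * Real.exp (-r ^ 2))
          = deriv χ (r / ρ) ^ 2 / ρ ^ 2 * (r ^ (d + 1) * Real.exp (-r ^ 2)) := by ring
        _ ≤ _ := mul_le_mul_of_nonneg_right h2 (by positivity)
    rw [hle]
    refine setIntegral_mono_on (integrableOn_Ioi_of_vanish ?_ (R := 2 * ρ) fun r hr => ?_)
      ((integrable_gaussWeight _).const_mul _).integrableOn measurableSet_Ioi hpt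
    · have h1 := hgs.continuous
      have h2 := (contDiff_infty_iff_deriv.1 hgs.smooth).2.continuous
      fun_prop
    · have h3 : g =ᶠ[nhds r] fun _ => 0 :=
        Filter.eventually_of_mem (Ioi_mem_nhds hr) fun s hs => hgR s (le_of_lt hs)
      rw [h3.deriv_eq, deriv_const, hgR r hr.le]
      ring

/-- For k = 1 the numerator on ℝ^{N+2} is the form with constant (N+2) + 2, plus (N+4)∫|∇u|² - 2∫u².
A truncated Gaussian has form at most 2∫u², so its quotient is at most N+4. With this bound, the gap
2 of the other spherical degrees is enough. -/
theorem stabConst_le_two {N : ℕ} (hN : 2 ≤ N) : stabConst N ≤ 2 := by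
  obtain ⟨v, hv, ⟨R, hR⟩, h0, hq⟩ := exists_radial_quadForm_le (d := N + 2 * 1) (by omega)
  set u : Euc (N + 2 * 1) → ℝ := fun x => v ‖x‖ with hu
  have ht : IsTest u := hv.isTest_comp_norm hR
  have hr : IsRadialTest u := ⟨ht.smooth, ht.compact, fun x y h => by simp only [hu, h], h0⟩
  have h1 := stabConst_mul_le hN le_rfl hr
  have hD := gradDot_integral_pos (by omega) ht h0
  rw [radialNum_eq ht] at h1
  rw [quadForm] at hq
  push_cast at h1 hq
  have h2 : (stabConst N - 2) * ∫ x, gradDot u u x ≤ 0 := by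
    simp only [hu] at *
    linarith
  by_contra h
  push Not at h
  nlinarith

end UpperBound

/-! ### Splitting into spherical degrees 0, 1 and at least 2. -/

/-- `φ` is orthogonal to `Y` on all spheres centred at the origin. -/
def SphOrth {d : ℕ} (Y φ : Euc d → ℝ) : Prop :=
  ∀ r : ℝ, 0 < r → sphInt (fun x => φ (r • x) * Y x) = 0

section Decomposition

variable {d k : ℕ} {v : ℝ → ℝ} {Y φ ψ : Euc d → ℝ}

theorem SphOrth.add (hY : Continuous Y) (hφ : Continuous φ) (hψ : Continuous ψ)
    (h : SphOrth Y φ) (h' : SphOrth Y ψ) : SphOrth Y fun x => φ x + ψ x := by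
  intro r hr
  simp only [add_mul]
  rw [sphInt_add (by fun_prop) (by fun_prop), h r hr, h' r hr, add_zero]

theorem SphOrth.sum (hY : Continuous Y) {ι : Type*} (s : Finset ι) {f : ι → Euc d → ℝ}
    (hf : ∀ i, Continuous (f i)) (h : ∀ i ∈ s, SphOrth Y (f i)) :
    SphOrth Y fun x => ∑ i ∈ s, f i x := by
  intro r hr
  simp only [Finset.sum_mul]
  rw [sphInt_sum _ fun i => by have := hf i; fun_prop]
  exact Finset.sum_eq_zero fun i hi => h i hi r hr

theorem SphOrth.orthRadial (hd : 0 < d) (hY : IsSolidHarmonic k Y) (hφ : IsTest φ)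
    (h : SphOrth Y φ) : OrthRadial Y φ := by
  intro w hw
  have hYc := hY.smooth.continuous
  rw [integral_polar hd (hφ.integrable_mul (by fun_prop))]
  refine setIntegral_eq_zero_of_forall_eq_zero fun r hr => ?_
  have e : sphInt (fun x => φ (r • x) * (Y (r • x) * w ‖r • x‖)) =
      r ^ k * w r * sphInt fun x => φ (r • x) * Y x := by
    rw [← sphInt_const_mul]
    refine sphInt_congr fun x hx => ?_
    rw [norm_smul, hx, mul_one, Real.norm_of_nonneg (le_of_lt hr), hY.homogeneous]
    ring
  rw [e, h r hr, mul_zero, mul_zero]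

theorem sphInt_coord_mul_radial (Y : Euc d → ℝ) (j : Fin d) {r : ℝ} (hr : 0 < r) :
    sphInt (fun x => ((r • x) j * v ‖r • x‖) * Y x) = r * v r * sphInt fun x => x j * Y x := by
  rw [← sphInt_const_mul]
  refine sphInt_congr fun x hx => ?_
  rw [norm_smul, hx, mul_one, Real.norm_of_nonneg hr.le, PiLp.smul_apply, smul_eq_mul]
  ring

theorem sphOrth_coord_mul_radial {j : Fin d} (h : sphInt (fun x => x j * Y x) = 0) :
    SphOrth Y fun x => x j * v ‖x‖ := fun r hr => by
  rw [sphInt_coord_mul_radial Y j hr, h, mul_zero]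

theorem sphInt_neg_smul (hd : 0 < d) {f : Euc d → ℝ} (hf : Continuous f) (r : ℝ) :
    sphInt (fun x => f ((-r) • x)) = sphInt fun x => f (r • x) := by
  simp only [neg_smul]
  rcases lt_trichotomy r 0 with hr | rfl | hr
  · have := sphInt_neg hd hf (neg_pos.2 hr)
    simpa only [neg_smul, neg_neg] using this.symm
  · simp
  · exact sphInt_neg hd hf hr

theorem contDiff_sphInt_smul {f g : Euc d → ℝ} (hf : ContDiff ℝ ∞ f) (hg : Continuous g) :
    ContDiff ℝ ∞ fun r : ℝ => sphInt fun x => f (r • x) * g x := by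
  have h := contDiff_integral_ray (volume : Measure (Euc d)).toSphere
    (γ := fun w : Metric.sphere (0 : Euc d) 1 => (w : Euc d)) continuous_subtype_val hf
    (ρ := fun w => g w • ContinuousLinearMap.id ℝ ℝ)
    ((hg.comp continuous_subtype_val).smul continuous_const)
  convert h using 2 with r
  simp [sphInt, mul_comm]

/-- The radial part of a smooth function. -/
theorem exists_radial_part (hd : 0 < d) (hφ : ContDiff ℝ ∞ φ) :
    ∃ v, EvenSmooth v ∧ ∀ r, sphInt (fun x => φ (r • x)) = sphInt (fun _ : Euc d => 1) * v r := by
  have hσ := (sphInt_one_pos hd).ne'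
  refine ⟨fun r => (sphInt fun x => φ (r • x)) / sphInt (fun _ : Euc d => 1), ⟨?_, fun r => ?_⟩,
    fun r => by field_simp⟩
  · simpa using (contDiff_sphInt_smul hφ (g := fun _ => 1) continuous_const).div_const _
  · rw [sphInt_neg_smul hd hφ.continuous]

/-- The first spherical harmonics of a smooth function. -/
theorem exists_coord_part (hd : 0 < d) (hφ : ContDiff ℝ ∞ φ) (i : Fin d) :
    ∃ v, EvenSmooth v ∧ ∀ r, sphInt (fun x => φ (r • x) * x i) =
      r * v r * (sphInt (fun _ : Euc d => 1) / d) := by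
  have hσ := (sphInt_one_pos hd).ne'
  have hd' : (d : ℝ) ≠ 0 := by positivity
  -- The antipodal map makes the first-degree coefficient odd in r, so dividing it by r gives an
  -- even smooth profile, as a multiplier of xᵢ must be. At r = 0 oddness is checked separately,
  -- since it is otherwise obtained by cancelling r.
  obtain ⟨v, hv, h⟩ := EvenSmooth.of_odd_div
    ((contDiff_sphInt_smul hφ (continuous_coord i)).div_const (sphInt (fun _ : Euc d => 1) / d))
    fun r => by
      have h1 := sphInt_neg_smul hd (f := fun x => φ x * x i)
        (hφ.continuous.mul (continuous_coord i)) r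
      have e : ∀ r : ℝ, sphInt (fun x => φ (r • x) * (r • x) i) =
          r * sphInt fun x => φ (r • x) * x i := by
        intro r
        rw [← sphInt_const_mul]
        congr 1
        funext x
        simp only [PiLp.smul_apply, smul_eq_mul]
        ring
      rw [e, e] at h1
      rcases eq_or_ne r 0 with rfl | hr
      · have h2 : sphInt (fun x : Euc d => x i) = -sphInt fun x : Euc d => x i := by
          have h2 := sphInt_neg hd (continuous_coord i) one_pos
          simp only [one_smul, PiLp.neg_apply] at h2
          rw [← h2]
          have := sphInt_const_mul (-1) fun x : Euc d => x i
          simp only [neg_one_mul] at this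
          rw [this]
          linarith
        have h3 : sphInt (fun x : Euc d => x i) = 0 := by linarith
        simp [sphInt_const_mul, h3]
      · have h2 : sphInt (fun x => φ ((-r) • x) * x i) = -sphInt fun x => φ (r • x) * x i := by
          refine mul_left_cancel₀ hr ?_
          linarith
        rw [h2, neg_div]
  refine ⟨v, hv, fun r => ?_⟩
  rw [← h r]
  field_simp

theorem pd_comp_smul (hφ : ContDiff ℝ ∞ φ) (r : ℝ) (i : Fin d) (x : Euc d) :
    pd i (fun x => φ (r • x)) x = r * pd i φ (r • x) := by
  have h := (differentiable_of_smooth hφ (r • x)).hasFDerivAt.comp x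
    ((hasFDerivAt_id x).const_smul r)
  have h' : fderiv ℝ (fun x => φ (r • x)) x = _ := h.fderiv
  rw [pd, h']
  simp [pd]

theorem rot_comp_smul (hφ : ContDiff ℝ ∞ φ) (r : ℝ) (i j : Fin d) (x : Euc d) :
    rot i j (fun x => φ (r • x)) x = rot i j φ (r • x) := by
  simp only [rot, pd_comp_smul hφ, PiLp.smul_apply, smul_eq_mul]
  ring

theorem sphere_poincare_smul (hd : 1 ≤ d) (l : ℕ) (hφ : ContDiff ℝ ∞ φ)
    (h : ∀ q ∈ polyLE d l, SphOrth (evalP q) φ) {r : ℝ} (hr : 0 < r) :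
    sphInt (fun x => 2 * (((l : ℝ) + 1) * (l + d - 1)) * φ (r • x) ^ 2) ≤
      sphInt fun x => ∑ i, ∑ j, rot i j φ (r • x) ^ 2 := by
  have hs : ContDiff ℝ ∞ fun x => φ (r • x) := hφ.comp (contDiff_const_smul r)
  have key := sphere_poincare hd l hs fun q hq => h q hq r hr
  rw [sphInt_const_mul]
  refine key.trans (le_of_eq ?_)
  have hc : ∀ i j : Fin d, Continuous fun x => rot i j φ (r • x) ^ 2 := fun i j => by
    have := (contDiff_rot hφ i j).continuous
    fun_prop
  rw [sphInt_sum _ fun i => continuous_finsetSum _ fun j _ => hc i j, sphEnergy]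
  refine Finset.sum_congr rfl fun i _ => ?_
  rw [sphInt_sum _ fun j => hc i j]
  simp only [rot_comp_smul hφ, sq]

/-- Lagrange's identity, separating the radial and angular parts of the gradient; the factor ½
compensates for counting each pair (i, j) twice. -/
theorem normSq_mul_gradDot (φ : Euc d → ℝ) (x : Euc d) :
    ‖x‖ ^ 2 * gradDot φ φ x = eul φ x ^ 2 + 1 / 2 * ∑ i, ∑ j, rot i j φ x ^ 2 := by
  have e : ∀ i j : Fin d, rot i j φ x ^ 2 = x i ^ 2 * pd j φ x ^ 2 + pd i φ x ^ 2 * x j ^ 2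
      - 2 * ((x i * pd i φ x) * (x j * pd j φ x)) := by
    intro i j
    rw [rot]
    ring
  simp only [e, Finset.sum_sub_distrib, Finset.sum_add_distrib, ← Finset.mul_sum,
    ← Finset.sum_mul]
  rw [norm_sq_eq_sum]
  simp only [gradDot, eul, ← sq]
  ring

/-- The gap on functions orthogonal to the spherical harmonics of degree at most one. -/
theorem two_mul_le_quadForm (hd : 1 ≤ d) (hφ : IsTest φ) (h0 : SphOrth (fun _ => 1) φ)
    (h1 : ∀ i, SphOrth (fun x => x i) φ) :
    2 * ∫ x, gradDot φ φ x ≤ quadForm ((d : ℝ) + 2) φ := by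
  have hd' : (1 : ℝ) ≤ d := by exact_mod_cast hd
  have horth : ∀ q ∈ polyLE d 1, SphOrth (evalP q) φ := by
    intro q hq r hr
    obtain ⟨c, a, h⟩ := polyLE_one_eq hq
    have hc := hφ.continuous
    have e : (fun x => φ (r • x) * evalP q x) =
        fun x => c * (φ (r • x) * 1) + ∑ i, a i * (φ (r • x) * x i) := by
      funext x
      rw [h, mul_add, Finset.mul_sum]
      congr 1
      · ring
      · exact Finset.sum_congr rfl fun i _ => by ring
    rw [e, sphInt_add (by fun_prop) (by fun_prop), sphInt_sum _ fun i => by fun_prop,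
      sphInt_const_mul, h0 r hr]
    simp only [sphInt_const_mul, h1 _ r hr]
    simp
  have hrc : ∀ i j : Fin d, Continuous (rot i j φ) := fun i j => (contDiff_rot hφ.smooth i j).continuous
  have hφc := hφ.continuous
  have hrt : ∀ i j : Fin d, IsTest (rot i j φ) := fun i j =>
    ((hφ.pd j).mul_left (contDiff_coord i)).sub ((hφ.pd i).mul_left (contDiff_coord j))
  have hRi : Integrable fun x => ∑ i, ∑ j, rot i j φ x ^ 2 :=
    integrable_finsetSum _ fun i _ => integrable_finsetSum _ fun j _ => by
      simpa only [sq] using (hrt i j).integrable_mul (hrc i j)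
  have hφi : Integrable fun x => φ x ^ 2 := by
    simpa only [sq] using hφ.integrable_mul hφc
  have hei : Integrable fun x => eul φ x ^ 2 := by
    simpa only [sq] using hφ.eul.integrable_mul hφ.eul.continuous
  have hp := (integrable_and_integral_le_of_sphInt_le hd
    (f := fun x => 2 * ((((1 : ℕ) : ℝ) + 1) * ((1 : ℕ) + d - 1)) * φ x ^ 2)
    (g := fun x => ∑ i, ∑ j, rot i j φ x ^ 2) (by fun_prop) (by fun_prop)
    (fun x => mul_nonneg (by push_cast; linarith) (sq_nonneg _)) (fun x => by positivity) hRi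
    fun r hr => sphere_poincare_smul hd 1 hφ.smooth horth hr).2
  rw [integral_const_mul] at hp
  have hw : ∫ x, ‖x‖ ^ 2 * gradDot φ φ x =
      (∫ x, eul φ x ^ 2) + 1 / 2 * ∫ x, ∑ i, ∑ j, rot i j φ x ^ 2 := by
    simp only [normSq_mul_gradDot]
    rw [integral_add hei (hRi.const_mul _), integral_const_mul]
  -- With c = d+1 the square gives ∫(Δφ)² + ∫(x·∇φ)² ≥ (d+4)∫|∇φ|² - (d+1)∫φ². The angular part
  -- supplies 2d∫φ², so the form exceeds 2∫|∇φ|² by at least (d-1)∫φ² ≥ 0.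
  have hs := integral_sq_lap_add_eul hφ ((d : ℝ) + 1)
  have hs0 : 0 ≤ ∫ x, (lap φ x + eul φ x + ((d : ℝ) + 1) * φ x) ^ 2 :=
    integral_nonneg fun x => sq_nonneg _
  have hm : 0 ≤ ∫ x, φ x ^ 2 := integral_nonneg fun x => sq_nonneg _
  rw [quadForm, hw]
  push_cast at hp
  nlinarith [mul_nonneg (sub_nonneg.2 hd') hm]

/-- The gap for products of a coordinate with a radial function. -/
theorem stabConst_mul_le_quadForm_coord (hd : 2 ≤ d) (hv : EvenSmooth v) {R : ℝ}
    (hR : ∀ r, R ≤ r → v r = 0) (i : Fin d) :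
    stabConst d * ∫ x : Euc d, gradDot (fun x => x i * v ‖x‖) (fun x => x i * v ‖x‖) x ≤
      quadForm ((d : ℝ) + 2) fun x : Euc d => x i * v ‖x‖ := by
  have hY := IsSolidHarmonic.coord i
  rw [integral_gradDot_harmonic (by omega) hY hv hR, quadForm_harmonic (by omega) hY hv hR]
  have h : (stabConst d + (d + 2)) *
      (∫ x : Euc (d + 2 * 1), gradDot (fun x => v ‖x‖) (fun x => v ‖x‖) x) ≤
      radialNum d 1 fun x => v ‖x‖ := by
    have ht : IsTest fun x : Euc (d + 2 * 1) => v ‖x‖ := hv.isTest_comp_norm hR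
    -- The zero function is not an admissible competitor in the infimum, but both sides then vanish.
    by_cases h0 : (fun x : Euc (d + 2 * 1) => v ‖x‖) = 0
    · rw [radialNum_eq ht]
      have e' : ∀ x : Euc (d + 2 * 1), v ‖x‖ = 0 := fun x => congrFun h0 x
      simp only [e', gradDot, lap, pd_const]
      simp
    · exact stabConst_mul_le hd le_rfl ⟨ht.smooth, ht.compact, fun x y h => by simp only [h], h0⟩
  have hκ := harmonicRatio_nonneg 1 fun x : Euc d => x i
  nlinarith [mul_le_mul_of_nonneg_left h hκ]

theorem le_quadForm_add {C : ℝ} (hd : 0 < d) (hY : IsSolidHarmonic k Y) (hv : EvenSmooth v)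
    (ht : IsTest fun x => Y x * v ‖x‖) (hφ : IsTest φ) (ho : SphOrth Y φ)
    (h1 : C * ∫ x, gradDot φ φ x ≤ quadForm ((d : ℝ) + 2) φ)
    (h2 : C * ∫ x, gradDot (fun x => Y x * v ‖x‖) (fun x => Y x * v ‖x‖) x ≤
      quadForm ((d : ℝ) + 2) fun x => Y x * v ‖x‖) :
    C * ∫ x, gradDot (fun x => φ x + Y x * v ‖x‖) (fun x => φ x + Y x * v ‖x‖) x ≤
      quadForm ((d : ℝ) + 2) fun x => φ x + Y x * v ‖x‖ := by
  have hr := ho.orthRadial hd hY hφ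
  rw [quadForm_add _ hY hv ht hφ hr, integral_gradDot_add hY hv ht hφ hr]
  linarith

/-- The Gaussian field is the gradient of the radial function -e^{-|x|²/2}. Moving the Laplacian
onto it leaves φ paired with a radial function. -/
theorem gaussPair_eq_zero (hd : 0 < d) (hφ : IsTest φ) (h : SphOrth (fun _ => 1) φ) :
    gaussPair φ = 0 := by
  set V : ℝ → ℝ := fun r => -Real.exp (-r ^ 2 / 2) with hV
  have hexp : ContDiff ℝ ∞ fun r : ℝ => Real.exp (-r ^ 2 / 2) :=
    Real.contDiff_exp.comp ((contDiff_id.pow 2).neg.div_const 2)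
  have hVs : EvenSmooth V := ⟨hexp.neg, fun r => by simp [hV]⟩
  have hder : ∀ r, deriv V r = r * Real.exp (-r ^ 2 / 2) := by
    intro r
    have h2 : HasDerivAt (fun r : ℝ => -r ^ 2 / 2) (-r) r := by
      refine (((hasDerivAt_pow 2 r).fun_neg).div_const 2).congr_deriv ?_
      push_cast
      ring
    rw [h2.exp.fun_neg.deriv]
    ring
  have e : gaussPair φ = ∫ x, gradDot (fun x => V ‖x‖) φ x := by
    rw [gaussPair]
    congr 1
    funext x
    rw [eul, gradDot, Finset.sum_mul]
    refine Finset.sum_congr rfl fun i _ => ?_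
    rw [hVs.pd_comp_norm hder]
    ring
  rw [e, integral_gradDot hVs.contDiff_comp_norm hφ,
    integral_mul_lap_comm hVs.contDiff_comp_norm hφ]
  simp only [hVs.lap_radial]
  have := h.orthRadial hd IsSolidHarmonic.one hφ _ (hVs.lapProfile d).continuous
  simp only [one_mul, mul_comm (φ _)] at this
  rw [this, neg_zero]

theorem integrable_eul_mul_exp (hφ : IsTest φ) :
    Integrable fun x => eul φ x * Real.exp (-‖x‖ ^ 2 / 2) :=
  hφ.eul.integrable_mul (by fun_prop)

theorem gaussPair_add (hφ : IsTest φ) (hψ : IsTest ψ) :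
    gaussPair (fun x => φ x + ψ x) = gaussPair φ + gaussPair ψ := by
  rw [gaussPair, gaussPair, gaussPair,
    ← integral_add (integrable_eul_mul_exp hφ) (integrable_eul_mul_exp hψ)]
  congr 1
  funext x
  simp only [eul, pd_add hφ.smooth hψ.smooth, mul_add, Finset.sum_add_distrib]
  ring

theorem gaussPair_sq_le (hd : 0 < d) (hφ : IsTest φ) :
    gaussPair φ ^ 2 ≤ gaussFieldNormSq d * ∫ x, gradDot φ φ x := by
  have hpos := gaussFieldNormSq_pos hd
  set t := gaussPair φ / gaussFieldNormSq d with ht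
  have h1 : 0 ≤ ∫ x : Euc d, (gradDot φ φ x + ((-2 * t) * (eul φ x * Real.exp (-‖x‖ ^ 2 / 2)) +
      t ^ 2 * (‖x‖ ^ 2 * Real.exp (-‖x‖ ^ 2 / 2) ^ 2))) := by
    refine integral_nonneg fun x => ?_
    have e : gradDot φ φ x + ((-2 * t) * (eul φ x * Real.exp (-‖x‖ ^ 2 / 2)) +
        t ^ 2 * (‖x‖ ^ 2 * Real.exp (-‖x‖ ^ 2 / 2) ^ 2)) =
        ∑ i, (pd i φ x - t * Real.exp (-‖x‖ ^ 2 / 2) * x i) ^ 2 := by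
      rw [norm_sq_eq_sum x, gradDot, eul]
      simp only [Finset.sum_mul, Finset.mul_sum, ← Finset.sum_add_distrib]
      exact Finset.sum_congr rfl fun i _ => by ring
    simp only [Pi.zero_apply]
    rw [e]
    positivity
  rw [integral_add (hφ.gradDot hφ).integrable (((integrable_eul_mul_exp hφ).const_mul _).fun_add
    ((integrable_gaussField d hd).const_mul _)), integral_add
    ((integrable_eul_mul_exp hφ).const_mul _) ((integrable_gaussField d hd).const_mul _),
    integral_const_mul, integral_const_mul, ← gaussPair, ← gaussFieldNormSq] at h1
  have h2 : gaussPair φ = t * gaussFieldNormSq d := by rw [ht]; field_simp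
  rw [h2] at h1 ⊢
  nlinarith

/-- The stability inequality for potentials with compact support. -/
theorem stabConst_mul_le_quadForm (hd : 2 ≤ d) (hφ : IsTest φ) :
    stabConst d * (gaussFieldNormSq d * (∫ x, gradDot φ φ x) - gaussPair φ ^ 2) ≤
      gaussFieldNormSq d * quadForm ((d : ℝ) + 2) φ := by
  have hd0 : 0 < d := by omega
  have hσ := sphInt_one_pos hd0
  have hd' : (d : ℝ) ≠ 0 := by positivity
  have hvn := gaussFieldNormSq_pos hd0
  have hC0 := stabConst_nonneg hd
  have hC2 := stabConst_le_two hd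
  obtain ⟨R, hR0, hR⟩ := hφ.compact.exists_pos_le_norm
  have hvan : ∀ r, R ≤ r → ∀ x : Euc d, ‖x‖ = 1 → φ (r • x) = 0 := fun r hr x hx =>
    hR _ (by rwa [norm_smul, hx, mul_one, Real.norm_of_nonneg (hR0.le.trans hr)])
  obtain ⟨v0, hv0, h0⟩ := exists_radial_part hd0 hφ.smooth
  choose v hv hvi using exists_coord_part hd0 hφ.smooth
  have h0R : ∀ r, R ≤ r → v0 r = 0 := by
    intro r hr
    have h1 := h0 r
    rw [sphInt_congr (g := fun _ => 0) (fun x hx => hvan r hr x hx), sphInt_const, mul_zero] at h1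
    exact (mul_eq_zero.1 h1.symm).resolve_left hσ.ne'
  have hvR : ∀ i r, R ≤ r → v i r = 0 := by
    intro i r hr
    have h1 := hvi i r
    rw [sphInt_congr (g := fun _ => 0) (fun x hx => by rw [hvan r hr x hx, zero_mul]),
      sphInt_const, mul_zero] at h1
    have h2 := (mul_eq_zero.1 h1.symm).resolve_right (by positivity)
    exact (mul_eq_zero.1 h2).resolve_left (by linarith)
  have ht0 : IsTest fun x : Euc d => v0 ‖x‖ := hv0.isTest_comp_norm h0R
  have hti : ∀ i, IsTest fun x : Euc d => x i * v i ‖x‖ := fun i =>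
    (IsSolidHarmonic.coord i).isTest_mul_radial (hv i) (hvR i)
  have htc : ∀ i, Continuous fun x : Euc d => x i * v i ‖x‖ := fun i => (hti i).continuous
  -- The spherical components of degree 0 and 1 are removed; what remains is orthogonal to constants
  -- and coordinates on each sphere.
  set φ₂ : Euc d → ℝ := fun x => φ x - v0 ‖x‖ - ∑ i, x i * v i ‖x‖ with hφ₂
  have ht2 : IsTest φ₂ := (hφ.sub ht0).sub (IsTest.sum _ hti)
  have hsplit : ∀ (Y : Euc d → ℝ), Continuous Y → ∀ r : ℝ, 0 < r →
      sphInt (fun x => φ₂ (r • x) * Y x) = sphInt (fun x => φ (r • x) * Y x) - v0 r * sphInt Y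
        - ∑ i, r * v i r * sphInt fun x => x i * Y x := by
    intro Y hY r hr
    have hφc := hφ.continuous
    have h0c := ht0.continuous
    have e : (fun x => φ₂ (r • x) * Y x) = fun x => φ (r • x) * Y x - v0 ‖r • x‖ * Y x
        - ∑ i, ((r • x) i * v i ‖r • x‖) * Y x := by
      funext x
      simp only [hφ₂, sub_mul, Finset.sum_mul]
    have hc1 : Continuous fun x : Euc d => v0 ‖r • x‖ * Y x :=
      (h0c.comp (continuous_const_smul r)).mul hY
    have hc2 : ∀ i, Continuous fun x : Euc d => ((r • x) i * v i ‖r • x‖) * Y x := fun i =>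
      ((htc i).comp (continuous_const_smul r)).mul hY
    have hc3 : Continuous fun x : Euc d => φ (r • x) * Y x := by fun_prop
    rw [e, sphInt_sub (hc3.fun_sub hc1) (continuous_finsetSum _ fun i _ => hc2 i),
      sphInt_sub hc3 hc1, sphInt_sum _ hc2]
    simp only [sphInt_coord_mul_radial Y _ hr]
    congr 2
    rw [← sphInt_const_mul]
    refine sphInt_congr fun x hx => ?_
    rw [norm_smul, hx, mul_one, Real.norm_of_nonneg hr.le]
  have ho1 : SphOrth (fun _ => 1) φ₂ := by
    intro r hr
    rw [hsplit _ continuous_const r hr]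
    simp only [mul_one, sphInt_coord hd, mul_zero, Finset.sum_const_zero, h0 r]
    ring
  have hoc : ∀ j, SphOrth (fun x => x j) φ₂ := by
    intro j r hr
    rw [hsplit _ (continuous_coord j) r hr, sphInt_coord hd, hvi, Finset.sum_eq_single j,
      sphInt_coord_sq hd0]
    · ring
    · intro i _ hij
      rw [sphInt_coord_mul hij, mul_zero]
    · simp
  have hD2 : 0 ≤ ∫ x, gradDot φ₂ φ₂ x := integral_nonneg fun x => gradDot_self_nonneg _ _
  -- The coordinate components are restored one at a time: each xⱼ is orthogonal on spheres to φ₂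
  -- and to the other coordinates, so the form splits at every stage.
  have key : ∀ s : Finset (Fin d), IsTest (fun x => φ₂ x + ∑ i ∈ s, x i * v i ‖x‖) ∧
      stabConst d * ∫ x, gradDot (fun x => φ₂ x + ∑ i ∈ s, x i * v i ‖x‖)
        (fun x => φ₂ x + ∑ i ∈ s, x i * v i ‖x‖) x ≤
      quadForm ((d : ℝ) + 2) fun x => φ₂ x + ∑ i ∈ s, x i * v i ‖x‖ := by
    intro s
    refine ⟨ht2.add (IsTest.sum _ hti), ?_⟩
    induction s using Finset.induction_on with
    | empty =>
      simp only [Finset.sum_empty, add_zero]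
      exact (mul_le_mul_of_nonneg_right hC2 hD2).trans (two_mul_le_quadForm hd0 ht2 ho1 hoc)
    | insert j s hj ih =>
      have ho : SphOrth (fun x => x j) fun x => φ₂ x + ∑ i ∈ s, x i * v i ‖x‖ := by
        refine SphOrth.add (continuous_coord j) ht2.continuous
          (continuous_finsetSum _ fun i _ => htc i) (hoc j)
          (SphOrth.sum (continuous_coord j) s htc fun i hi => ?_)
        exact sphOrth_coord_mul_radial (sphInt_coord_mul fun h => hj (h ▸ hi))
      have := le_quadForm_add hd0 (IsSolidHarmonic.coord j) (hv j) (hti j)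
        (ht2.add (IsTest.sum s hti)) ho ih (stabConst_mul_le_quadForm_coord hd (hv j) (hvR j) j)
      have e : (fun x : Euc d => φ₂ x + ∑ i ∈ insert j s, x i * v i ‖x‖) =
          fun x => φ₂ x + ∑ i ∈ s, x i * v i ‖x‖ + x j * v j ‖x‖ := by
        funext x
        rw [Finset.sum_insert hj]
        ring
      rw [e]
      exact this
  obtain ⟨ht1, hk⟩ := key Finset.univ
  set φ₁ : Euc d → ℝ := fun x => φ₂ x + ∑ i, x i * v i ‖x‖ with hφ₁
  have ho : SphOrth (fun _ => 1) φ₁ :=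
    SphOrth.add continuous_const ht2.continuous (continuous_finsetSum _ fun i _ => htc i) ho1
      (SphOrth.sum continuous_const _ htc fun i _ => sphOrth_coord_mul_radial (by
        simpa using sphInt_coord hd i))
  have hφe : φ = fun x => φ₁ x + 1 * v0 ‖x‖ := by
    funext x
    simp only [hφ₁, hφ₂]
    ring
  have ht0' : IsTest fun x : Euc d => 1 * v0 ‖x‖ := by simpa using ht0
  have hor := ho.orthRadial hd0 IsSolidHarmonic.one ht1
  have hg : gaussPair φ = gaussPair fun x : Euc d => 1 * v0 ‖x‖ := by
    conv_lhs => rw [hφe]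
    rw [gaussPair_add ht1 ht0', gaussPair_eq_zero hd0 ht1 ho, zero_add]
  have hq : quadForm ((d : ℝ) + 2) φ =
      quadForm ((d : ℝ) + 2) φ₁ + quadForm ((d : ℝ) + 2) fun x : Euc d => 1 * v0 ‖x‖ := by
    conv_lhs => rw [hφe]
    exact quadForm_add _ IsSolidHarmonic.one hv0 ht0' ht1 hor
  have hD : ∫ x, gradDot φ φ x = (∫ x, gradDot φ₁ φ₁ x) +
      ∫ x : Euc d, gradDot (fun x => 1 * v0 ‖x‖) (fun x => 1 * v0 ‖x‖) x := by
    conv_lhs => rw [hφe]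
    exact integral_gradDot_add IsSolidHarmonic.one hv0 ht0' ht1 hor
  have hgap := radial_gap hd0 hv0 h0R
  have hcs := gaussPair_sq_le hd0 ht0
  rw [hg, hq, hD]
  simp only [one_mul]
  -- Only the radial part pairs with the Gaussian. Its gap is 2 times the nonnegative defect in
  -- `hcs`, hence at least C(N) times it.
  nlinarith [mul_le_mul_of_nonneg_left hk hvn.le,
    mul_le_mul_of_nonneg_right hC2 (sub_nonneg.2 hcs)]

end Decomposition

/-! ### Removing compact support by truncation. -/

section Approximation

variable {d : ℕ} {φ : Euc d → ℝ}

/-- A radial cutoff function with its profile. -/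
theorem exists_cutoff_euc (d : ℕ) : ∃ (κ : Euc d → ℝ) (χ : ℝ → ℝ), IsTest κ ∧ EvenSmooth χ ∧
    (∀ r, 2 ≤ |r| → χ r = 0) ∧ (∀ x, κ x = χ ‖x‖) ∧ (∀ x, |κ x| ≤ 1) ∧ (∀ x, ‖x‖ < 1 → κ x = 1) ∧
    (∀ i x, ‖x‖ < 1 → pd i κ x = 0) ∧ (∀ i j x, ‖x‖ < 1 → pd i (pd j κ) x = 0) ∧
    ∃ M, (∀ i x, |pd i κ x| ≤ M) ∧ (∀ i x, |‖x‖ * pd i κ x| ≤ M) ∧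
      ∀ i j x, |pd i (pd j κ) x| ≤ M := by
  obtain ⟨χ, hχ, hχ1, hχ2, hχ0, hχle⟩ := exists_cutoff
  have ht : IsTest fun x : Euc d => χ ‖x‖ := hχ.isTest_comp_norm (R := 2) fun r hr =>
    hχ2 r (hr.trans (le_abs_self r))
  set κ : Euc d → ℝ := fun x => χ ‖x‖ with hκ
  have h1 : ∀ x : Euc d, ‖x‖ < 1 → κ x = 1 := fun x hx => hχ1 _ (by simpa using hx.le)
  have hloc : ∀ {f : Euc d → ℝ} {c : ℝ}, (∀ x, ‖x‖ < 1 → f x = c) → ∀ i x, ‖x‖ < 1 →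
      pd i f x = 0 := by
    intro f c hf i x hx
    have h : f =ᶠ[nhds x] fun _ => c := by
      filter_upwards [(isOpen_lt continuous_norm continuous_const).mem_nhds hx] with y hy
      exact hf y hy
    rw [pd, h.fderiv_eq]
    simp
  have h2 := fun i => hloc h1 i
  refine ⟨κ, χ, ht, hχ, hχ2, fun x => rfl, fun x => ?_, h1, h2, fun i j => hloc (h2 j) i, ?_⟩
  · rw [abs_of_nonneg (hχ0 _)]
    exact hχle _
  · have b1 := fun i => (ht.pd i).compact.exists_bound_of_continuous (ht.pd i).continuous
    have b2 : ∀ i, ∃ C, ∀ x : Euc d, ‖‖x‖ * pd i κ x‖ ≤ C := fun i =>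
      HasCompactSupport.exists_bound_of_continuous (ht.pd i).compact.mul_left
        (continuous_norm.mul (ht.pd i).continuous)
    have b3 : ∀ p : Fin d × Fin d, ∃ C, ∀ x : Euc d, ‖pd p.1 (pd p.2 κ) x‖ ≤ C := fun p =>
      ((ht.pd p.2).pd p.1).compact.exists_bound_of_continuous ((ht.pd p.2).pd p.1).continuous
    choose C1 hC1 using b1
    choose C2 hC2 using b2
    choose C3 hC3 using b3
    obtain ⟨M1, hM1⟩ := Finite.exists_le C1
    obtain ⟨M2, hM2⟩ := Finite.exists_le C2
    obtain ⟨M3, hM3⟩ := Finite.exists_le C3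
    refine ⟨max M1 (max M2 M3), fun i x => (hC1 i x).trans ((hM1 i).trans (le_max_left _ _)),
      fun i x => (hC2 i x).trans ((hM2 i).trans ((le_max_left _ _).trans (le_max_right _ _))),
      fun i j x => (hC3 (i, j) x).trans
        ((hM3 (i, j)).trans ((le_max_right _ _).trans (le_max_right _ _)))⟩

/-- The weight is at least 1 outside the unit ball, and inside it continuity suffices. -/
theorem integrable_of_normSq_mul {f : Euc d → ℝ} (hf : Continuous f) (hf0 : ∀ x, 0 ≤ f x)
    (h : Integrable fun x => ‖x‖ ^ 2 * f x) : Integrable f := by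
  have h1 : Integrable ((Metric.closedBall (0 : Euc d) 1).indicator f) :=
    (hf.continuousOn.integrableOn_compact (isCompact_closedBall _ _)).integrable_indicator
      measurableSet_closedBall
  refine (h.add h1).mono' hf.aestronglyMeasurable (Filter.Eventually.of_forall fun x => ?_)
  rw [Real.norm_of_nonneg (hf0 x), Pi.add_apply]
  by_cases hx : x ∈ Metric.closedBall (0 : Euc d) 1
  · rw [Set.indicator_of_mem hx]
    have := mul_nonneg (sq_nonneg ‖x‖) (hf0 x)
    linarith
  · rw [Set.indicator_of_notMem hx, add_zero]
    simp only [Metric.mem_closedBall, dist_zero_right, not_le] at hx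
    exact le_mul_of_one_le_left (hf0 x) (one_le_pow₀ hx.le)

/-- The oscillation of `φ` on spheres is square integrable, together with its gradient. -/
theorem exists_radial_part_integrable (hd : 2 ≤ d) (hφ : ContDiff ℝ ∞ φ)
    (hB : Integrable fun x => ‖x‖ ^ 2 * gradDot φ φ x) :
    ∃ v, EvenSmooth v ∧ Integrable (fun x => (φ x - v ‖x‖) ^ 2) ∧
      Integrable (gradDot (fun x => φ x - v ‖x‖) fun x => φ x - v ‖x‖) := by
  have hd0 : 0 < d := by omega
  have hσ := sphInt_one_pos hd0
  have hd' : (2 : ℝ) ≤ d := by exact_mod_cast hd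
  have hgc : Continuous (gradDot φ φ) := (contDiff_gradDot hφ hφ).continuous
  have hD := integrable_of_normSq_mul hgc (gradDot_self_nonneg φ) hB
  obtain ⟨v, hv, h0⟩ := exists_radial_part hd0 hφ
  have hvs := hv.contDiff_comp_norm (E := Euc d)
  have hts := hφ.sub hvs
  have hφc := hφ.continuous
  have hrc : ∀ i j : Fin d, Continuous (rot i j φ) := fun i j => (contDiff_rot hφ i j).continuous
  refine ⟨v, hv, ?_, ?_⟩
  -- The Poincaré inequality on spheres with l = 0 has constant 2(d-1), positive because d ≥ 2. The
  -- angular part of |x|²|∇φ|² therefore controls (φ - v)² without a weight.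
  · have horth : ∀ q ∈ polyLE d 0, SphOrth (evalP q) fun x => φ x - v ‖x‖ := by
      intro q hq r hr
      obtain ⟨c, hc⟩ : ∃ c, ∀ x : Euc d, evalP q x = c := by
        have h := MvPolynomial.totalDegree_eq_zero_iff_eq_C.1 (Nat.le_zero.1 (mem_polyLE.1 hq))
        exact ⟨_, fun x => by rw [h, evalP, MvPolynomial.eval_C]⟩
      have hvc : Continuous fun x : Euc d => v ‖r • x‖ :=
        hvs.continuous.comp (continuous_const_smul r)
      have e : (fun x => (φ (r • x) - v ‖r • x‖) * evalP q x) =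
          fun x => c * (φ (r • x) - v ‖r • x‖) := by
        funext x
        rw [hc, mul_comm]
      rw [e, sphInt_const_mul, sphInt_sub (by fun_prop) hvc, h0,
        sphInt_congr (f := fun x => v ‖r • x‖) (g := fun _ => v r) fun x hx => by
          rw [norm_smul, hx, mul_one, Real.norm_of_nonneg hr.le], sphInt_const (v r), sub_self, mul_zero]
    have hrot : ∀ i j x, rot i j (fun x => φ x - v ‖x‖) x = rot i j φ x := fun i j x => by
      rw [rot_sub hφ hvs, rot_comp_norm hv, sub_zero]
    have hRi : Integrable fun x => ∑ i, ∑ j, rot i j φ x ^ 2 := by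
      refine (hB.const_mul 2).mono' (by fun_prop : Continuous _).aestronglyMeasurable
        (Filter.Eventually.of_forall fun x => ?_)
      rw [Real.norm_of_nonneg (by positivity), normSq_mul_gradDot]
      nlinarith [sq_nonneg (eul φ x)]
    have hc := hts.continuous
    have := (integrable_and_integral_le_of_sphInt_le hd0
      (f := fun x => 2 * ((((0 : ℕ) : ℝ) + 1) * ((0 : ℕ) + d - 1)) * (φ x - v ‖x‖) ^ 2)
      (g := fun x => ∑ i, ∑ j, rot i j φ x ^ 2) (by fun_prop) (by fun_prop)
      (fun x => mul_nonneg (by push_cast; linarith) (sq_nonneg _)) (fun x => by positivity) hRi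
      fun r hr => by
        have := sphere_poincare_smul hd0 0 hts horth hr
        simp only [hrot] at this
        exact this).1
    have h2 := this.const_mul (2 * ((((0 : ℕ) : ℝ) + 1) * ((0 : ℕ) + d - 1)))⁻¹
    refine h2.congr (Filter.Eventually.of_forall fun x => ?_)
    have : 2 * ((((0 : ℕ) : ℝ) + 1) * ((0 : ℕ) + d - 1)) ≠ 0 := by
      push_cast
      have : (0 : ℝ) < 2 * ((0 + 1) * (0 + d - 1)) := by linarith
      exact this.ne'
    simp only
    rw [inv_mul_cancel_left₀ this]
  · have hgv : Continuous (gradDot (fun x : Euc d => v ‖x‖) fun x => v ‖x‖) :=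
      (contDiff_gradDot hvs hvs).continuous
    have hvi := (integrable_and_integral_le_of_sphInt_le hd0 hgv hgc (gradDot_self_nonneg _)
      (gradDot_self_nonneg φ) hD fun r hr => ?_).1
    · refine ((hD.const_mul 2).add (hvi.const_mul 2)).mono'
        (contDiff_gradDot hts hts).continuous.aestronglyMeasurable
        (Filter.Eventually.of_forall fun x => ?_)
      rw [Real.norm_of_nonneg (gradDot_self_nonneg _ x)]
      simp only [Pi.add_apply, gradDot, pd_sub hφ hvs, Finset.mul_sum, ← Finset.sum_add_distrib]
      refine Finset.sum_le_sum fun i _ => ?_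
      nlinarith [sq_nonneg (pd i φ x + pd i (fun x => v ‖x‖) x)]
    · set D : Euc d → ℝ := fun x => fderiv ℝ φ (r • x) x with hDdef
      have hDc : Continuous D := by
        have : D = fun x => ∑ i, x i * pd i φ (r • x) := funext fun x =>
          fderiv_apply_eq_sum_pd φ _ _
        rw [this]
        have := fun i => (contDiff_pd hφ i).continuous
        fun_prop
      have hder : sphInt D = sphInt (fun _ : Euc d => 1) * deriv v r := by
        have h1 := hasDerivAt_integral_ray (volume : Measure (Euc d)).toSphere
          (γ := fun w : Metric.sphere (0 : Euc d) 1 => (w : Euc d)) continuous_subtype_val hφ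
          (ρ := fun _ => ContinuousLinearMap.id ℝ ℝ) continuous_const r
        have h2 := (differentiable_of_smooth hv.smooth r).hasDerivAt.const_mul
          (sphInt fun _ : Euc d => 1)
        have e : (fun r => sphInt (fun _ : Euc d => 1) * v r) = fun r : ℝ =>
          ∫ w : Metric.sphere (0 : Euc d) 1, (ContinuousLinearMap.id ℝ ℝ) (φ (r • (w : Euc d)))
            ∂(volume : Measure (Euc d)).toSphere := funext fun r => (h0 r).symm
        rw [e] at h2
        exact h1.unique h2
      set c := deriv v r with hc
      -- Jensen's inequality: v' is the spherical mean of the radial derivative of φ.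
      have hj : sphInt (fun _ : Euc d => 1) * c ^ 2 ≤ sphInt fun x => D x ^ 2 := by
        have h1 : 0 ≤ sphInt fun x => (D x - c) ^ 2 := sphInt_nonneg fun _ => sq_nonneg _
        have e : (fun x => (D x - c) ^ 2) = fun x => D x ^ 2 + ((-2 * c) * D x + c ^ 2) := by
          funext x; ring
        rw [e, sphInt_add (by fun_prop) (by fun_prop), sphInt_add (by fun_prop) (by fun_prop),
          sphInt_const_mul, hder, sphInt_const (c ^ 2)] at h1
        nlinarith
      have h1 : sphInt (fun x => gradDot (fun x : Euc d => v ‖x‖) (fun x => v ‖x‖) (r • x)) =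
          sphInt (fun _ : Euc d => 1) * c ^ 2 := by
        rw [← sphInt_const]
        refine sphInt_congr fun x hx => ?_
        rw [hv.gradDot_radial, norm_smul, hx, mul_one, Real.norm_of_nonneg hr.le, hc, hv.deriv_eq]
        ring
      rw [h1]
      refine hj.trans (sphInt_mono (by fun_prop) (by fun_prop) fun x hx => ?_)
      have h2 := Finset.sum_mul_sq_le_sq_mul_sq Finset.univ (fun i => x i)
        (fun i => pd i φ (r • x))
      rw [← norm_sq_eq_sum, hx, one_pow, one_mul] at h2
      simp only [hDdef, fderiv_apply_eq_sum_pd, gradDot]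
      simpa only [sq] using h2

/-- Truncation of a potential, up to a radial function. -/
theorem exists_truncation (hφ : ContDiff ℝ ∞ φ) {v : ℝ → ℝ} (hv : EvenSmooth v) {κ : Euc d → ℝ}
    {χ : ℝ → ℝ} (hκ : IsTest κ) (hχ : EvenSmooth χ) (hχ2 : ∀ r, 2 ≤ |r| → χ r = 0)
    (hκχ : ∀ x, κ x = χ ‖x‖) {a : ℝ} (ha : 0 < a) : ∃ ψ, IsTest ψ ∧
      (∀ i x, pd i ψ x = κ (a • x) * pd i φ x + a * pd i κ (a • x) * (φ x - v ‖x‖)) ∧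
      ∀ i j x, pd i (pd j ψ) x = a * pd i κ (a • x) * pd j φ x + κ (a • x) * pd i (pd j φ) x +
        (a * (a * pd i (pd j κ) (a • x)) * (φ x - v ‖x‖) +
          a * pd j κ (a • x) * pd i (fun x => φ x - v ‖x‖) x) := by
  -- The radial part is truncated at the level of its derivative: e' = χ(ar)v'. The truncation then
  -- has gradient κ∇φ + a∇κ(φ - v), with no term in v itself, whose integrability is unknown.
  set g : ℝ → ℝ := fun r => χ (a * r) * rdiv v r with hg
  have hgs : EvenSmooth g := by
    refine EvenSmooth.mul (f := fun r => χ (a * r)) ⟨hχ.smooth.comp (contDiff_const.mul contDiff_id),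
      fun r => by rw [mul_neg, hχ.even]⟩ hv.rdiv
  have hgR : ∀ r, 2 / a ≤ r → g r = 0 := by
    intro r hr
    rw [div_le_iff₀ ha] at hr
    simp only [hg, hχ2 (a * r) ((by linarith : 2 ≤ a * r).trans (le_abs_self _)), zero_mul]
  obtain ⟨e, he, heR, hed⟩ := exists_radial_potential hgs hgR
  have hvs := hv.contDiff_comp_norm (E := Euc d)
  have hts : ContDiff ℝ ∞ fun x => φ x - v ‖x‖ := hφ.sub hvs
  have hκs : ContDiff ℝ ∞ fun x => κ (a • x) := hκ.smooth.comp (contDiff_const_smul a)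
  have hκa : IsTest fun x => κ (a • x) :=
    ⟨hκs, hκ.compact.comp_homeomorph (Homeomorph.smulOfNeZero a ha.ne')⟩
  have het : IsTest fun x : Euc d => e ‖x‖ := he.isTest_comp_norm heR
  have h1 : ∀ i, pd i (fun x => κ (a • x) * (φ x - v ‖x‖) + e ‖x‖) =
      fun x => κ (a • x) * pd i φ x + a * pd i κ (a • x) * (φ x - v ‖x‖) := by
    intro i
    rw [pd_add (hκs.mul hts) het.smooth, pd_mul hκs hts, pd_sub hφ hvs]
    funext x
    beta_reduce
    rw [pd_comp_smul hκ.smooth, he.pd_comp_norm hed, hv.pd_radial]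
    simp only [hg, hκχ, norm_smul, Real.norm_of_nonneg ha.le]
    ring
  refine ⟨fun x => κ (a • x) * (φ x - v ‖x‖) + e ‖x‖, (hκa.mul_right hts).add het,
    fun i x => congrFun (h1 i) x, fun i j x => ?_⟩
  have hκj : ContDiff ℝ ∞ fun x => pd j κ (a • x) :=
    (contDiff_pd hκ.smooth j).comp (contDiff_const_smul a)
  have haκ : ContDiff ℝ ∞ fun x => a * pd j κ (a • x) := contDiff_const.mul hκj
  rw [h1, pd_add (hκs.mul (contDiff_pd hφ j)) (haκ.mul hts), pd_mul hκs (contDiff_pd hφ j),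
    pd_mul haκ hts, pd_const_mul hκj]
  simp only [pd_comp_smul hκ.smooth, pd_comp_smul (contDiff_pd hκ.smooth j)]

theorem sq_mul_le_of_abs_le {c M : ℝ} (h : |c| ≤ M) (t : ℝ) : (c * t) ^ 2 ≤ M ^ 2 * t ^ 2 := by
  rw [mul_pow]
  exact mul_le_mul_of_nonneg_right (sq_le_sq' (abs_le.1 h).1 (abs_le.1 h).2) (sq_nonneg t)

/-- The stability inequality for gradient fields of finite energy. -/
theorem stabConst_mul_le_of_integrable (hd : 2 ≤ d) (hφ : ContDiff ℝ ∞ φ)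
    (hA : Integrable fun x => ∑ i, ∑ j, pd i (pd j φ) x ^ 2)
    (hB : Integrable fun x => ‖x‖ ^ 2 * gradDot φ φ x) :
    stabConst d * (gaussFieldNormSq d * (∫ x, gradDot φ φ x) - gaussPair φ ^ 2) ≤
      gaussFieldNormSq d * ((∫ x, ∑ i, ∑ j, pd i (pd j φ) x ^ 2) +
        (∫ x, ‖x‖ ^ 2 * gradDot φ φ x) - ((d : ℝ) + 2) * ∫ x, gradDot φ φ x) := by
  have hD := integrable_of_normSq_mul (contDiff_gradDot hφ hφ).continuous
    (gradDot_self_nonneg φ) hB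
  obtain ⟨v, hv, hv2, hvg⟩ := exists_radial_part_integrable hd hφ hB
  obtain ⟨κ, χ, hκ, hχ, hχ2, hκχ, hκ1, hκb, hκb1, hκb2, M, hM1, hM2, hM3⟩ := exists_cutoff_euc d
  set a : ℕ → ℝ := fun n => 1 / ((n : ℝ) + 1) with ha
  have ha0 : ∀ n, 0 < a n := fun n => by simp only [ha]; positivity
  have ha1 : ∀ n, a n ≤ 1 := fun n => by
    simp only [ha]
    rw [div_le_one (by positivity)]
    linarith [(Nat.cast_nonneg n : (0 : ℝ) ≤ n)]
  have hlim : Filter.Tendsto a Filter.atTop (nhds 0) := tendsto_one_div_add_atTop_nhds_zero_nat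
  choose ψ hψ hψ1 hψ2 using fun n => exists_truncation hφ hv hκ hχ hχ2 hκχ (ha0 n)
  set t : Euc d → ℝ := fun x => φ x - v ‖x‖ with ht
  have hM0 : ∀ n i x, |a n * pd i κ (a n • x)| ≤ M := by
    intro n i x
    rw [abs_mul, abs_of_pos (ha0 n)]
    exact (mul_le_of_le_one_left (abs_nonneg _) (ha1 n)).trans (hM1 _ _)
  -- This bound is uniform in the scale because |y||∇κ(y)| is bounded, with y = ax; it absorbs the
  -- weight |x| on the cutoff error.
  have hM0' : ∀ n i x, |‖x‖ * (a n * pd i κ (a n • x))| ≤ M := by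
    intro n i x
    have := hM2 i (a n • x)
    rw [norm_smul, Real.norm_of_nonneg (ha0 n).le] at this
    convert this using 2
    ring
  have hM0'' : ∀ n i j x, |a n * (a n * pd i (pd j κ) (a n • x))| ≤ M := by
    intro n i j x
    rw [abs_mul, abs_mul, abs_of_pos (ha0 n)]
    refine (mul_le_of_le_one_left (by positivity) (ha1 n)).trans
      ((mul_le_of_le_one_left (abs_nonneg _) (ha1 n)).trans (hM3 _ _ _))
  -- At each point the cutoff is eventually constant, so pointwise convergence is eventual equality
  -- and only domination remains to be checked.
  have hev : ∀ x : Euc d, ∀ᶠ n in Filter.atTop, ‖a n • x‖ < 1 := by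
    intro x
    have h1 : Filter.Tendsto (fun n => ‖a n • x‖) Filter.atTop (nhds 0) := by
      have := (hlim.smul_const x).norm
      simpa using this
    exact h1.eventually_lt_const one_pos
  have e1 : ∀ x : Euc d, ∀ᶠ n in Filter.atTop, ∀ i, pd i (ψ n) x = pd i φ x := by
    intro x
    filter_upwards [hev x] with n hn i
    rw [hψ1, hκb _ hn, hκb1 _ _ hn]
    ring
  have e2 : ∀ x : Euc d, ∀ᶠ n in Filter.atTop, ∀ i j, pd i (pd j (ψ n)) x = pd i (pd j φ) x := by
    intro x
    filter_upwards [hev x] with n hn i j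
    rw [hψ2, hκb _ hn, hκb1 _ _ hn, hκb1 _ _ hn, hκb2 _ _ _ hn]
    ring
  have b1 : ∀ n x, gradDot (ψ n) (ψ n) x ≤ 2 * gradDot φ φ x + 2 * (d * (M ^ 2 * t x ^ 2)) := by
    intro n x
    have e : 2 * gradDot φ φ x + 2 * (d * (M ^ 2 * t x ^ 2)) =
        ∑ i, (2 * (pd i φ x * pd i φ x) + 2 * (M ^ 2 * t x ^ 2)) := by
      simp [gradDot, Finset.sum_add_distrib, ← Finset.mul_sum]
      ring
    rw [e]
    refine Finset.sum_le_sum fun i _ => ?_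
    rw [hψ1]
    have h1 := sq_mul_le_of_abs_le (hκ1 (a n • x)) (pd i φ x)
    have h2 := sq_mul_le_of_abs_le (hM0 n i x) (t x)
    nlinarith [sq_nonneg (κ (a n • x) * pd i φ x - a n * pd i κ (a n • x) * t x)]
  have b2 : ∀ n x, ‖x‖ ^ 2 * gradDot (ψ n) (ψ n) x ≤
      2 * (‖x‖ ^ 2 * gradDot φ φ x) + 2 * (d * (M ^ 2 * t x ^ 2)) := by
    intro n x
    have e : 2 * (‖x‖ ^ 2 * gradDot φ φ x) + 2 * (d * (M ^ 2 * t x ^ 2)) =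
        ∑ i, (2 * (‖x‖ ^ 2 * (pd i φ x * pd i φ x)) + 2 * (M ^ 2 * t x ^ 2)) := by
      simp [gradDot, Finset.sum_add_distrib, ← Finset.mul_sum]
      ring
    rw [e, gradDot, Finset.mul_sum]
    refine Finset.sum_le_sum fun i _ => ?_
    rw [hψ1]
    have h1 := sq_mul_le_of_abs_le (hκ1 (a n • x)) (‖x‖ * pd i φ x)
    have h2 := sq_mul_le_of_abs_le (hM0' n i x) (t x)
    nlinarith [sq_nonneg (κ (a n • x) * (‖x‖ * pd i φ x) -
      ‖x‖ * (a n * pd i κ (a n • x)) * t x)]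
  have b3 : ∀ n x, ∑ i, ∑ j, pd i (pd j (ψ n)) x ^ 2 ≤
      4 * (M ^ 2 * (d * gradDot φ φ x) + ∑ i, ∑ j, pd i (pd j φ) x ^ 2 +
        (M ^ 2 * (d * (d * t x ^ 2)) + M ^ 2 * (d * gradDot t t x))) := by
    intro n x
    have e : 4 * (M ^ 2 * (d * gradDot φ φ x) + ∑ i, ∑ j, pd i (pd j φ) x ^ 2 +
        (M ^ 2 * (d * (d * t x ^ 2)) + M ^ 2 * (d * gradDot t t x))) =
        ∑ i, ∑ j, 4 * (M ^ 2 * (pd j φ x) ^ 2 + pd i (pd j φ) x ^ 2 +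
          (M ^ 2 * t x ^ 2 + M ^ 2 * pd i t x ^ 2)) := by
      simp [gradDot, Finset.sum_add_distrib, ← Finset.mul_sum, ← sq]
      ring
    rw [e]
    refine Finset.sum_le_sum fun i _ => Finset.sum_le_sum fun j _ => ?_
    rw [hψ2]
    have h1 := sq_mul_le_of_abs_le (hM0 n i x) (pd j φ x)
    have h2 := sq_mul_le_of_abs_le (hκ1 (a n • x)) (pd i (pd j φ) x)
    have h3 := sq_mul_le_of_abs_le (hM0'' n i j x) (t x)
    have h4 := sq_mul_le_of_abs_le (hM0 n j x) (pd i t x)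
    set p := a n * pd i κ (a n • x) * pd j φ x
    set q := κ (a n • x) * pd i (pd j φ) x
    set r := a n * (a n * pd i (pd j κ) (a n • x)) * t x
    set s := a n * pd j κ (a n • x) * pd i t x
    nlinarith [sq_nonneg (p - q), sq_nonneg (p - r), sq_nonneg (p - s), sq_nonneg (q - r),
      sq_nonneg (q - s), sq_nonneg (r - s)]
  have hI1 := (hD.const_mul 2).fun_add (((hv2.const_mul (M ^ 2)).const_mul (d : ℝ)).const_mul 2)
  have hI2 := (hB.const_mul 2).fun_add (((hv2.const_mul (M ^ 2)).const_mul (d : ℝ)).const_mul 2)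
  have hI3 := (((((hD.const_mul (d : ℝ)).const_mul (M ^ 2)).fun_add hA).fun_add
    ((((hv2.const_mul (d : ℝ)).const_mul (d : ℝ)).const_mul (M ^ 2)).fun_add
      ((hvg.const_mul (d : ℝ)).const_mul (M ^ 2)))).const_mul 4)
  have lD : Filter.Tendsto (fun n => ∫ x, gradDot (ψ n) (ψ n) x) Filter.atTop
      (nhds (∫ x, gradDot φ φ x)) := by
    refine tendsto_integral_of_dominated_convergence _
      (fun n => ((hψ n).gradDot (hψ n)).continuous.aestronglyMeasurable) hI1
      (fun n => Filter.Eventually.of_forall fun x => ?_)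
      (Filter.Eventually.of_forall fun x => tendsto_nhds_of_eventually_eq ?_)
    · rw [Real.norm_of_nonneg (gradDot_self_nonneg _ x)]
      exact b1 n x
    · filter_upwards [e1 x] with n hn
      simp only [gradDot, hn]
  have lB : Filter.Tendsto (fun n => ∫ x, ‖x‖ ^ 2 * gradDot (ψ n) (ψ n) x) Filter.atTop
      (nhds (∫ x, ‖x‖ ^ 2 * gradDot φ φ x)) := by
    refine tendsto_integral_of_dominated_convergence _
      (fun n => (((hψ n).gradDot (hψ n)).mul_left contDiff_normSq).continuous.aestronglyMeasurable)
      hI2 (fun n => Filter.Eventually.of_forall fun x => ?_)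
      (Filter.Eventually.of_forall fun x => tendsto_nhds_of_eventually_eq ?_)
    · rw [Real.norm_of_nonneg (mul_nonneg (sq_nonneg _) (gradDot_self_nonneg _ x))]
      exact b2 n x
    · filter_upwards [e1 x] with n hn
      simp only [gradDot, hn]
  have lA : Filter.Tendsto (fun n => ∫ x, lap (ψ n) x ^ 2) Filter.atTop
      (nhds (∫ x, ∑ i, ∑ j, pd i (pd j φ) x ^ 2)) := by
    -- The limit is taken on the Hessian: it is the Hessian of φ that is assumed square integrable,
    -- and for φ itself no integration by parts is available.
    simp only [← fun n => integral_hessian_sq (hψ n)]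
    refine tendsto_integral_of_dominated_convergence _
      (fun n => (continuous_finsetSum _ fun i _ => continuous_finsetSum _ fun j _ =>
        (((hψ n).pd j).pd i).continuous.pow 2).aestronglyMeasurable)
      hI3 (fun n => Filter.Eventually.of_forall fun x => ?_)
      (Filter.Eventually.of_forall fun x => tendsto_nhds_of_eventually_eq ?_)
    · rw [Real.norm_of_nonneg (by positivity)]
      exact b3 n x
    · filter_upwards [e2 x] with n hn
      simp only [hn]
  have lP : Filter.Tendsto (fun n => gaussPair (ψ n)) Filter.atTop (nhds (gaussPair φ)) := by
    refine tendsto_integral_of_dominated_convergence _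
      (fun n => (integrable_eul_mul_exp (hψ n)).aestronglyMeasurable)
      (hI1.fun_add (integrable_gaussField d (by omega)))
      (fun n => Filter.Eventually.of_forall fun x => ?_)
      (Filter.Eventually.of_forall fun x => tendsto_nhds_of_eventually_eq ?_)
    · refine le_trans ?_ (add_le_add_left (b1 n x) _)
      have h1 : (eul (ψ n) x) ^ 2 ≤ ‖x‖ ^ 2 * gradDot (ψ n) (ψ n) x := eul_sq_le _ x
      have h2 := gradDot_self_nonneg (ψ n) x
      set G := Real.exp (-‖x‖ ^ 2 / 2)
      rw [Real.norm_eq_abs]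
      refine abs_le_of_sq_le_sq ?_ (by positivity)
      nlinarith [mul_le_mul_of_nonneg_right h1 (sq_nonneg G),
        sq_nonneg (gradDot (ψ n) (ψ n) x - ‖x‖ ^ 2 * G ^ 2),
        mul_nonneg h2 (mul_nonneg (sq_nonneg ‖x‖) (sq_nonneg G))]
    · filter_upwards [e1 x] with n hn
      simp only [eul, hn]
  refine le_of_tendsto_of_tendsto' (((lD.const_mul _).sub (lP.pow 2)).const_mul _)
    ((((lA.add lB).sub (lD.const_mul _))).const_mul _) fun n => ?_
  exact stabConst_mul_le_quadForm hd (hψ n)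

end Approximation

/-! ### From potentials to curl-free fields: choosing the width. -/

section Fields

variable {d : ℕ} {U : Euc d → Euc d} {φ : Euc d → ℝ} {α β : ℝ}

/-- The squared `L²` norm of the field `x e^{-β|x|²}`. -/
noncomputable def expFieldNormSq (d : ℕ) (β : ℝ) : ℝ :=
  ∫ x : Euc d, ‖x‖ ^ 2 * Real.exp (-β * ‖x‖ ^ 2) ^ 2

/-- The `L²` pairing of `U` with the field `x e^{-β|x|²}`. -/
noncomputable def expFieldPair (U : Euc d → Euc d) (β : ℝ) : ℝ :=
  ∫ x, inner ℝ (U x) x * Real.exp (-β * ‖x‖ ^ 2)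

theorem expField_smul (hβ : 0 < β) (x : Euc d) :
    ‖√(1 / (2 * β)) • x‖ ^ 2 * Real.exp (-β * ‖√(1 / (2 * β)) • x‖ ^ 2) ^ 2 =
      1 / (2 * β) * (‖x‖ ^ 2 * Real.exp (-‖x‖ ^ 2 / 2) ^ 2) := by
  rw [norm_smul, mul_pow, Real.norm_of_nonneg (Real.sqrt_nonneg _), Real.sq_sqrt (by positivity)]
  have e : -β * (1 / (2 * β) * ‖x‖ ^ 2) = -‖x‖ ^ 2 / 2 := by
    field_simp
  rw [e]
  ring

theorem integrable_expField (hd : 0 < d) (hβ : 0 < β) :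
    Integrable fun x : Euc d => ‖x‖ ^ 2 * Real.exp (-β * ‖x‖ ^ 2) ^ 2 := by
  have hs : √(1 / (2 * β)) ≠ 0 := (Real.sqrt_pos.2 (by positivity)).ne'
  refine (integrable_comp_smul_iff (volume : Measure (Euc d)) _ hs).1 ?_
  simp only [expField_smul hβ]
  exact (integrable_gaussField d hd).const_mul _

theorem expFieldNormSq_smul (hβ : 0 < β) : |(√(1 / (2 * β)) ^ d)⁻¹| * expFieldNormSq d β =
    1 / (2 * β) * gaussFieldNormSq d := by
  have h := Measure.integral_comp_smul (volume : Measure (Euc d))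
    (fun x : Euc d => ‖x‖ ^ 2 * Real.exp (-β * ‖x‖ ^ 2) ^ 2) √(1 / (2 * β))
  simp only [expField_smul hβ, integral_const_mul, finrank_euclideanSpace, Fintype.card_fin,
    smul_eq_mul] at h
  exact h.symm

theorem expFieldNormSq_pos (hd : 0 < d) (hβ : 0 < β) : 0 < expFieldNormSq d β := by
  have h := expFieldNormSq_smul (d := d) hβ
  have h1 := gaussFieldNormSq_pos hd
  have h2 : 0 < |(√(1 / (2 * β)) ^ d)⁻¹| * expFieldNormSq d β := by
    rw [h]
    positivity
  exact pos_of_mul_pos_right h2 (abs_nonneg _)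

theorem integrable_expFieldPair (hd : 0 < d) (hU : Continuous U)
    (hD : Integrable fun x => ‖U x‖ ^ 2) (hβ : 0 < β) :
    Integrable fun x => inner ℝ (U x) x * Real.exp (-β * ‖x‖ ^ 2) := by
  refine (hD.add (integrable_expField hd hβ)).mono'
    (by fun_prop : Continuous _).aestronglyMeasurable (Filter.Eventually.of_forall fun x => ?_)
  rw [norm_mul, Real.norm_of_nonneg (Real.exp_nonneg _), Real.norm_eq_abs, Pi.add_apply]
  have h1 := abs_real_inner_le_norm (U x) x
  have h2 := mul_le_mul_of_nonneg_right h1 (Real.exp_nonneg (-β * ‖x‖ ^ 2))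
  nlinarith [sq_nonneg (‖U x‖ - ‖x‖ * Real.exp (-β * ‖x‖ ^ 2)), sq_nonneg ‖U x‖,
    sq_nonneg (‖x‖ * Real.exp (-β * ‖x‖ ^ 2))]

theorem integral_norm_sub_sq (hd : 0 < d) (hU : Continuous U)
    (hD : Integrable fun x => ‖U x‖ ^ 2) (α : ℝ) (hβ : 0 < β) :
    ∫ x, ‖U x - (α * Real.exp (-β * ‖x‖ ^ 2)) • x‖ ^ 2 =
      (∫ x, ‖U x‖ ^ 2) - 2 * α * expFieldPair U β + α ^ 2 * expFieldNormSq d β := by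
  have e : ∀ x, ‖U x - (α * Real.exp (-β * ‖x‖ ^ 2)) • x‖ ^ 2 = ‖U x‖ ^ 2 +
      (-(2 * α)) * (inner ℝ (U x) x * Real.exp (-β * ‖x‖ ^ 2)) +
      α ^ 2 * (‖x‖ ^ 2 * Real.exp (-β * ‖x‖ ^ 2) ^ 2) := by
    intro x
    rw [norm_sub_sq_real, inner_smul_right, norm_smul, mul_pow, Real.norm_eq_abs, sq_abs]
    ring
  have h1 := integrable_expFieldPair hd hU hD hβ
  have h2 := integrable_expField hd hβ
  simp only [e]
  rw [integral_add (hD.fun_add (h1.const_mul _)) (h2.const_mul _), integral_add hD (h1.const_mul _),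
    integral_const_mul, integral_const_mul, ← expFieldPair, ← expFieldNormSq]
  ring

theorem expFieldPair_sq_le (hd : 0 < d) (hU : Continuous U)
    (hD : Integrable fun x => ‖U x‖ ^ 2) (hβ : 0 < β) :
    expFieldPair U β ^ 2 ≤ expFieldNormSq d β * ∫ x, ‖U x‖ ^ 2 := by
  have hW := expFieldNormSq_pos hd hβ
  set α := expFieldPair U β / expFieldNormSq d β with hα
  have h1 : 0 ≤ ∫ x, ‖U x - (α * Real.exp (-β * ‖x‖ ^ 2)) • x‖ ^ 2 :=
    integral_nonneg fun x => sq_nonneg _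
  rw [integral_norm_sub_sq hd hU hD α hβ] at h1
  have h2 : expFieldPair U β = α * expFieldNormSq d β := by rw [hα]; field_simp
  rw [h2] at h1 ⊢
  nlinarith

theorem pderivComp_eq_pd (hU : ContDiff ℝ ∞ U) (i j : Fin d) (x : Euc d) :
    pderivComp U i j x = pd i (fun x => U x j) x := by
  have h : HasFDerivAt (fun x => U x j) ((EuclideanSpace.proj (𝕜 := ℝ) j).comp (fderiv ℝ U x)) x :=
    (EuclideanSpace.proj (𝕜 := ℝ) j).hasFDerivAt.comp x
      (differentiable_of_smooth hU x).hasFDerivAt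
  rw [pd, h.fderiv]
  rfl

/-- A smooth curl-free field is a gradient. -/
theorem exists_potential (hU : ContDiff ℝ ∞ U) (hc : ∀ x, curl U x = 0) :
    ∃ φ : Euc d → ℝ, ContDiff ℝ ∞ φ ∧ ∀ i x, pd i φ x = U x i := by
  set w : Euc d → Euc d →L[ℝ] ℝ := fun x => innerSL ℝ (U x) with hw
  have hws : ContDiff ℝ ∞ w := (innerSL ℝ (E := Euc d)).contDiff.comp hU
  have hcomp : ∀ x u v, fderiv ℝ w x u v = ∑ i, ∑ j, u i * v j * pderivComp U i j x := by
    intro x u v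
    have h1 : HasFDerivAt w ((innerSL ℝ (E := Euc d)).comp (fderiv ℝ U x)) x :=
      (innerSL ℝ (E := Euc d)).hasFDerivAt.comp x (differentiable_of_smooth hU x).hasFDerivAt
    have hu : u = ∑ i, u i • EuclideanSpace.single i (1 : ℝ) := by
      ext j
      simp [Finset.sum_apply, Pi.single_apply]
    rw [h1.fderiv]
    conv_lhs => rw [hu]
    simp only [ContinuousLinearMap.comp_apply, map_sum, map_smul, sum_apply, smul_apply, smul_eq_mul, innerSL_apply_apply, PiLp.inner_apply,
      Finset.mul_sum, pderivComp]
    refine Finset.sum_congr rfl fun i _ => Finset.sum_congr rfl fun j _ => ?_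
    simp
    ring
  have hsymm : ∀ i j x, pderivComp U i j x = pderivComp U j i x := fun i j x => by
    have := congrFun (congrFun (hc x) i) j
    simpa [curl, sub_eq_zero] using this
  obtain ⟨φ, hφ⟩ := convex_univ.exists_forall_hasFDerivAt_of_fderiv_symmetric isOpen_univ
    (differentiable_of_smooth hws).differentiableOn fun x _ u v => by
      rw [hcomp, hcomp, Finset.sum_comm]
      refine Finset.sum_congr rfl fun i _ => Finset.sum_congr rfl fun j _ => ?_
      rw [hsymm i j]
      ring
  have hf : fderiv ℝ φ = w := funext fun x => (hφ x trivial).fderiv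
  refine ⟨φ, ?_, fun i x => ?_⟩
  · rw [contDiff_infty_iff_fderiv, hf]
    exact ⟨fun x => (hφ x trivial).differentiableAt, hws⟩
  · rw [pd, hf, hw]
    simp [EuclideanSpace.inner_single_right]

theorem gradNormSq_eq_of_potential (hU : ContDiff ℝ ∞ U) (h : ∀ i x, pd i φ x = U x i) (x : Euc d) :
    gradNormSq U x = ∑ i, ∑ j, pd i (pd j φ) x ^ 2 := by
  simp only [gradNormSq, pderivComp_eq_pd hU]
  refine Finset.sum_congr rfl fun i _ => Finset.sum_congr rfl fun j _ => ?_
  rw [show pd j φ = fun x => U x j from funext (h j)]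

theorem norm_sq_eq_of_potential (h : ∀ i x, pd i φ x = U x i) (x : Euc d) :
    ‖U x‖ ^ 2 = gradDot φ φ x := by
  rw [norm_sq_eq_sum, gradDot]
  exact Finset.sum_congr rfl fun i _ => by rw [h, sq]

theorem inner_eq_of_potential (h : ∀ i x, pd i φ x = U x i) (x : Euc d) :
    inner ℝ (U x) x = eul φ x := by
  rw [PiLp.inner_apply, eul]
  refine Finset.sum_congr rfl fun i _ => ?_
  rw [h]
  simp

theorem IsCurlFreeField.integrable_norm_sq (hU : IsCurlFreeField U) :
    Integrable fun x => ‖U x‖ ^ 2 :=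
  integrable_of_normSq_mul (hU.smooth.continuous.norm.pow 2) (fun _ => sq_nonneg _)
    hU.integrable_weight

/-- The stability inequality with respect to the Gaussian field of a given width. -/
theorem stabConst_mul_le_width (hd : 2 ≤ d) (hU : IsCurlFreeField U) (hβ : 0 < β) :
    stabConst d * (expFieldNormSq d β * (∫ x, ‖U x‖ ^ 2) - expFieldPair U β ^ 2) ≤
      expFieldNormSq d β * (1 / (2 * β) * (∫ x, gradNormSq U x) +
        2 * β * (∫ x, ‖x‖ ^ 2 * ‖U x‖ ^ 2) - ((d : ℝ) + 2) * ∫ x, ‖U x‖ ^ 2) := by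
  obtain ⟨φ, hφ, hpot⟩ := exists_potential hU.smooth hU.curl_eq_zero
  have hA := hU.integrable_grad
  have hB := hU.integrable_weight
  have hW := expFieldNormSq_smul (d := d) hβ
  rw [expFieldPair]
  simp only [gradNormSq_eq_of_potential hU.smooth hpot, norm_sq_eq_of_potential hpot,
    inner_eq_of_potential hpot] at hA hB ⊢
  -- Dilation by s = (2β)^{-1/2} carries e^{-β|x|²} to e^{-|x|²/2}. The Jacobian J cancels in the
  -- end, each side being quadratic in it.
  set s := √(1 / (2 * β)) with hs
  have hs0 : 0 < s := Real.sqrt_pos.2 (by positivity)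
  have hs2 : s ^ 2 = 1 / (2 * β) := Real.sq_sqrt (by positivity)
  set J := |(s ^ d)⁻¹| with hJ
  have hJ0 : 0 < J := abs_pos.2 (by positivity)
  have hcov : ∀ f : Euc d → ℝ, ∫ x, f (s • x) = J * ∫ x, f x := by
    intro f
    have := Measure.integral_comp_smul (volume : Measure (Euc d)) f s
    simpa only [finrank_euclideanSpace, Fintype.card_fin, smul_eq_mul] using this
  set ψ : Euc d → ℝ := fun x => φ (s • x) with hψ
  have hψs : ContDiff ℝ ∞ ψ := hφ.comp (contDiff_const_smul s)
  have h1 : ∀ i x, pd i ψ x = s * pd i φ (s • x) := fun i x => pd_comp_smul hφ s i x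
  have h2 : ∀ i j x, pd i (pd j ψ) x = s ^ 2 * pd i (pd j φ) (s • x) := by
    intro i j x
    rw [show pd j ψ = fun x => s * pd j φ (s • x) from funext (h1 j),
      pd_const_mul (φ := fun x => pd j φ (s • x))
        ((contDiff_pd hφ j).comp (contDiff_const_smul s))]
    beta_reduce
    rw [pd_comp_smul (contDiff_pd hφ j)]
    ring
  have e1 : ∀ x, gradDot ψ ψ x = s ^ 2 * gradDot φ φ (s • x) := by
    intro x
    simp only [gradDot, h1, Finset.mul_sum]
    exact Finset.sum_congr rfl fun i _ => by ring
  have e2 : ∀ x, ‖x‖ ^ 2 * gradDot ψ ψ x = ‖s • x‖ ^ 2 * gradDot φ φ (s • x) := by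
    intro x
    rw [e1, norm_smul, Real.norm_of_nonneg hs0.le]
    ring
  have e3 : ∀ x, ∑ i, ∑ j, pd i (pd j ψ) x ^ 2 = s ^ 4 * ∑ i, ∑ j, pd i (pd j φ) (s • x) ^ 2 := by
    intro x
    simp only [h2, Finset.mul_sum]
    exact Finset.sum_congr rfl fun i _ => Finset.sum_congr rfl fun j _ => by ring
  have e4 : ∀ x, eul ψ x * Real.exp (-‖x‖ ^ 2 / 2) =
      eul φ (s • x) * Real.exp (-β * ‖s • x‖ ^ 2) := by
    intro x
    have h3 : -β * ‖s • x‖ ^ 2 = -‖x‖ ^ 2 / 2 := by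
      rw [norm_smul, mul_pow, Real.norm_of_nonneg hs0.le, hs2]
      field_simp
    rw [h3]
    congr 1
    simp only [eul, h1, PiLp.smul_apply, smul_eq_mul]
    exact Finset.sum_congr rfl fun i _ => by ring
  have key := stabConst_mul_le_of_integrable hd hψs
    (by
      simp only [e3]
      exact ((integrable_comp_smul_iff (volume : Measure (Euc d)) _ hs0.ne').2 hA).const_mul _)
    (by
      simp only [e2]
      exact (integrable_comp_smul_iff (volume : Measure (Euc d)) _ hs0.ne').2 hB)
  rw [gaussPair] at key
  simp only [e2, e3, e4] at key
  simp only [e1, integral_const_mul] at key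
  rw [hcov (gradDot φ φ), hcov fun x => ‖x‖ ^ 2 * gradDot φ φ x,
    hcov fun x => ∑ i, ∑ j, pd i (pd j φ) x ^ 2,
    hcov fun x => eul φ x * Real.exp (-β * ‖x‖ ^ 2)] at key
  rw [← hs2] at hW ⊢
  have hβs : 2 * β = 1 / s ^ 2 := by rw [hs2]; field_simp
  rw [hβs]
  set A := ∫ x, ∑ i, ∑ j, pd i (pd j φ) x ^ 2
  set B := ∫ x, ‖x‖ ^ 2 * gradDot φ φ x
  set D := ∫ x, gradDot φ φ x
  set P := ∫ x, eul φ x * Real.exp (-β * ‖x‖ ^ 2)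
  set W := expFieldNormSq d β
  have hvn : gaussFieldNormSq d = J * W / s ^ 2 := by
    rw [hW]
    field_simp
  rw [hvn] at key
  have hJ2 : 0 < J ^ 2 := by positivity
  refine le_of_mul_le_mul_left ?_ hJ2
  refine le_trans (le_of_eq ?_) (key.trans (le_of_eq ?_))
  · field_simp
  · field_simp

/-- The deficit controls the distance to the line spanned by a suitable Gaussian field. -/
theorem exists_width (hd : 2 ≤ d) (hU : IsCurlFreeField U) : ∃ β, 0 < β ∧
    stabConst d / 2 * ((∫ x, ‖U x‖ ^ 2) - expFieldPair U β ^ 2 / expFieldNormSq d β) ≤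
      deficit3 U := by
  have hd0 : 0 < d := by omega
  have hc := hU.smooth.continuous
  have hD := hU.integrable_norm_sq
  have hC0 := stabConst_nonneg hd
  set A := ∫ x, gradNormSq U x with hA
  set B := ∫ x, ‖x‖ ^ 2 * ‖U x‖ ^ 2 with hB
  set D := ∫ x, ‖U x‖ ^ 2 with hDdef
  have hA0 : 0 ≤ A := integral_nonneg fun x =>
    Finset.sum_nonneg fun _ _ => Finset.sum_nonneg fun _ _ => sq_nonneg _
  have hB0 : 0 ≤ B := integral_nonneg fun x => mul_nonneg (sq_nonneg _) (sq_nonneg _)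
  have hD0 : 0 ≤ D := integral_nonneg fun x => sq_nonneg _
  have hle : ∀ β, 0 < β → stabConst d * (D - expFieldPair U β ^ 2 / expFieldNormSq d β) ≤
      1 / (2 * β) * A + 2 * β * B - ((d : ℝ) + 2) * D := by
    intro β hβ
    have hW := expFieldNormSq_pos hd0 hβ
    refine le_of_mul_le_mul_left (le_trans (le_of_eq ?_) (stabConst_mul_le_width hd hU hβ)) hW
    rw [← hDdef]
    field_simp
  have hnn : ∀ β, 0 < β → 0 ≤ D - expFieldPair U β ^ 2 / expFieldNormSq d β := by
    intro β hβ
    rw [sub_nonneg, div_le_iff₀ (expFieldNormSq_pos hd0 hβ), mul_comm]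
    exact expFieldPair_sq_le hd0 hc hD hβ
  have hlow : ∀ β, 0 < β → ((d : ℝ) + 2) * D ≤ 1 / (2 * β) * A + 2 * β * B := fun β hβ => by
    have := mul_nonneg hC0 (hnn β hβ)
    linarith [hle β hβ]
  -- If A or B vanishes the optimal width degenerates. A small β when A = 0, or a large one when B =
  -- 0, would violate `hlow` unless D = 0.
  rcases hA0.eq_or_lt with h | hApos
  · have hD' : D = 0 := by
      by_contra hne
      have hDp : 0 < D := lt_of_le_of_ne hD0 (Ne.symm hne)
      have h1 := hlow (D / (2 * (B + 1))) (by positivity)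
      rw [← h, mul_zero, zero_add] at h1
      have h2 : 2 * (D / (2 * (B + 1))) * B ≤ D := by
        have : 2 * (D / (2 * (B + 1))) * B = D * (B / (B + 1)) := by field_simp
        rw [this]
        exact mul_le_of_le_one_right hD0 ((div_le_one (by positivity)).2 (by linarith))
      nlinarith [(Nat.cast_nonneg d : (0 : ℝ) ≤ d)]
    refine ⟨1, one_pos, ?_⟩
    have h1 := hnn 1 one_pos
    have h2 : 0 ≤ expFieldPair U 1 ^ 2 / expFieldNormSq d 1 :=
      div_nonneg (sq_nonneg _) (expFieldNormSq_pos hd0 one_pos).le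
    have h3 : D - expFieldPair U 1 ^ 2 / expFieldNormSq d 1 = 0 := by linarith
    rw [h3, deficit3, ← hA, ← h, ← hDdef, hD']
    simp
  rcases hB0.eq_or_lt with h | hBpos
  · have hD' : D = 0 := by
      by_contra hne
      have hDp : 0 < D := lt_of_le_of_ne hD0 (Ne.symm hne)
      have h1 := hlow (A / (2 * D)) (by positivity)
      rw [← h, mul_zero, add_zero] at h1
      have h2 : 1 / (2 * (A / (2 * D))) * A = D := by field_simp
      nlinarith [(Nat.cast_nonneg d : (0 : ℝ) ≤ d)]
    refine ⟨1, one_pos, ?_⟩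
    have h1 := hnn 1 one_pos
    have h2 : 0 ≤ expFieldPair U 1 ^ 2 / expFieldNormSq d 1 :=
      div_nonneg (sq_nonneg _) (expFieldNormSq_pos hd0 one_pos).le
    have h3 : D - expFieldPair U 1 ^ 2 / expFieldNormSq d 1 = 0 := by linarith
    rw [h3, deficit3, ← hB, ← h, ← hDdef, hD']
    simp
  · have ha : 0 < √A := Real.sqrt_pos.2 hApos
    have hb : 0 < √B := Real.sqrt_pos.2 hBpos
    -- This β minimises A/(2β) + 2βB, with minimum 2√A√B.
    refine ⟨√A / √B / 2, by positivity, ?_⟩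
    have h1 := hle (√A / √B / 2) (by positivity)
    have h2 : 1 / (2 * (√A / √B / 2)) * A + 2 * (√A / √B / 2) * B = 2 * (√A * √B) := by
      have hA2 := Real.sq_sqrt hA0
      have hB2 := Real.sq_sqrt hB0
      field_simp
      nlinarith
    rw [h2] at h1
    rw [deficit3, ← hA, ← hB, ← hDdef]
    linarith

theorem bddBelow_distSq (p : (Euc d → Euc d) → Prop) :
    BddBelow {t : ℝ | ∃ V ∈ ECFHUP d, p V ∧ t = ∫ x, ‖U x - V x‖ ^ 2} := by
  refine ⟨0, ?_⟩
  rintro _ ⟨V, -, -, rfl⟩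
  exact integral_nonneg fun x => sq_nonneg _

/-- The multiple P/W of the Gaussian is the orthogonal projection of U, at squared distance D -
P²/W, the quantity that `exists_width` controls. -/
theorem stabConst_mul_distSqE_le (hd : 2 ≤ d) (hU : IsCurlFreeField U) :
    stabConst d / 2 * distSqE U ≤ deficit3 U := by
  have hd0 : 0 < d := by omega
  obtain ⟨β, hβ, h⟩ := exists_width hd hU
  have hW := expFieldNormSq_pos hd0 hβ
  refine (mul_le_mul_of_nonneg_left ?_ (by linarith [stabConst_nonneg hd])).trans h
  refine csInf_le ⟨0, ?_⟩ (Set.mem_ofPred.2 ⟨fun x =>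
    (expFieldPair U β / expFieldNormSq d β * Real.exp (-β * ‖x‖ ^ 2)) • x,
    ⟨_, β, hβ, rfl⟩, ?_⟩)
  · rintro _ ⟨V, -, rfl⟩
    exact integral_nonneg fun x => sq_nonneg _
  · rw [integral_norm_sub_sq hd0 hU.smooth.continuous hU.integrable_norm_sq _ hβ]
    field_simp
    ring

/-- A multiple t of the Gaussian with the norm of U is at squared distance 2(D - tP). With the sign
of P, Cauchy-Schwarz gives tP ≥ P²/W, so this is at most twice the squared distance to the line;
hence C/4 in place of C/2. -/
theorem stabConst_mul_distSqENormalized_le (hd : 2 ≤ d) (hU : IsCurlFreeField U) :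
    stabConst d / 4 * distSqENormalized U ≤ deficit3 U := by
  have hd0 : 0 < d := by omega
  obtain ⟨β, hβ, h⟩ := exists_width hd hU
  have hW := expFieldNormSq_pos hd0 hβ
  have hc := hU.smooth.continuous
  have hDi := hU.integrable_norm_sq
  have hcs := expFieldPair_sq_le hd0 hc hDi hβ
  set W := expFieldNormSq d β with hWdef
  set P := expFieldPair U β with hP
  set D := ∫ x, ‖U x‖ ^ 2 with hD
  have hD0 : 0 ≤ D := integral_nonneg fun x => sq_nonneg _
  obtain ⟨t, ht, htP⟩ : ∃ t : ℝ, t ^ 2 * W = D ∧ P ^ 2 / W ≤ t * P := by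
    have h1 : √(D / W) ^ 2 * W = D := by
      rw [Real.sq_sqrt (by positivity)]
      field_simp
    have h2 : |P| / W ≤ √(D / W) := by
      refine Real.le_sqrt_of_sq_le ?_
      rw [div_pow, sq_abs, div_le_div_iff₀ (by positivity) hW]
      nlinarith
    have h3 : P ^ 2 / W ≤ √(D / W) * |P| := by
      have := mul_le_mul_of_nonneg_right h2 (abs_nonneg P)
      rwa [div_mul_eq_mul_div, abs_mul_abs_self, ← sq] at this
    rcases abs_choice P with hp | hp
    · exact ⟨√(D / W), h1, by rwa [hp] at h3⟩
    · refine ⟨-√(D / W), by rw [neg_sq, h1], ?_⟩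
      rw [hp] at h3
      linarith
  have hdist : distSqENormalized U ≤ 2 * (D - P ^ 2 / W) := by
    have hV : (∫ x : Euc d, ‖(t * Real.exp (-β * ‖x‖ ^ 2)) • x‖ ^ 2) = D := by
      rw [← ht, hWdef, expFieldNormSq, ← integral_const_mul]
      congr 1
      funext x
      rw [norm_smul, mul_pow, Real.norm_eq_abs, sq_abs]
      ring
    have hle : distSqENormalized U ≤
        ∫ x, ‖U x - (t * Real.exp (-β * ‖x‖ ^ 2)) • x‖ ^ 2 :=
      csInf_le (bddBelow_distSq fun V => (∫ x, ‖U x‖ ^ 2) = ∫ x, ‖V x‖ ^ 2)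
        (Set.mem_ofPred.2 ⟨fun x => (t * Real.exp (-β * ‖x‖ ^ 2)) • x, ⟨t, β, hβ, rfl⟩, hV.symm, rfl⟩)
    rw [integral_norm_sub_sq hd0 hc hDi t hβ, ← hWdef, ← hP, ← hD, ht] at hle
    linarith
  have := mul_le_mul_of_nonneg_left hdist (by linarith [stabConst_nonneg hd] : 0 ≤ stabConst d / 4)
  linarith

end Fields

/-! ### Sharpness: potentials built on higher harmonics. -/

section Sharpness

variable {d : ℕ}

/-- The real part of `(xᵢ + √-1 xⱼ)^k`. -/
noncomputable def planeRe (i j : Fin d) (k : ℕ) (x : Euc d) : ℝ := ((⟨x i, x j⟩ : ℂ) ^ k).re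

/-- The imaginary part of `(xᵢ + √-1 xⱼ)^k`. -/
noncomputable def planeIm (i j : Fin d) (k : ℕ) (x : Euc d) : ℝ := ((⟨x i, x j⟩ : ℂ) ^ k).im

theorem planeRe_succ (i j : Fin d) (k : ℕ) : planeRe i j (k + 1) =
    fun x => x i * planeRe i j k x - x j * planeIm i j k x := by
  funext x
  simp only [planeRe, planeIm, pow_succ, Complex.mul_re]
  ring

theorem planeIm_succ (i j : Fin d) (k : ℕ) : planeIm i j (k + 1) =
    fun x => x i * planeIm i j k x + x j * planeRe i j k x := by
  funext x
  simp only [planeRe, planeIm, pow_succ, Complex.mul_im]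
  ring

theorem planeRe_zero (i j : Fin d) : planeRe i j 0 = fun _ => 1 := by
  funext x
  simp [planeRe]

theorem planeIm_zero (i j : Fin d) : planeIm i j 0 = fun _ => 0 := by
  funext x
  simp [planeIm]

theorem contDiff_plane (i j : Fin d) (k : ℕ) :
    ContDiff ℝ ∞ (planeRe i j k) ∧ ContDiff ℝ ∞ (planeIm i j k) := by
  induction k with
  | zero =>
    rw [planeRe_zero, planeIm_zero]
    exact ⟨contDiff_const, contDiff_const⟩
  | succ k ih =>
    rw [planeRe_succ, planeIm_succ]
    exact ⟨((contDiff_coord i).mul ih.1).sub ((contDiff_coord j).mul ih.2),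
      ((contDiff_coord i).mul ih.2).add ((contDiff_coord j).mul ih.1)⟩

/-- The rule (z^{k+1})' = (k+1)z^k for z = xᵢ + √-1 xⱼ, in real and imaginary parts. -/
theorem pd_plane (i j : Fin d) (k : ℕ) (l : Fin d) (x : Euc d) :
    pd l (planeRe i j (k + 1)) x = (k + 1) * ((if l = i then planeRe i j k x else 0) -
        if l = j then planeIm i j k x else 0) ∧
      pd l (planeIm i j (k + 1)) x = (k + 1) * ((if l = i then planeIm i j k x else 0) +
        if l = j then planeRe i j k x else 0) := by
  have hs := contDiff_plane i j
  have step : ∀ m, pd l (planeRe i j (m + 1)) x =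
      (if l = i then 1 else 0) * planeRe i j m x + x i * pd l (planeRe i j m) x -
        ((if l = j then 1 else 0) * planeIm i j m x + x j * pd l (planeIm i j m) x) ∧
      pd l (planeIm i j (m + 1)) x =
      (if l = i then 1 else 0) * planeIm i j m x + x i * pd l (planeIm i j m) x +
        ((if l = j then 1 else 0) * planeRe i j m x + x j * pd l (planeRe i j m) x) := by
    intro m
    rw [planeRe_succ, planeIm_succ,
      pd_sub ((contDiff_coord i).mul (hs m).1) ((contDiff_coord j).mul (hs m).2),
      pd_add ((contDiff_coord i).mul (hs m).2) ((contDiff_coord j).mul (hs m).1),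
      pd_mul (contDiff_coord i) (hs m).1, pd_mul (contDiff_coord j) (hs m).2,
      pd_mul (contDiff_coord i) (hs m).2, pd_mul (contDiff_coord j) (hs m).1]
    simp only [pd_coord, and_self]
  induction k with
  | zero =>
    rw [(step 0).1, (step 0).2]
    simp [planeRe_zero, planeIm_zero, pd_const]
  | succ k ih =>
    rw [(step (k + 1)).1, (step (k + 1)).2, ih.1, ih.2, planeRe_succ, planeIm_succ]
    push_cast
    constructor <;> split_ifs <;> ring

/-- A holomorphic power of one plane variable is harmonic in all of ℝ^d, which supplies a solid
harmonic of every positive degree as soon as d ≥ 2. -/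
theorem isSolidHarmonic_planeRe {i j : Fin d} (hij : i ≠ j) (k : ℕ) :
    IsSolidHarmonic (k + 1) (planeRe i j (k + 1)) where
  smooth := (contDiff_plane i j _).1
  harmonic x := by
    have h1 : ∀ l, pd l (planeRe i j (k + 1)) = fun x =>
        ((k + 1) * (if l = i then 1 else 0)) * planeRe i j k x -
          ((k + 1) * (if l = j then 1 else 0)) * planeIm i j k x := by
      intro l
      funext x
      rw [(pd_plane i j k l x).1]
      split_ifs <;> ring
    have h2 : ∀ l, pd l (pd l (planeRe i j (k + 1))) x =
        ((k + 1) * (if l = i then 1 else 0)) * pd l (planeRe i j k) x -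
          ((k + 1) * (if l = j then 1 else 0)) * pd l (planeIm i j k) x := by
      intro l
      rw [h1, pd_sub (contDiff_const.mul (contDiff_plane i j k).1)
        (contDiff_const.mul (contDiff_plane i j k).2), pd_const_mul (contDiff_plane i j k).1,
        pd_const_mul (contDiff_plane i j k).2]
    simp only [lap, h2]
    cases k with
    | zero => simp [planeRe_zero, planeIm_zero, pd_const]
    | succ k =>
      simp only [(pd_plane i j k _ x).1, (pd_plane i j k _ x).2]
      rw [Finset.sum_sub_distrib]
      simp [hij, hij.symm]
  homogeneous r x := by
    have h : (⟨(r • x) i, (r • x) j⟩ : ℂ) = (r : ℂ) * ⟨x i, x j⟩ := by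
      apply Complex.ext <;> simp
    simp only [planeRe]
    rw [h, mul_pow, ← Complex.ofReal_pow, Complex.re_ofReal_mul]
  euler x := by
    have h : eul (planeRe i j (k + 1)) x = ((k + 1 : ℕ) : ℝ) *
        (x i * planeRe i j k x - x j * planeIm i j k x) := by
      simp only [eul, (pd_plane i j k _ x).1]
      have : ∀ l, x l * ((k + 1) * ((if l = i then planeRe i j k x else 0) -
          if l = j then planeIm i j k x else 0)) = (k + 1) * ((if l = i then x l * planeRe i j k x
            else 0) - if l = j then x l * planeIm i j k x else 0) := by
        intro l
        split_ifs <;> ring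
      simp only [this]
      rw [← Finset.mul_sum, Finset.sum_sub_distrib]
      simp
    rw [h, planeRe_succ]

/-- Rotation in the plane multiplies z^{k+1} by (k+1)√-1, so the real part is a multiple of the
rotated imaginary part. -/
theorem sphInt_planeRe {i j : Fin d} (hij : i ≠ j) (k : ℕ) :
    sphInt (planeRe i j (k + 1)) = 0 := by
  have h := sphInt_rot (contDiff_plane i j (k + 1)).2 i j
  have e : rot i j (planeIm i j (k + 1)) = fun x => ((k : ℝ) + 1) * planeRe i j (k + 1) x := by
    funext x
    rw [rot, (pd_plane i j k _ x).2, (pd_plane i j k _ x).2, planeRe_succ]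
    simp [hij, hij.symm]
    ring
  rw [e, sphInt_const_mul] at h
  exact (mul_eq_zero.1 h).resolve_left (by positivity)

theorem harmonicRatio_planeRe_pos {i j : Fin d} (hij : i ≠ j) (k : ℕ) :
    0 < harmonicRatio (k + 1) (planeRe i j (k + 1)) := by
  have hY := isSolidHarmonic_planeRe hij k
  refine lt_of_le_of_ne (harmonicRatio_nonneg _ _) fun h0 => ?_
  obtain ⟨χ, hχ, hχ1, hχ2, hχ0, -⟩ := exists_cutoff
  have hR : ∀ r, 2 ≤ r → χ r = 0 := fun r hr => hχ2 r (hr.trans (le_abs_self r))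
  have h1 := integral_harmonic_sq i.pos hY hχ.continuous hR
  rw [← h0, zero_mul] at h1
  have hχc : Continuous fun x : Euc d => χ ‖x‖ := hχ.continuous.comp continuous_norm
  have hc : Continuous fun x => planeRe i j (k + 1) x ^ 2 * χ ‖x‖ :=
    (hY.smooth.continuous.pow 2).mul hχc
  have hi : Integrable fun x => planeRe i j (k + 1) x ^ 2 * χ ‖x‖ :=
    hc.integrable_of_hasCompactSupport (hasCompactSupport_comp_norm hR).mul_left
  have h2 := (integral_eq_zero_iff_of_nonneg
    (fun x => mul_nonneg (sq_nonneg _) (hχ0 _)) hi).1 h1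
  have h3 := Measure.eq_of_ae_eq h2 hc continuous_const
  -- At the i-th basis vector z = 1 and the cutoff is 1, so the integrand is not identically zero.
  have h4 := congrFun h3 (EuclideanSpace.single i (1 : ℝ))
  have h5 : (⟨1, 0⟩ : ℂ) = 1 := rfl
  simp [planeRe, hij.symm, hχ1, h5] at h4

/-- The gradient of a function as a vector field. -/
noncomputable def gradField (φ : Euc d → ℝ) (x : Euc d) : Euc d := WithLp.toLp 2 fun i => pd i φ x

theorem gradField_apply (φ : Euc d → ℝ) (i : Fin d) (x : Euc d) :
    pd i φ x = gradField φ x i := rfl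

theorem contDiff_gradField {φ : Euc d → ℝ} (hφ : ContDiff ℝ ∞ φ) : ContDiff ℝ ∞ (gradField φ) :=
  contDiff_euclidean.2 fun i => contDiff_pd hφ i

theorem isCurlFreeField_gradField {φ : Euc d → ℝ} (hφ : IsTest φ) :
    IsCurlFreeField (gradField φ) where
  smooth := contDiff_gradField hφ.smooth
  curl_eq_zero x := by
    ext i j
    simp only [curl, Matrix.of_apply, pderivComp_eq_pd (contDiff_gradField hφ.smooth),
      ← gradField_apply]
    rw [show pd i (fun x => pd j φ x) = pd i (pd j φ) from rfl, pd_comm hφ.smooth]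
    exact sub_self _
  integrable_grad := by
    simp only [gradNormSq_eq_of_potential (contDiff_gradField hφ.smooth) (gradField_apply φ), sq]
    exact integrable_finsetSum _ fun i _ => integrable_finsetSum _ fun j _ =>
      ((hφ.pd j).pd i).integrable_mul ((hφ.pd j).pd i).continuous
  integrable_weight := by
    simp only [norm_sq_eq_of_potential (gradField_apply φ)]
    exact ((hφ.gradDot hφ).mul_left contDiff_normSq).integrable

theorem hasCompactSupport_gradField {φ : Euc d → ℝ} (hφ : IsTest φ) :
    HasCompactSupport (gradField φ) := by
  refine HasCompactSupport.intro hφ.compact.isCompact fun x hx => ?_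
  ext i
  rw [← gradField_apply]
  by_contra h
  exact hx (tsupport_fderiv_apply_subset ℝ _ (subset_tsupport _ h))

/-- Arithmetic-geometric mean: the product of the square roots is at most half the sum. Sharpness
needs only this direction, so no dilation is required. -/
theorem deficit3_gradField_le {φ : Euc d → ℝ} (hφ : IsTest φ) :
    deficit3 (gradField φ) ≤ 1 / 2 * quadForm ((d : ℝ) + 2) φ := by
  rw [deficit3, quadForm]
  simp only [gradNormSq_eq_of_potential (contDiff_gradField hφ.smooth) (gradField_apply φ),
    norm_sq_eq_of_potential (gradField_apply φ), integral_hessian_sq hφ]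
  have hA : 0 ≤ ∫ x, lap φ x ^ 2 := integral_nonneg fun x => sq_nonneg _
  have hB : 0 ≤ ∫ x, ‖x‖ ^ 2 * gradDot φ φ x :=
    integral_nonneg fun x => mul_nonneg (sq_nonneg _) (gradDot_self_nonneg _ _)
  nlinarith [Real.sq_sqrt hA, Real.sq_sqrt hB,
    sq_nonneg (√(∫ x, lap φ x ^ 2) - √(∫ x, ‖x‖ ^ 2 * gradDot φ φ x))]

/-- For a field orthogonal to every Gaussian, Pythagoras gives ‖U - V‖² = ‖U‖² + ‖V‖² for each
competitor V. -/
theorem le_distSqE {U : Euc d → Euc d} (hd : 0 < d) (hU : Continuous U)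
    (hD : Integrable fun x => ‖U x‖ ^ 2) (h : ∀ β, 0 < β → expFieldPair U β = 0) :
    ∫ x, ‖U x‖ ^ 2 ≤ distSqE U := by
  refine le_csInf ⟨_, Set.mem_ofPred.2 ⟨_, ⟨0, 1, one_pos, rfl⟩, rfl⟩⟩ ?_
  rintro _ ⟨_, ⟨α, β, hβ, rfl⟩, rfl⟩
  rw [integral_norm_sub_sq hd hU hD α hβ, h β hβ]
  nlinarith [mul_nonneg (sq_nonneg α) (expFieldNormSq_pos hd hβ).le]

/-- Fields built on higher harmonics with nearly optimal profiles. -/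
theorem exists_deficit3_lt (hd : 2 ≤ d) {K : ℝ} (hK : stabConst d / 2 < K) :
    ∃ U : Euc d → Euc d, IsCurlFreeField U ∧ HasCompactSupport U ∧
      deficit3 U < K * distSqE U := by
  have hd0 : 0 < d := by omega
  -- The constant 2K matches the factor ½ lost in bounding the deficit by half the form.
  obtain ⟨m, hm, u, hu, hlt⟩ := exists_radialNum_lt (N := d) (c := 2 * K) (by linarith)
  obtain ⟨k, rfl⟩ : ∃ k, m = k + 1 := ⟨m - 1, by omega⟩
  set i₀ : Fin (d + 2 * (k + 1)) := ⟨0, by omega⟩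
  obtain ⟨hv, hvu⟩ := EvenSmooth.of_radial i₀ hu.smooth hu.radial
  set v : ℝ → ℝ := fun r => u (EuclideanSpace.single i₀ r) with hvdef
  obtain ⟨R, hR0, hR'⟩ := hu.compactSupport.exists_pos_le_norm
  have hR : ∀ r, R ≤ r → v r = 0 := fun r hr => hR' _ (by
    have h : ‖EuclideanSpace.single i₀ r‖ = ‖r‖ := by simp
    rw [h, Real.norm_of_nonneg (hR0.le.trans hr)]
    exact hr)
  have hue : u = fun x => v ‖x‖ := funext hvu
  rw [hue] at hlt
  set i : Fin d := ⟨0, by omega⟩ with hi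
  set j : Fin d := ⟨1, by omega⟩ with hj
  have hij : i ≠ j := by simp [hi, hj]
  have hY := isSolidHarmonic_planeRe hij k
  have ht := hY.isTest_mul_radial hv hR
  set φ : Euc d → ℝ := fun x => planeRe i j (k + 1) x * v ‖x‖ with hφ
  have hU := isCurlFreeField_gradField ht
  refine ⟨gradField φ, hU, hasCompactSupport_gradField ht, ?_⟩
  have hκ := harmonicRatio_planeRe_pos hij k
  have hdist : ∫ x, gradDot φ φ x ≤ distSqE (gradField φ) := by
    have h := le_distSqE hd0 hU.smooth.continuous hU.integrable_norm_sq fun β hβ => ?_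
    · simpa only [norm_sq_eq_of_potential (gradField_apply φ)] using h
    · have hint := integrable_expFieldPair hd0 hU.smooth.continuous hU.integrable_norm_sq hβ
      rw [expFieldPair]
      simp only [inner_eq_of_potential (gradField_apply φ)] at hint ⊢
      rw [integral_polar hd0 hint]
      refine setIntegral_eq_zero_of_forall_eq_zero fun r hr => ?_
      -- On each sphere x·∇φ is a multiple of a harmonic of positive degree, which has zero mean;
      -- the pairing with radial Gaussians thus vanishes for every width.
      have e : sphInt (fun x : Euc d => eul φ (r • x) * Real.exp (-β * ‖r • x‖ ^ 2)) =
          r ^ (k + 1) * ((((k + 1 : ℕ) : ℝ) * v r + r ^ 2 * rdiv v r) * Real.exp (-β * r ^ 2)) *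
            sphInt (planeRe i j (k + 1)) := by
        rw [← sphInt_const_mul]
        refine sphInt_congr fun x hx => ?_
        rw [hφ, hY.eul_mul_radial hv, hY.homogeneous, norm_smul, hx, mul_one,
          Real.norm_of_nonneg (le_of_lt hr)]
        ring
      rw [e, sphInt_planeRe hij, mul_zero, mul_zero]
  have hK0 : 0 ≤ K := by linarith [stabConst_nonneg hd]
  refine lt_of_lt_of_le ?_ (mul_le_mul_of_nonneg_left hdist hK0)
  refine (deficit3_gradField_le ht).trans_lt ?_
  rw [hφ, quadForm_harmonic hd0 hY hv hR, integral_gradDot_harmonic hd0 hY hv hR]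
  have h1 := mul_lt_mul_of_pos_left hlt hκ
  linarith

end Sharpness

theorem mainTheorem5 (N : ℕ) (hN : 2 ≤ N) :
    (∀ U : Euc N → Euc N, IsCurlFreeField U →
      stabConst N / 2 * distSqE U ≤ deficit3 U) ∧
    (∀ K : ℝ, stabConst N / 2 < K →
      ∃ U : Euc N → Euc N, IsCurlFreeField U ∧ HasCompactSupport U ∧
        deficit3 U < K * distSqE U) ∧
    (∀ U : Euc N → Euc N, IsCurlFreeField U →
      stabConst N / 4 * distSqENormalized U ≤ deficit3 U) :=
  ⟨fun _ hU => stabConst_mul_distSqE_le hN hU, fun _ hK => exists_deficit3_lt hN hK,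
    fun _ hU => stabConst_mul_distSqENormalized_le hN hU⟩
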